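/- \textbf{Theorem (McIntosh).} Let $X$ be a complex separable Hilbert space and let $A$ generate a strongly continuous, exponentially stable semigroup $(T(t))_{t\ge 0}$ on $X$. A linear operator $C$ whose domain contains $D(A)$ and with values in $X$ is called (infinite-time) admissible for $(T(t))_{t\ge0}$ if $CT(\cdot)x\in L^2((0,\infty);X)$ for all $x\in D(A)$ and there is a constant $m$ with $\int_0^\infty\|CT(t)x\|^2\,dt\le m\|x\|^2$ for all $x\in D(A)$. For $\alpha>0$, $(-A)^{\alpha}$ is the inverse of the injective bounded operator $(-A)^{-\alpha}x=\Gamma(\alpha)^{-1}\int_0^\infty t^{\alpha-1}T(t)x\,dt$, and $(-A^*)^{\alpha}$ is defined in the same way from the adjoint semigroup $(T(t)^*)_{t\ge0}$, whose generator is $A^*$. Let $\mathcal H_\infty^-$ be the algebra of bounded analytic functions on $\{s\in\mathbb C:\operatorname{Re}s<0\}$, with the supremum norm $\|\cdot\|_\infty$. For $g\in\mathcal H_\infty^-$ let $M_g$ be the operator $M_gf=\mathcal L^{-1}\Pi(g\,\mathcal Lf)$ on $L^2((0,\infty);X)$, where $\mathcal L$ is the Laplace transform, $g$ and $\mathcal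 Lf$ are identified with their boundary functions on the imaginary axis, and $\Pi$ is the orthogonal projection of $L^2(i\mathbb R;X)$ onto the (boundary functions of) Laplace transforms of functions in $L^2((0,\infty);X)$. Let $g(A)$ denote the admissible linear operator from $D(A)$ to $X$, bounded for the graph norm, such that $M_g(T(\cdot)x)=g(A)T(\cdot)x$ in $L^2((0,\infty);X)$ for all $x\in D(A)$. Suppose that $(-A)^{1/2}$ is admissible for $(T(t))_{t\ge0}$ and that $(-A^*)^{1/2}$ is admissible for $(T(t)^*)_{t\ge0}$. Then for every $g\in\mathcal H_\infty^-$ the operator $g(A)$ exists, is unique, and is bounded: $\|g(A)x\|\le K_g\|x\|$ for all $x\in D(A)$, with a constant $K_g$. Thus the semigroup has a bounded $\mathcal H_\infty^-$-calculus: extending each $g(A)$ to a bounded operator on $X$, the map $g\mapsto g(A)$ is a unital algebra homomorphism from $\mathcal H_\infty^-$ to the bounded operators on $X$, there is a constant $K$ with $\|g(A)\|\le K\|g\|_\infty$ for all $g\in\mathcal H_\infty^-$, and $g(A)=(A-aI)^{-1}$ for $g(s)=(s-a)^{-1}$ with $\operatorname{Re}a>0$. -/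

import Mathlib

open MeasureTheory Set Filter Topology FourierTransform
open scoped ENNReal LinearPMap InnerProductSpace

noncomputable section

/-! ### Semigroups, generators, fractional powers, admissibility

A semigroup is a family `T : ℝ → X →L[ℂ] X` of which only the values at `t ≥ 0` are ever used. -/

section Semigroup

variable {X : Type*} [NormedAddCommGroup X] [InnerProductSpace ℂ X]

/-- `(T(t))_{t ≥ 0}` is a strongly continuous semigroup of bounded operators. -/
structure IsC0Semigroup (T : ℝ → X →L[ℂ] X) : Prop where
  map_zero : T 0 = 1
  map_add : ∀ s t : ℝ, 0 ≤ s → 0 ≤ t → T (s + t) = T s * T t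
  tendsto_zero : ∀ x : X, Tendsto (fun t => T t x) (𝓝[>] 0) (𝓝 x)

/-- Exponential stability: `‖T(t)‖ ≤ M e^{-ωt}` for all `t ≥ 0`, for some `M` and some `ω > 0`. -/
def IsExponentiallyStable (T : ℝ → X →L[ℂ] X) : Prop :=
  ∃ M ω : ℝ, 0 < ω ∧ ∀ t : ℝ, 0 ≤ t → ‖T t‖ ≤ M * Real.exp (-ω * t)

/-- The graph of the infinitesimal generator: all `(x, y)` with `(T(t)x - x)/t → y` as `t ↓ 0`. -/
def generatorGraph (T : ℝ → X →L[ℂ] X) : Submodule ℂ (X × X) where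
  carrier := {p | Tendsto (fun t : ℝ => ((t : ℂ)⁻¹) • (T t p.1 - p.1)) (𝓝[>] 0) (𝓝 p.2)}
  add_mem' := by
    intro p q hp hq
    refine (hp.add hq).congr fun t => ?_
    simp only [Prod.fst_add, map_add]
    rw [← smul_add]
    congr 1
    abel
  zero_mem' := by simp
  smul_mem' := by
    intro c p hp
    refine (hp.const_smul c).congr fun t => ?_
    simp only [Prod.smul_fst, map_smul]
    rw [smul_comm, smul_sub]

/-- The infinitesimal generator `A` of the semigroup `T`, an unbounded operator with domain
`D(A)`, the set of `x` for which the limit of `(T(t)x - x)/t` as `t ↓ 0` exists. -/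
def generator (T : ℝ → X →L[ℂ] X) : X →ₗ.[ℂ] X :=
  (generatorGraph T).toLinearPMap

theorem generator_graph (T : ℝ → X →L[ℂ] X) : (generator T).graph = generatorGraph T := by
  refine Submodule.toLinearPMap_graph_eq _ ?_
  rintro ⟨x, y⟩ (h : Tendsto _ _ _) (rfl : x = 0)
  refine tendsto_nhds_unique h ?_
  simp

/-- The semigroup formula `(-A)^{-α} x = Γ(α)⁻¹ ∫_0^∞ t^{α-1} T(t) x dt` for the negative fractional
powers of `-A`, where `A` generates `T`; the domain is the set of all `x` for which the Bochner
integral converges (all of `X` if `T` is exponentially stable and `α > 0`). -/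
def negGeneratorNegPow (T : ℝ → X →L[ℂ] X) (α : ℝ) : X →ₗ.[ℂ] X where
  domain :=
    { carrier := {x | IntegrableOn (fun t : ℝ => ((t ^ (α - 1) : ℝ) : ℂ) • T t x) (Ioi 0)}
      add_mem' := by
        intro x y hx hy
        refine (Integrable.add hx hy).congr (Eventually.of_forall fun t => ?_)
        simp only [Pi.add_apply, map_add, smul_add]
      zero_mem' := by simp
      smul_mem' := by
        intro c x hx
        refine (Integrable.smul c hx).congr (Eventually.of_forall fun t => ?_)
        simp only [Pi.smul_apply, map_smul]
        exact smul_comm _ _ _ }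
  toFun :=
    { toFun := fun x => ((Real.Gamma α : ℝ) : ℂ)⁻¹ •
        ∫ t in Ioi (0 : ℝ), ((t ^ (α - 1) : ℝ) : ℂ) • T t (x : X)
      map_add' := by
        intro x y
        rw [← smul_add, ← integral_add x.2 y.2]
        simp only [Submodule.coe_add, map_add, smul_add]
      map_smul' := by
        intro c x
        rw [RingHom.id_apply, smul_comm c, ← integral_smul c (fun t : ℝ => ((t ^ (α - 1) : ℝ) : ℂ) • T t (x : X))]
        congr 1
        refine integral_congr_ae (Eventually.of_forall fun t => ?_)
        simp only [Submodule.coe_smul, map_smul]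
        exact smul_comm _ _ _ }

/-- The fractional power `(-A)^α`, `α > 0`, where `A` generates `T`: the inverse of the injective
operator `(-A)^{-α}`, defined on the range of the latter. -/
def negGeneratorPow (T : ℝ → X →L[ℂ] X) (α : ℝ) : X →ₗ.[ℂ] X :=
  (negGeneratorNegPow T α).inverse

/-- The (restriction to `D(A)` of the) operator `C` is an infinite-time admissible output operator
for `T`: `C T(·)x ∈ L²(0,∞)` for all `x ∈ D(A)`, and
`∫_0^∞ ‖C T(t) x‖² dt ≤ m ‖x‖²` with `m` independent of `x ∈ D(A)`. Here `f t = C T(t) x`. -/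
def IsAdmissible (T : ℝ → X →L[ℂ] X) (C : X →ₗ.[ℂ] X) : Prop :=
  (generator T).domain ≤ C.domain ∧
  ∃ m : ℝ, ∀ x ∈ (generator T).domain, ∃ f : ℝ → X,
    (∀ t : ℝ, 0 ≤ t → (T t x, f t) ∈ C.graph) ∧
    MemLp f 2 (volume.restrict (Ioi 0)) ∧
    ∫ t in Ioi (0 : ℝ), ‖f t‖ ^ 2 ≤ m * ‖x‖ ^ 2

/-- The adjoint semigroup `(T(t)^*)_{t ≥ 0}`. -/
def adjointSemigroup [CompleteSpace X] (T : ℝ → X →L[ℂ] X) : ℝ → X →L[ℂ] X :=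
  fun t => ContinuousLinearMap.adjoint (T t)

end Semigroup

/-! ### The adjoint semigroup

It is again a strongly continuous, exponentially stable semigroup, and its generator is `A^*`. So
`negGeneratorPow (adjointSemigroup T) α` is `(-A^*)^α`. -/

section Adjoint

variable {X : Type*} [NormedAddCommGroup X] [InnerProductSpace ℂ X]

theorem IsExponentiallyStable.exists_bound {T : ℝ → X →L[ℂ] X} (hs : IsExponentiallyStable T) :
    ∃ M : ℝ, 0 ≤ M ∧ ∀ t : ℝ, 0 ≤ t → ‖T t‖ ≤ M := by
  obtain ⟨M, ω, hω, h⟩ := hs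
  have hM : 0 ≤ M := by simpa using (norm_nonneg _).trans (h 0 le_rfl)
  refine ⟨M, hM, fun t ht => (h t ht).trans (mul_le_of_le_one_right hM ?_)⟩
  rw [Real.exp_le_one_iff]
  nlinarith

theorem IsC0Semigroup.continuous_orbit {T : ℝ → X →L[ℂ] X} (hT : IsC0Semigroup T)
    (hs : IsExponentiallyStable T) (x : X) : Continuous fun t : ℝ => T |t| x := by
  obtain ⟨M, hM, hb⟩ := hs.exists_bound
  have key : ∀ a b : ℝ, 0 ≤ a → a ≤ b → ‖T b x - T a x‖ ≤ M * ‖T (b - a) x - x‖ := by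
    intro a b ha hab
    have h := hT.map_add a (b - a) ha (sub_nonneg.2 hab)
    rw [add_sub_cancel] at h
    rw [h, mul_apply_eq_comp, ← map_sub]
    exact (T a).le_of_opNorm_le (hb a ha) _
  have h0 : Tendsto (fun t : ℝ => T t x) (𝓝[≥] 0) (𝓝 x) := by
    rw [← Ioi_insert, nhdsWithin_insert]
    refine Tendsto.sup ?_ (hT.tendsto_zero x)
    rw [tendsto_pure_left]
    intro s hs
    rw [hT.map_zero]
    exact mem_of_mem_nhds hs
  refine continuous_iff_continuousAt.2 fun s => ?_
  rw [ContinuousAt, tendsto_iff_norm_sub_tendsto_zero]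
  have h1 : Tendsto (fun t : ℝ => |(|t| - |s|)|) (𝓝 s) (𝓝[≥] 0) := by
    refine tendsto_nhdsWithin_iff.2 ⟨?_, Eventually.of_forall fun t => mem_Ici.2 (abs_nonneg _)⟩
    have : Continuous fun t : ℝ => |(|t| - |s|)| := by fun_prop
    simpa using this.tendsto s
  have h2 := ((h0.comp h1).sub_const x).norm.const_mul M
  simp only [sub_self, norm_zero, mul_zero] at h2
  refine squeeze_zero (fun _ => norm_nonneg _) (fun t => ?_) h2
  rcases le_total |s| |t| with h | h
  · simpa [abs_of_nonneg (sub_nonneg.2 h)] using key _ _ (abs_nonneg s) h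
  · rw [norm_sub_rev]
    simpa [abs_of_nonpos (sub_nonpos.2 h)] using key _ _ (abs_nonneg t) h

variable [CompleteSpace X]

theorem IsExponentiallyStable.adjoint {T : ℝ → X →L[ℂ] X} (hs : IsExponentiallyStable T) :
    IsExponentiallyStable (adjointSemigroup T) := by
  obtain ⟨M, ω, hω, h⟩ := hs
  refine ⟨M, ω, hω, fun t ht => ?_⟩
  rw [adjointSemigroup, LinearIsometryEquiv.norm_map]
  exact h t ht

/-- The integrated semigroup `∫_0^t T(r) dr`. -/
theorem IsC0Semigroup.exists_integrated {T : ℝ → X →L[ℂ] X} (hT : IsC0Semigroup T)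
    (hs : IsExponentiallyStable T) :
    ∃ S : ℝ → X →L[ℂ] X, ∀ t x, S t x = ∫ r in (0 : ℝ)..t, T |r| x := by
  obtain ⟨M, hM, hb⟩ := hs.exists_bound
  have hc := hT.continuous_orbit hs
  refine ⟨fun t => LinearMap.mkContinuous
    { toFun := fun x => ∫ r in (0 : ℝ)..t, T |r| x
      map_add' := fun x y => ?_
      map_smul' := fun c x => ?_ } (M * |t|) fun x => ?_, fun t x => rfl⟩
  · have h := intervalIntegral.integral_add ((hc x).intervalIntegrable (μ := volume) 0 t)
      ((hc y).intervalIntegrable 0 t)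
    simp [← h]
  · simp
  · refine (intervalIntegral.norm_integral_le_of_norm_le_const (C := M * ‖x‖) fun r _ =>
      (T |r|).le_of_opNorm_le (hb _ (abs_nonneg r)) x).trans (le_of_eq ?_)
    rw [sub_zero]
    ring

theorem IsC0Semigroup.tendsto_integrated {T : ℝ → X →L[ℂ] X} (hT : IsC0Semigroup T)
    (hs : IsExponentiallyStable T) {S : ℝ → X →L[ℂ] X}
    (hS : ∀ t x, S t x = ∫ r in (0 : ℝ)..t, T |r| x) (t : ℝ) (x : X) :
    Tendsto (fun h : ℝ => ((h : ℂ)⁻¹) • (S (t + h) x - S t x)) (𝓝[>] 0) (𝓝 (T |t| x)) := by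
  have h1 : HasDerivAt (fun t => S t x) (T |t| x) t := by
    simp only [hS]
    exact ((hT.continuous_orbit hs x).integral_hasStrictDerivAt 0 t).hasDerivAt
  refine (h1.tendsto_slope_zero_right).congr fun h => ?_
  rw [← Complex.ofReal_inv, Complex.coe_smul]

theorem IsC0Semigroup.integrated_comm {T : ℝ → X →L[ℂ] X} (hT : IsC0Semigroup T)
    (hs : IsExponentiallyStable T) {S : ℝ → X →L[ℂ] X}
    (hS : ∀ t x, S t x = ∫ r in (0 : ℝ)..t, T |r| x) {t h : ℝ} (ht : 0 ≤ t) (hh : 0 ≤ h) (x : X) :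
    T h (S t x) = S (t + h) x - S h x ∧ S t (T h x) = S (t + h) x - S h x := by
  have hc := hT.continuous_orbit hs x
  have e : ∫ r in (0 : ℝ)..t, T |r + h| x = S (t + h) x - S h x := by
    rw [intervalIntegral.integral_comp_add_right (fun r => T |r| x), hS, hS, zero_add, eq_sub_iff_add_eq,
      add_comm, intervalIntegral.integral_add_adjacent_intervals] <;>
    exact hc.intervalIntegrable _ _
  have e2 : ∀ r ∈ uIcc 0 t, T |r + h| = T |r| * T h := by
    intro r hr
    rw [uIcc_of_le ht] at hr
    rw [abs_of_nonneg hr.1, abs_of_nonneg (add_nonneg hr.1 hh), hT.map_add r h hr.1 hh]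
  have e3 : ∀ r ∈ uIcc 0 t, T |r + h| = T h * T |r| := by
    intro r hr
    rw [uIcc_of_le ht] at hr
    rw [abs_of_nonneg hr.1, abs_of_nonneg (add_nonneg hr.1 hh), add_comm, hT.map_add h r hh hr.1]
  constructor
  · rw [← e, hS, ← (T h).intervalIntegral_comp_comm (hc.intervalIntegrable _ _)]
    exact intervalIntegral.integral_congr fun r hr => by simp only [e3 r hr]; rfl
  · rw [← e, hS]
    exact intervalIntegral.integral_congr fun r hr => by simp only [e2 r hr]; rfl

theorem IsC0Semigroup.integrated_mem_graph {T : ℝ → X →L[ℂ] X} (hT : IsC0Semigroup T)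
    (hs : IsExponentiallyStable T) {S : ℝ → X →L[ℂ] X}
    (hS : ∀ t x, S t x = ∫ r in (0 : ℝ)..t, T |r| x) {t : ℝ} (ht : 0 ≤ t) (x : X) :
    (S t x, T t x - x) ∈ generatorGraph T := by
  have h1 := hT.tendsto_integrated hs hS t x
  have h2 := hT.tendsto_integrated hs hS 0 x
  have h3 : S 0 x = 0 := by simp [hS]
  rw [abs_of_nonneg ht] at h1
  simp only [abs_zero, hT.map_zero, zero_add, h3, sub_zero, one_apply_eq_self] at h2
  refine (h1.sub h2).congr' ?_
  filter_upwards [self_mem_nhdsWithin] with h hh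
  rw [(hT.integrated_comm hs hS ht (le_of_lt hh) x).1, ← smul_sub]
  congr 1
  abel

theorem IsC0Semigroup.integrated_generator {T : ℝ → X →L[ℂ] X} (hT : IsC0Semigroup T)
    (hs : IsExponentiallyStable T) {S : ℝ → X →L[ℂ] X}
    (hS : ∀ t x, S t x = ∫ r in (0 : ℝ)..t, T |r| x) {t : ℝ} (ht : 0 ≤ t) {x y : X}
    (hxy : (x, y) ∈ generatorGraph T) : S t y = T t x - x := by
  have h1 : Tendsto _ _ _ := (S t).continuous.tendsto y |>.comp hxy
  refine tendsto_nhds_unique h1 (Tendsto.congr' ?_ (hT.integrated_mem_graph hs hS ht x))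
  filter_upwards [self_mem_nhdsWithin] with h hh
  have := hT.integrated_comm hs hS ht (le_of_lt hh) x
  simp [this.1, this.2]

theorem IsC0Semigroup.dense_generator_domain {T : ℝ → X →L[ℂ] X} (hT : IsC0Semigroup T)
    (hs : IsExponentiallyStable T) : Dense ((generator T).domain : Set X) := by
  obtain ⟨S, hS⟩ := hT.exists_integrated hs
  intro x
  have h2 := hT.tendsto_integrated hs hS 0 x
  have h3 : S 0 x = 0 := by simp [hS]
  simp only [abs_zero, hT.map_zero, zero_add, h3, sub_zero, one_apply_eq_self] at h2
  refine mem_closure_of_tendsto h2 ?_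
  filter_upwards [self_mem_nhdsWithin] with h hh
  refine Submodule.smul_mem _ _ ?_
  have := hT.integrated_mem_graph hs hS (le_of_lt hh) x
  rw [← generator_graph] at this
  exact LinearPMap.mem_domain_of_mem_graph this

theorem IsC0Semigroup.adjoint {T : ℝ → X →L[ℂ] X} (hT : IsC0Semigroup T)
    (hs : IsExponentiallyStable T) : IsC0Semigroup (adjointSemigroup T) where
  map_zero := by
    rw [adjointSemigroup, hT.map_zero]
    exact ContinuousLinearMap.adjoint_id
  map_add s t h1 h2 := by
    simp only [adjointSemigroup]
    rw [add_comm, hT.map_add t s h2 h1]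
    exact ContinuousLinearMap.adjoint_comp _ _
  tendsto_zero := by
    obtain ⟨S, hS⟩ := hT.exists_integrated hs
    obtain ⟨M, hM, hb⟩ := hs.exists_bound
    let E : Submodule ℂ X :=
      { carrier := {x | Tendsto (fun t => adjointSemigroup T t x) (𝓝[>] 0) (𝓝 x)}
        add_mem' := fun {x y} hx hy => by simpa using Tendsto.add hx hy
        zero_mem' := by simp
        smul_mem' := fun c x hx => by simpa using Tendsto.const_smul hx c }
    have hclosed : IsClosed (E : Set X) := by
      refine isClosed_of_closure_subset fun x hx => ?_
      change Tendsto _ _ _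
      rw [Metric.tendsto_nhds]
      intro ε hε
      have hM1 : 0 < M + 2 := by linarith
      obtain ⟨y, hy, hxy⟩ := Metric.mem_closure_iff.1 hx (ε / (M + 2)) (by positivity)
      rw [dist_eq_norm, lt_div_iff₀ hM1] at hxy
      filter_upwards [Metric.tendsto_nhds.1 (show Tendsto _ _ _ from hy) (ε / (M + 2)) (by positivity),
        self_mem_nhdsWithin] with t h1 h2
      rw [dist_eq_norm, lt_div_iff₀ hM1] at h1
      have h3 : ‖adjointSemigroup T t (x - y)‖ ≤ M * ‖x - y‖ :=
        ContinuousLinearMap.le_of_opNorm_le _ (by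
          rw [adjointSemigroup, LinearIsometryEquiv.norm_map]
          exact hb t (le_of_lt h2)) _
      have h4 : adjointSemigroup T t x - x
          = adjointSemigroup T t (x - y) + (adjointSemigroup T t y - y) - (x - y) := by
        rw [map_sub]; abel
      rw [dist_eq_norm, h4]
      have h5 := norm_sub_le (adjointSemigroup T t (x - y) + (adjointSemigroup T t y - y)) (x - y)
      have h6 := norm_add_le (adjointSemigroup T t (x - y)) (adjointSemigroup T t y - y)
      nlinarith [norm_nonneg (x - y), norm_nonneg (adjointSemigroup T t y - y)]
    have hmem : ∀ t, 0 ≤ t → ∀ v, ContinuousLinearMap.adjoint (S t) v ∈ E := by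
      intro t ht v
      change Tendsto _ _ _
      rw [tendsto_iff_norm_sub_tendsto_zero]
      have hlim : Tendsto (fun h : ℝ => 2 * (M * |h|) * ‖v‖) (𝓝[>] 0) (𝓝 0) := by
        have : Continuous fun h : ℝ => 2 * (M * |h|) * ‖v‖ := by fun_prop
        simpa using (this.tendsto 0).mono_left nhdsWithin_le_nhds
      refine squeeze_zero' (Eventually.of_forall fun _ => norm_nonneg _) ?_ hlim
      filter_upwards [self_mem_nhdsWithin] with h hh
      have hh' : (0 : ℝ) ≤ h := le_of_lt hh
      have e : adjointSemigroup T h (ContinuousLinearMap.adjoint (S t) v)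
          - ContinuousLinearMap.adjoint (S t) v
          = ContinuousLinearMap.adjoint (S t * T h - S t) v := by
        rw [map_sub]
        change _ = ContinuousLinearMap.adjoint ((S t).comp (T h)) v - _
        rw [ContinuousLinearMap.adjoint_comp]
        rfl
      rw [e]
      refine ContinuousLinearMap.le_of_opNorm_le _ ?_ _
      rw [LinearIsometryEquiv.norm_map]
      refine ContinuousLinearMap.opNorm_le_bound _ (by positivity) fun x => ?_
      have hc := hT.continuous_orbit hs x
      have hbd : ∀ a : ℝ, ‖∫ r in a..(a + h), T |r| x‖ ≤ M * ‖x‖ * |h| := by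
        intro a
        refine (intervalIntegral.norm_integral_le_of_norm_le_const (C := M * ‖x‖) fun r _ =>
          (T |r|).le_of_opNorm_le (hb _ (abs_nonneg r)) x).trans (le_of_eq ?_)
        rw [add_sub_cancel_left]
      have e1 : S (t + h) x - S t x = ∫ r in t..(t + h), T |r| x := by
        rw [hS, hS, intervalIntegral.integral_interval_sub_left] <;>
        exact hc.intervalIntegrable _ _
      have e2 : (S t * T h - S t) x = (S (t + h) x - S t x) - S h x := by
        change S t (T h x) - S t x = _
        rw [(hT.integrated_comm hs hS ht hh' x).2]
        abel
      have h1 := hbd t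
      have h2 := hbd 0
      rw [zero_add, ← hS] at h2
      rw [e2]
      refine (norm_sub_le _ _).trans ?_
      rw [e1]
      linarith
    have htop : E = ⊤ := by
      have : CompleteSpace E := hclosed.completeSpace_coe
      rw [← Submodule.orthogonal_eq_bot_iff, Submodule.eq_bot_iff]
      intro u hu
      have h0 : ∀ t, 0 ≤ t → S t u = 0 := by
        intro t ht
        have := hu _ (hmem t ht (S t u))
        rwa [ContinuousLinearMap.adjoint_inner_left, inner_self_eq_zero] at this
      have h2 := hT.tendsto_integrated hs hS 0 u
      simp only [abs_zero, hT.map_zero, zero_add, one_apply_eq_self] at h2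
      refine tendsto_nhds_unique h2 (tendsto_const_nhds.congr' ?_)
      filter_upwards [self_mem_nhdsWithin] with h hh
      rw [h0 h (le_of_lt hh), h0 0 le_rfl]
      simp
    intro x
    have : x ∈ E := htop ▸ Submodule.mem_top
    exact this

/-- The generator of the adjoint semigroup is the adjoint `A^*` of the generator `A`. -/
theorem IsC0Semigroup.generator_adjointSemigroup {T : ℝ → X →L[ℂ] X} (hT : IsC0Semigroup T)
    (hs : IsExponentiallyStable T) : generator (adjointSemigroup T) = (generator T)† := by
  have hd := hT.dense_generator_domain hs
  obtain ⟨S, hS⟩ := hT.exists_integrated hs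
  obtain ⟨S', hS'⟩ := (hT.adjoint hs).exists_integrated hs.adjoint
  have hSS : ∀ t w, S' t w = ContinuousLinearMap.adjoint (S t) w := by
    intro t w
    refine ext_inner_right ℂ fun z => ?_
    rw [ContinuousLinearMap.adjoint_inner_left, hS, hS']
    have h1 := (innerSL ℂ w).intervalIntegral_comp_comm
      ((hT.continuous_orbit hs z).intervalIntegrable (μ := volume) 0 t)
    have h2 := (innerSL ℂ z).intervalIntegral_comp_comm
      (((hT.adjoint hs).continuous_orbit hs.adjoint w).intervalIntegrable (μ := volume) 0 t)
    simp only [innerSL_apply_apply] at h1 h2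
    rw [← h1, ← inner_conj_symm, ← h2, ← intervalIntegral.intervalIntegral_conj]
    refine intervalIntegral.integral_congr fun r _ => ?_
    simp [adjointSemigroup, ContinuousLinearMap.adjoint_inner_left]
  refine LinearPMap.eq_of_eq_graph (le_antisymm ?_ ?_)
  · refine LinearPMap.le_graph_of_le (LinearPMap.IsFormalAdjoint.le_adjoint hd ?_)
    intro x y
    have hy := (generator (adjointSemigroup T)).mem_graph y
    have hx := (generator T).mem_graph x
    rw [generator_graph] at hx hy
    have h1 := (Tendsto.inner (𝕜 := ℂ) (tendsto_const_nhds (x := (x : X))) hy)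
    have h2 := (Tendsto.inner (𝕜 := ℂ) hx (tendsto_const_nhds (x := (y : X))))
    refine tendsto_nhds_unique h2 (h1.congr fun t => ?_)
    simp [inner_smul_left, inner_smul_right, inner_sub_left, inner_sub_right, adjointSemigroup,
      ContinuousLinearMap.adjoint_inner_right]
  · rintro ⟨y, w⟩ hyw
    rw [generator_graph]
    have h2 := (hT.adjoint hs).tendsto_integrated hs.adjoint hS' 0 w
    have h3 : S' 0 w = 0 := by simp [hS']
    simp only [abs_zero, (hT.adjoint hs).map_zero, zero_add, h3, sub_zero,
      one_apply_eq_self] at h2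
    refine Tendsto.congr' ?_ h2
    filter_upwards [self_mem_nhdsWithin] with t ht
    have ht' : (0 : ℝ) ≤ t := le_of_lt ht
    congr 1
    rw [hSS]
    refine ext_inner_right ℂ fun z => ?_
    rw [ContinuousLinearMap.adjoint_inner_left, inner_sub_left, adjointSemigroup,
      ContinuousLinearMap.adjoint_inner_left, ← inner_sub_right]
    obtain ⟨y', rfl, rfl⟩ := (LinearPMap.mem_graph_iff _).1 hyw
    have hz := hT.integrated_mem_graph hs hS ht' z
    rw [← generator_graph] at hz
    obtain ⟨x', hx1, hx2⟩ := (LinearPMap.mem_graph_iff _).1 hz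
    simp only at hx1 hx2
    rw [← hx1, ← hx2]
    exact LinearPMap.adjoint_isFormalAdjoint hd y' x'

end Adjoint

/-! ### The algebra of bounded analytic functions on the open left half-plane -/

/-- The open left half-plane. -/
def leftHalfPlane : Set ℂ := {s | s.re < 0}

/-- The algebra of functions that are bounded and analytic on the open left half-plane. They are
written as functions on `ℂ`, of which only the values on the left half-plane matter. -/
def HInfMinus : Subalgebra ℂ (ℂ → ℂ) where
  carrier := {g | DifferentiableOn ℂ g leftHalfPlane ∧ ∃ K : ℝ, ∀ s ∈ leftHalfPlane, ‖g s‖ ≤ K}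
  mul_mem' := by
    rintro f g ⟨hf, K, hK⟩ ⟨hg, L, hL⟩
    refine ⟨hf.mul hg, K * L, fun s hs => ?_⟩
    rw [Pi.mul_apply, norm_mul]
    exact mul_le_mul (hK s hs) (hL s hs) (norm_nonneg _) ((norm_nonneg _).trans (hK s hs))
  add_mem' := by
    rintro f g ⟨hf, K, hK⟩ ⟨hg, L, hL⟩
    exact ⟨hf.add hg, K + L, fun s hs => (norm_add_le _ _).trans (add_le_add (hK s hs) (hL s hs))⟩
  algebraMap_mem' := by
    intro c
    exact ⟨differentiableOn_const c, ‖c‖, fun s _ => le_rfl⟩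

/-- The supremum norm over the left half-plane. -/
def hInfNorm (g : ℂ → ℂ) : ℝ := ⨆ s : leftHalfPlane, ‖g s‖

/-- The boundary function `ω ↦ lim_{r ↑ 0} g(r + iω)` on the imaginary axis. -/
def boundaryValue (g : ℂ → ℂ) (ω : ℝ) : ℂ :=
  limUnder (𝓝[<] (0 : ℝ)) fun r : ℝ => g (r + ω * Complex.I)

open Classical in
/-- The boundary function of `g` as an element of `L^∞(ℝ)`, in the frequency variable
`ξ = ω / 2π` of the Fourier transform `f̂(ξ) = ∫ e^{-2πi t ξ} f(t) dt`. -/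
def boundaryLp (g : ℂ → ℂ) : Lp ℂ ∞ (volume : Measure ℝ) :=
  if h : MemLp (fun ξ : ℝ => boundaryValue g (2 * Real.pi * ξ)) ∞ volume then h.toLp else 0

/-! ### The Toeplitz operator and `g(A)` -/

section Calculus

variable {X : Type*} [NormedAddCommGroup X] [InnerProductSpace ℂ X]

/-- Extension by zero, `L²((0,∞);X) → L²(ℝ;X)`. -/
def extendByZero (f : Lp X 2 (volume.restrict (Ioi (0 : ℝ)))) : Lp X 2 (volume : Measure ℝ) :=
  ((memLp_indicator_iff_restrict measurableSet_Ioi).2 (Lp.memLp f)).toLp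

/-- The Toeplitz operator `M_g f = 𝓛⁻¹ Π (g F)` on `L²((0,∞);X)`, where `F = 𝓛 f`. On the imaginary
axis `F(2πiξ)` is the Fourier transform of the extension of `f` by zero; the projection `Π` onto the
Laplace transforms of `L²((0,∞);X)` becomes, after inverse transformation, restriction to
`(0,∞)`. -/
def toeplitz [CompleteSpace X] (g : ℂ → ℂ) (f : Lp X 2 (volume.restrict (Ioi (0 : ℝ)))) :
    Lp X 2 (volume.restrict (Ioi (0 : ℝ))) :=
  LpToLpRestrictCLM ℝ X ℂ volume 2 (Ioi 0)
    (𝓕⁻ ((boundaryLp g • 𝓕 (extendByZero f) : Lp X 2 (volume : Measure ℝ))))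

open Classical in
/-- The orbit `T(·)x` as an element of `L²((0,∞);X)`. -/
def orbitLp (T : ℝ → X →L[ℂ] X) (x : X) : Lp X 2 (volume.restrict (Ioi (0 : ℝ))) :=
  if h : MemLp (fun t => T t x) 2 (volume.restrict (Ioi (0 : ℝ))) then h.toLp else 0

/-- `G` is the operator `g(A)`, where `A` generates `T`: the admissible operator with domain `D(A)`,
bounded for the graph norm, such that `M_g (T(·)x) = G T(·)x` in `L²((0,∞);X)` for all
`x ∈ D(A)`. -/
structure IsFunctionOfGenerator [CompleteSpace X] (T : ℝ → X →L[ℂ] X) (g : ℂ → ℂ)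
    (G : X →ₗ.[ℂ] X) : Prop where
  domain_eq : G.domain = (generator T).domain
  bounded_graphNorm : ∃ c : ℝ, ∀ x y z : X, (x, y) ∈ (generator T).graph → (x, z) ∈ G.graph →
    ‖z‖ ≤ c * (‖x‖ + ‖y‖)
  admissible : IsAdmissible T G
  output_eq : ∀ x ∈ (generator T).domain, ∀ᵐ t ∂(volume.restrict (Ioi (0 : ℝ))),
    (T t x, toeplitz g (orbitLp T x) t) ∈ G.graph

/-- The semigroup `T` with generator `A` has a bounded `H_∞^-`-calculus: `g ↦ g(A)` is, after
extension of the operators `g(A)` from `D(A)` to `X`, a bounded unital algebra homomorphism `Φ` from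
`H_∞^-` to the bounded operators on `X`, and it maps `s ↦ 1/(s - a)`, `Re a > 0`, to
`(A - a I)⁻¹`. -/
def HasBoundedHInfCalculus [CompleteSpace X] (T : ℝ → X →L[ℂ] X) : Prop :=
  ∃ Φ : HInfMinus →ₐ[ℂ] (X →L[ℂ] X),
    (∀ g : HInfMinus,
      IsFunctionOfGenerator T g ((Φ g : X →ₗ[ℂ] X).toPMap (generator T).domain)) ∧
    (∃ K : ℝ, ∀ g : HInfMinus, ‖Φ g‖ ≤ K * hInfNorm g) ∧
    (∀ (a : ℂ) (g : HInfMinus), 0 < a.re →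
      (∀ s ∈ leftHalfPlane, (g : ℂ → ℂ) s = (s - a)⁻¹) →
      (∀ x : X, (Φ g x, x + a • Φ g x) ∈ (generator T).graph) ∧
      (∀ x : (generator T).domain, Φ g (generator T x - a • (x : X)) = x))

end Calculus

end

open MeasureTheory Set Filter Topology FourierTransform
open scoped ENNReal LinearPMap InnerProductSpace

noncomputable section

set_option linter.unusedSectionVars false

/-! ### Toeplitz operators with bounded symbols -/

section Toeplitz

variable {X : Type*} [NormedAddCommGroup X] [InnerProductSpace ℂ X]

/-! Put `Ψ x = (-A)^{1/2} T(·)x`. Admissibility of `(-A)^{1/2}` makes `Ψ` bounded from `X` to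
`L²((0,∞);X)`, and admissibility of `(-A^*)^{1/2}` does the same for its counterpart `Ψ'` built from
the adjoint semigroup. Formally `⟪Ψ' y, Ψ x⟫ = ∫_0^∞ ⟪y, -A T(2t) x⟫ dt = ½ ⟪y, x⟫`, so `Λ = 2 Ψ'^*`
is a left inverse of `Ψ` (`IsC0Semigroup.exists_leftInvertible_intertwining`). The calculus is `g ↦
Λ M_g Ψ`, and its bound `‖Λ‖ ‖Ψ‖ ‖g‖_∞` is immediate from `‖M_g‖ ≤ ‖g‖_∞`.

What makes this operator equal to `g(A)` is that `Ψ` turns `T(r)` into the left shift by `r`. If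
`g(s) = ∫_0^∞ h(r) e^{rs} dr` on the imaginary axis with `h` integrable, then `M_g` is the
superposition of left shifts with weight `h`. Hence `M_g V = V S` with `S = ∫_0^∞ h(r) T(r) dr`, for
every bounded `V` intertwining `T` with the left shift. The case `V = Ψ` identifies `S = Λ M_g Ψ`,
so that `M_g V = V (Λ M_g Ψ)`. This identity no longer mentions `h` and survives bounded almost
everywhere limits of symbols (`IsAnalyticSymbol.toeplitzL_intertwining`). With `V = Ψ` it gives
multiplicativity, with `V = Ψ T(t)` commutation with the semigroup, with `V` the orbit map the
defining identity of `g(A)`; the weight `-e^{-ar}` gives the resolvent.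

It remains to see that every `g` is such a limit. Boundary values exist by Fatou's theorem
(`ae_exists_tendsto_boundary`), proved by differentiating a Lipschitz primitive at the boundary. The
approximants `g(s-δ) (M/(M-s))²` are analytic past the axis and decay quadratically, so shifting the
contour shows that their Fourier transforms live on `(0,∞)` and decay exponentially
(`exists_laplace_representation`). -/

theorem coeFn_extendByZero (f : Lp X 2 (volume.restrict (Ioi (0 : ℝ)))) :
    extendByZero f =ᵐ[volume] (Ioi (0 : ℝ)).indicator f :=
  MemLp.coeFn_toLp _

/-- Extension by zero as a bounded operator. -/
def extendL (X : Type*) [NormedAddCommGroup X] [InnerProductSpace ℂ X] :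
    Lp X 2 (volume.restrict (Ioi (0 : ℝ))) →L[ℂ] Lp X 2 (volume : Measure ℝ) :=
  LinearMap.mkContinuous
    { toFun := extendByZero
      map_add' := fun f g => by
        refine Lp.ext ?_
        filter_upwards [coeFn_extendByZero (f + g), coeFn_extendByZero f, coeFn_extendByZero g,
          Lp.coeFn_add (extendByZero f) (extendByZero g),
          (ae_restrict_iff' measurableSet_Ioi).1 (Lp.coeFn_add f g)] with t h1 h2 h3 h4 h5
        rw [h1, h4, Pi.add_apply, h2, h3]
        by_cases ht : t ∈ Ioi (0 : ℝ)
        · simp only [indicator_of_mem ht]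
          exact h5 ht
        · simp [indicator_of_notMem ht]
      map_smul' := fun c f => by
        refine Lp.ext ?_
        filter_upwards [coeFn_extendByZero (c • f), coeFn_extendByZero f,
          Lp.coeFn_smul c (extendByZero f),
          (ae_restrict_iff' measurableSet_Ioi).1 (Lp.coeFn_smul c f)] with t h1 h2 h4 h5
        rw [h1, RingHom.id_apply, h4, Pi.smul_apply, h2]
        by_cases ht : t ∈ Ioi (0 : ℝ)
        · simp only [indicator_of_mem ht]
          exact h5 ht
        · simp [indicator_of_notMem ht] }
    1 fun f => by
      change ‖extendByZero f‖ ≤ _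
      rw [one_mul, extendByZero, Lp.norm_toLp, Lp.norm_def,
        eLpNorm_indicator_eq_eLpNorm_restrict measurableSet_Ioi]

theorem extendL_apply (f : Lp X 2 (volume.restrict (Ioi (0 : ℝ)))) :
    extendL X f = extendByZero f := rfl

theorem norm_extendL_le : ‖extendL X‖ ≤ 1 :=
  LinearMap.mkContinuous_norm_le _ zero_le_one _

/-- Restriction to the half-line. -/
def restrictL (X : Type*) [NormedAddCommGroup X] [InnerProductSpace ℂ X] :
    Lp X 2 (volume : Measure ℝ) →L[ℂ] Lp X 2 (volume.restrict (Ioi (0 : ℝ))) :=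
  LpToLpRestrictCLM ℝ X ℂ volume 2 (Ioi 0)

theorem coeFn_restrictL (u : Lp X 2 (volume : Measure ℝ)) :
    restrictL X u =ᵐ[volume.restrict (Ioi (0 : ℝ))] u :=
  LpToLpRestrictCLM_coeFn ℂ _ u

theorem norm_restrictL_le : ‖restrictL X‖ ≤ 1 :=
  ContinuousLinearMap.opNorm_le_bound _ zero_le_one fun u => by
    rw [one_mul]; exact norm_Lp_toLp_restrict_le _ u

theorem restrictL_extendL (f : Lp X 2 (volume.restrict (Ioi (0 : ℝ)))) :
    restrictL X (extendL X f) = f := by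
  refine Lp.ext ?_
  filter_upwards [coeFn_restrictL (extendL X f),
    ae_restrict_of_ae (coeFn_extendByZero f), ae_restrict_mem measurableSet_Ioi] with t h1 h2 h3
  rw [h1, extendL_apply, h2, indicator_of_mem h3]

/-- The translation `u ↦ u(· + r)` on the line. -/
def translateL (X : Type*) [NormedAddCommGroup X] [InnerProductSpace ℂ X] (r : ℝ) :
    Lp X 2 (volume : Measure ℝ) →ₗᵢ[ℂ] Lp X 2 (volume : Measure ℝ) :=
  Lp.compMeasurePreservingₗᵢ ℂ (fun t => t + r) (measurePreserving_add_right volume r)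

theorem coeFn_translateL (r : ℝ) (u : Lp X 2 (volume : Measure ℝ)) :
    translateL X r u =ᵐ[volume] fun t => u (t + r) :=
  Lp.coeFn_compMeasurePreserving u (measurePreserving_add_right volume r)

/-- For `t > 0` and `r ≥ 0` the value at `t + r` is taken on the half-line, so truncating beforehand
changes nothing. This is why the projection between two Toeplitz operators can be dropped when the
left one is made of left shifts. -/
theorem restrictL_translateL_extendL (r : ℝ) (hr : 0 ≤ r) (u : Lp X 2 (volume : Measure ℝ)) :
    restrictL X (translateL X r (extendL X (restrictL X u))) = restrictL X (translateL X r u) := by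
  refine Lp.ext ?_
  have h0 : ∀ᵐ t : ℝ, extendL X (restrictL X u) t = (Ioi (0 : ℝ)).indicator u t := by
    filter_upwards [coeFn_extendByZero (restrictL X u),
      (ae_restrict_iff' measurableSet_Ioi).1 (coeFn_restrictL u)] with t h1 h2
    rw [extendL_apply, h1]
    by_cases ht : t ∈ Ioi (0 : ℝ)
    · simp only [indicator_of_mem ht, h2 ht]
    · simp only [indicator_of_notMem ht]
  have h1 := (measurePreserving_add_right volume r).quasiMeasurePreserving.ae h0
  filter_upwards [coeFn_restrictL (translateL X r (extendL X (restrictL X u))),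
    coeFn_restrictL (translateL X r u), ae_restrict_of_ae (coeFn_translateL r u),
    ae_restrict_of_ae (coeFn_translateL r (extendL X (restrictL X u))), ae_restrict_of_ae h1,
    ae_restrict_mem measurableSet_Ioi] with t e1 e2 e3 e4 e5 ht
  rw [e1, e2, e3, e4, e5, indicator_of_mem]
  exact add_pos_of_pos_of_nonneg ht hr

/-- Multiplication by an `L^∞` function on `L²(ℝ;X)`. -/
def multiplyL (X : Type*) [NormedAddCommGroup X] [InnerProductSpace ℂ X] :
    Lp ℂ ∞ (volume : Measure ℝ) →L[ℂ] Lp X 2 (volume : Measure ℝ) →L[ℂ] Lp X 2 (volume : Measure ℝ) :=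
  LinearMap.mkContinuous₂
    (LinearMap.mk₂ ℂ (fun (φ : Lp ℂ ∞ (volume : Measure ℝ)) (u : Lp X 2 (volume : Measure ℝ)) =>
      (φ • u : Lp X 2 (volume : Measure ℝ))) Lp.smul_add Lp.smul_assoc Lp.add_smul
      fun c φ u => (Lp.smul_comm c φ u).symm) 1
    fun φ u => by rw [one_mul]; exact Lp.norm_smul_le φ u

theorem MeasureTheory.Lp.norm_sq_eq_integral {α : Type*} [MeasurableSpace α] {μ : Measure α}
    (f : Lp X 2 μ) : ‖f‖ ^ 2 = ∫ t, ‖f t‖ ^ 2 ∂μ := by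
  have h := L2.inner_def (𝕜 := ℂ) f f
  simp only [inner_self_eq_norm_sq_to_K] at h
  apply Complex.ofReal_injective
  rw [← integral_complex_ofReal]
  simpa using h

theorem coeFn_multiplyL (φ : Lp ℂ ∞ (volume : Measure ℝ)) (u : Lp X 2 (volume : Measure ℝ)) :
    multiplyL X φ u =ᵐ[volume] fun ξ => φ ξ • u ξ :=
  Lp.coeFn_lpSMul φ u

theorem norm_multiplyL_apply_le (φ : Lp ℂ ∞ (volume : Measure ℝ))
    (u : Lp X 2 (volume : Measure ℝ)) : ‖multiplyL X φ u‖ ≤ ‖φ‖ * ‖u‖ :=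
  Lp.norm_smul_le φ u

variable [CompleteSpace X]

/-- The operator `u ↦ 𝓕⁻¹ (φ 𝓕 u)` on `L²(ℝ;X)`. -/
def fourierMultiplierL (X : Type*) [NormedAddCommGroup X] [InnerProductSpace ℂ X] [CompleteSpace X]
    (φ : Lp ℂ ∞ (volume : Measure ℝ)) :
    Lp X 2 (volume : Measure ℝ) →L[ℂ] Lp X 2 (volume : Measure ℝ) :=
  ((Lp.fourierTransformₗᵢ ℝ X).symm.toContinuousLinearEquiv : _ →L[ℂ] _) ∘L multiplyL X φ ∘L
    ((Lp.fourierTransformₗᵢ ℝ X).toContinuousLinearEquiv : _ →L[ℂ] _)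

theorem fourierMultiplierL_apply (φ : Lp ℂ ∞ (volume : Measure ℝ))
    (u : Lp X 2 (volume : Measure ℝ)) : fourierMultiplierL X φ u = 𝓕⁻ (multiplyL X φ (𝓕 u)) := rfl

theorem norm_fourierMultiplierL_apply_le (φ : Lp ℂ ∞ (volume : Measure ℝ))
    (u : Lp X 2 (volume : Measure ℝ)) : ‖fourierMultiplierL X φ u‖ ≤ ‖φ‖ * ‖u‖ := by
  rw [fourierMultiplierL_apply]
  refine ((Lp.fourierTransformₗᵢ ℝ X).symm.norm_map _).le.trans
    ((norm_multiplyL_apply_le _ _).trans_eq ?_)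
  rw [Lp.norm_fourier_eq]

/-- The Toeplitz operator with symbol `φ`. -/
def toeplitzL (X : Type*) [NormedAddCommGroup X] [InnerProductSpace ℂ X] [CompleteSpace X]
    (φ : Lp ℂ ∞ (volume : Measure ℝ)) :
    Lp X 2 (volume.restrict (Ioi (0 : ℝ))) →L[ℂ] Lp X 2 (volume.restrict (Ioi (0 : ℝ))) :=
  restrictL X ∘L fourierMultiplierL X φ ∘L extendL X

theorem toeplitzL_apply (φ : Lp ℂ ∞ (volume : Measure ℝ))
    (f : Lp X 2 (volume.restrict (Ioi (0 : ℝ)))) :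
    toeplitzL X φ f = restrictL X (fourierMultiplierL X φ (extendL X f)) := rfl

theorem toeplitz_eq_toeplitzL (g : ℂ → ℂ) (f : Lp X 2 (volume.restrict (Ioi (0 : ℝ)))) :
    toeplitz g f = toeplitzL X (boundaryLp g) f := rfl

theorem toeplitzL_add (φ ψ : Lp ℂ ∞ (volume : Measure ℝ)) :
    toeplitzL X (φ + ψ) = toeplitzL X φ + toeplitzL X ψ := by
  ext1 f
  simp [toeplitzL, fourierMultiplierL]

theorem toeplitzL_smul (c : ℂ) (φ : Lp ℂ ∞ (volume : Measure ℝ)) :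
    toeplitzL X (c • φ) = c • toeplitzL X φ := by
  ext1 f
  simp [toeplitzL, fourierMultiplierL]

theorem norm_toeplitzL_le (φ : Lp ℂ ∞ (volume : Measure ℝ)) : ‖toeplitzL X φ‖ ≤ ‖φ‖ := by
  refine ContinuousLinearMap.opNorm_le_bound _ (norm_nonneg _) fun f => ?_
  rw [toeplitzL_apply]
  refine ((restrictL X).le_of_opNorm_le norm_restrictL_le _).trans ?_
  rw [one_mul]
  refine (norm_fourierMultiplierL_apply_le _ _).trans ?_
  have := (extendL X).le_of_opNorm_le norm_extendL_le f
  rw [one_mul] at this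
  gcongr

theorem toeplitzL_eq_id {φ : Lp ℂ ∞ (volume : Measure ℝ)} (h : ∀ᵐ ξ, φ ξ = 1) :
    toeplitzL X φ = 1 := by
  ext1 f
  have : multiplyL X φ (𝓕 (extendL X f)) = (𝓕 (extendL X f) : Lp X 2 (volume : Measure ℝ)) := by
    refine Lp.ext ?_
    filter_upwards [h, coeFn_multiplyL φ (𝓕 (extendL X f))] with ξ h1 h2
    rw [h2, h1, one_smul]
  rw [toeplitzL_apply, fourierMultiplierL_apply, this, fourierInv_fourier_eq, restrictL_extendL]
  rfl

theorem fourierMultiplierL_comp {φ ψ χ : Lp ℂ ∞ (volume : Measure ℝ)}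
    (h : ∀ᵐ ξ, χ ξ = φ ξ * ψ ξ) (u : Lp X 2 (volume : Measure ℝ)) :
    fourierMultiplierL X χ u = fourierMultiplierL X φ (fourierMultiplierL X ψ u) := by
  rw [fourierMultiplierL_apply, fourierMultiplierL_apply, fourierMultiplierL_apply,
    fourier_fourierInv_eq]
  congr 1
  refine Lp.ext ?_
  filter_upwards [h, coeFn_multiplyL χ (𝓕 u), coeFn_multiplyL ψ (𝓕 u),
    coeFn_multiplyL φ (multiplyL X ψ (𝓕 u))] with ξ h1 h2 h3 h4
  rw [h2, h4, h3, h1, mul_smul]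

/-- Bounded almost everywhere convergence of the symbols implies strong convergence. -/
theorem tendsto_toeplitzL {φ : ℕ → Lp ℂ ∞ (volume : Measure ℝ)} {ψ : Lp ℂ ∞ (volume : Measure ℝ)}
    {K : ℝ} (hK : ∀ n, ∀ᵐ ξ, ‖φ n ξ‖ ≤ K) (h : ∀ᵐ ξ, Tendsto (fun n => φ n ξ) atTop (𝓝 (ψ ξ)))
    (f : Lp X 2 (volume.restrict (Ioi (0 : ℝ)))) :
    Tendsto (fun n => toeplitzL X (φ n) f) atTop (𝓝 (toeplitzL X ψ f)) := by
  have key : ∀ u : Lp X 2 (volume : Measure ℝ),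
      Tendsto (fun n => multiplyL X (φ n) u) atTop (𝓝 (multiplyL X ψ u)) := by
    intro u
    have hψ : ∀ᵐ ξ, ‖ψ ξ‖ ≤ K := by
      filter_upwards [ae_all_iff.2 hK, h] with ξ h1 h2
      exact le_of_tendsto h2.norm (Eventually.of_forall h1)
    rw [tendsto_iff_norm_sub_tendsto_zero]
    have h2 : Tendsto (fun n => ‖multiplyL X (φ n) u - multiplyL X ψ u‖ ^ 2) atTop (𝓝 0) := by
      simp only [Lp.norm_sq_eq_integral]
      have h3 : ∀ n, ∫ ξ, ‖(multiplyL X (φ n) u - multiplyL X ψ u) ξ‖ ^ 2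
          = ∫ ξ, ‖(φ n ξ - ψ ξ) • u ξ‖ ^ 2 := by
        intro n
        refine integral_congr_ae ?_
        filter_upwards [Lp.coeFn_sub (multiplyL X (φ n) u) (multiplyL X ψ u),
          coeFn_multiplyL (φ n) u, coeFn_multiplyL ψ u] with ξ e1 e2 e3
        rw [e1, Pi.sub_apply, e2, e3, sub_smul]
      simp only [h3]
      rw [show (0 : ℝ) = ∫ ξ : ℝ, (0 : ℝ) by simp]
      -- The limit symbol inherits the bound `K`, so differences of symbols are at most `2 * K`.
      refine tendsto_integral_of_dominated_convergence (fun ξ => (2 * K) ^ 2 * ‖u ξ‖ ^ 2)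
        (fun n => ?_) ((Lp.memLp u).norm.integrable_sq.const_mul _) (fun n => ?_) ?_
      · exact ((((Lp.aestronglyMeasurable (φ n)).sub (Lp.aestronglyMeasurable ψ)).smul
          (Lp.aestronglyMeasurable u)).norm.pow 2)
      · filter_upwards [hK n, hψ] with ξ e1 e2
        rw [norm_pow, norm_norm, norm_smul, mul_pow]
        have : ‖φ n ξ - ψ ξ‖ ≤ 2 * K := (norm_sub_le _ _).trans (by linarith)
        gcongr
      · filter_upwards [h] with ξ e
        have := ((e.sub_const (ψ ξ)).smul_const (u ξ)).norm.pow 2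
        simpa using this
    have h3 := h2.sqrt
    simpa [Real.sqrt_sq] using h3
  exact ((restrictL X).continuous.comp
    (Lp.fourierTransformₗᵢ ℝ X).symm.continuous).tendsto _ |>.comp (key (𝓕 (extendL X f)))

theorem norm_cexp_ofReal_mul_I_le (x : ℝ) : ‖Complex.exp (x * Complex.I)‖ ≤ 1 :=
  (Complex.norm_exp_ofReal_mul_I x).le

/-- Both sides are continuous in `u`, so the classical formula for Schwartz functions suffices. With
`s = 2πiξ` the factor is `e^{rs}`: left shifts are the multipliers from which analytic symbols are
built. -/
theorem fourier_translateL (r : ℝ) (u : Lp X 2 (volume : Measure ℝ)) :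
    (𝓕 (translateL X r u) : Lp X 2 (volume : Measure ℝ)) =ᵐ[volume] fun ξ =>
      Complex.exp ((2 * Real.pi * (r * ξ) : ℝ) * Complex.I) •
        (𝓕 u : Lp X 2 (volume : Measure ℝ)) ξ := by
  have hmem : MemLp (fun ξ : ℝ => Complex.exp ((2 * Real.pi * (r * ξ) : ℝ) * Complex.I)) ∞ volume :=
    memLp_top_of_bound (Continuous.aestronglyMeasurable (by fun_prop)) 1
      (ae_of_all _ fun ξ => norm_cexp_ofReal_mul_I_le _)
  have key : (𝓕 (translateL X r u) : Lp X 2 (volume : Measure ℝ))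
      = multiplyL X hmem.toLp (𝓕 u) := by
    refine DenseRange.induction_on (p := fun u : Lp X 2 (volume : Measure ℝ) =>
      (𝓕 (translateL X r u) : Lp X 2 (volume : Measure ℝ)) = multiplyL X hmem.toLp (𝓕 u))
      (SchwartzMap.denseRange_toLpCLM (p := 2) ENNReal.ofNat_ne_top) u ?_ ?_
    · exact isClosed_eq ((Lp.fourierTransformₗᵢ ℝ X).continuous.comp (translateL X r).continuous)
        ((multiplyL X hmem.toLp).continuous.comp (Lp.fourierTransformₗᵢ ℝ X).continuous)
    · intro f
      have e1 : translateL X r (f.toLp 2) = (f.compSubConstCLM ℂ (-r)).toLp 2 := by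
        refine Lp.ext ?_
        have h1 := (measurePreserving_add_right volume r).quasiMeasurePreserving.ae
          (f.coeFn_toLp 2 volume)
        filter_upwards [coeFn_translateL r (f.toLp 2 volume), h1,
          (f.compSubConstCLM ℂ (-r)).coeFn_toLp 2 volume] with t h1 h2 h3
        rw [h1, h2, h3, SchwartzMap.compSubConstCLM_apply, sub_neg_eq_add]
      change 𝓕 (translateL X r (f.toLp 2)) = multiplyL X hmem.toLp (𝓕 (f.toLp 2))
      rw [e1, SchwartzMap.toLp_fourier_eq, SchwartzMap.toLp_fourier_eq]
      refine Lp.ext ?_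
      filter_upwards [(𝓕 (f.compSubConstCLM ℂ (-r))).coeFn_toLp 2 volume,
        coeFn_multiplyL hmem.toLp ((𝓕 f).toLp 2 volume), (𝓕 f).coeFn_toLp 2 volume,
        hmem.coeFn_toLp] with ξ h1 h2 h3 h4
      rw [h1, h2, h3, h4]
      have h5 := congrFun (VectorFourier.fourierIntegral_comp_add_right Real.fourierChar volume
        (innerₗ ℝ) f r) ξ
      have h6 : ⇑(f.compSubConstCLM ℂ (-r)) = f ∘ fun v => v + r := by
        ext v
        rw [SchwartzMap.compSubConstCLM_apply, sub_neg_eq_add, Function.comp_apply]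
      rw [SchwartzMap.fourier_coe, SchwartzMap.fourier_coe, h6]
      refine h5.trans ?_
      rw [Circle.smul_def, Real.fourierChar_apply]
      simp [mul_comm]
      rfl
  rw [key]
  filter_upwards [coeFn_multiplyL hmem.toLp (𝓕 u), hmem.coeFn_toLp] with ξ h1 h2
  rw [h1, h2]

/-- Multiplication of the Fourier transform by `∫_0^∞ h(r) e^{2πirξ} dr` is the superposition of
the translations by `r` with the weight `h(r)`, in the weak sense. -/
theorem inner_fourierMultiplierL {h : ℝ → ℂ} (hh : IntegrableOn h (Ioi 0))
    {φ : Lp ℂ ∞ (volume : Measure ℝ)}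
    (hφ : ∀ᵐ ξ : ℝ, φ ξ = ∫ r in Ioi (0 : ℝ),
      Complex.exp ((2 * Real.pi * (r * ξ) : ℝ) * Complex.I) * h r)
    (u v : Lp X 2 (volume : Measure ℝ)) :
    ⟪v, fourierMultiplierL X φ u⟫_ℂ = ∫ r in Ioi (0 : ℝ), h r * ⟪v, translateL X r u⟫_ℂ := by
  have e0 : ∀ w : Lp X 2 (volume : Measure ℝ), ⟪v, w⟫_ℂ = ∫ ξ,
      ⟪(𝓕 v : Lp X 2 (volume : Measure ℝ)) ξ, (𝓕 w : Lp X 2 (volume : Measure ℝ)) ξ⟫_ℂ := by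
    intro w
    rw [← Lp.inner_fourier_eq, L2.inner_def]
  have hw := L2.integrable_inner (𝕜 := ℂ) (𝓕 v : Lp X 2 (volume : Measure ℝ)) (𝓕 u)
  set w : ℝ → ℂ := fun ξ =>
    ⟪(𝓕 v : Lp X 2 (volume : Measure ℝ)) ξ, (𝓕 u : Lp X 2 (volume : Measure ℝ)) ξ⟫_ℂ with hwdef
  have e1 : ⟪v, fourierMultiplierL X φ u⟫_ℂ = ∫ ξ, ∫ r in Ioi (0 : ℝ),
      Complex.exp ((2 * Real.pi * (r * ξ) : ℝ) * Complex.I) * (h r * w ξ) := by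
    rw [e0, fourierMultiplierL_apply, fourier_fourierInv_eq]
    refine integral_congr_ae ?_
    filter_upwards [coeFn_multiplyL φ (𝓕 u), hφ] with ξ h1 h2
    rw [h1, inner_smul_right, h2, ← integral_mul_const]
    simp only [mul_assoc, hwdef]
  rw [e1, integral_integral_swap]
  · refine integral_congr_ae (ae_of_all _ fun r => ?_)
    simp only
    rw [e0, ← integral_const_mul]
    refine integral_congr_ae ?_
    filter_upwards [fourier_translateL r u] with ξ h1
    rw [h1, inner_smul_right]
    simp only [hwdef]
    ring
  -- Fubini applies because the integrand is an integrable product `w(ξ) h(r)` times a unimodular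
  -- factor.
  · have := (hw.mul_prod hh).bdd_mul (c := 1)
      (f := fun p : ℝ × ℝ => Complex.exp ((2 * Real.pi * (p.2 * p.1) : ℝ) * Complex.I))
      (Continuous.aestronglyMeasurable (by fun_prop))
      (ae_of_all _ fun p => norm_cexp_ofReal_mul_I_le _)
    refine this.congr (ae_of_all _ fun p => ?_)
    simp only [Function.uncurry]
    ring

end Toeplitz

/-! ### Analytic symbols and operators intertwining a semigroup with the left shift -/

section Intertwining

variable {X : Type*} [NormedAddCommGroup X] [InnerProductSpace ℂ X]

/-- On the imaginary axis, `φ` is `s ↦ ∫_0^∞ h(r) e^{rs} dr` with an integrable `h`. -/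
structure IsLaplaceSymbol (φ : Lp ℂ ∞ (volume : Measure ℝ)) (h : ℝ → ℂ) : Prop where
  integrableOn : IntegrableOn h (Ioi 0)
  ae_eq : ∀ᵐ ξ : ℝ, φ ξ = ∫ r in Ioi (0 : ℝ),
    Complex.exp ((2 * Real.pi * (r * ξ) : ℝ) * Complex.I) * h r

/-- `φ` is a bounded almost everywhere limit of symbols `∫_0^∞ h(r) e^{rs} dr`. -/
def IsAnalyticSymbol (φ : Lp ℂ ∞ (volume : Measure ℝ)) : Prop :=
  ∃ (φ' : ℕ → Lp ℂ ∞ (volume : Measure ℝ)) (h : ℕ → ℝ → ℂ) (K : ℝ),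
    (∀ n, IsLaplaceSymbol (φ' n) (h n)) ∧ (∀ n, ∀ᵐ ξ, ‖φ' n ξ‖ ≤ K) ∧
    ∀ᵐ ξ, Tendsto (fun n => φ' n ξ) atTop (𝓝 (φ ξ))

/-- `V` intertwines the semigroup `T` with the left shift on `L²((0,∞);X)`. -/
def IsIntertwining (T : ℝ → X →L[ℂ] X) (V : X →L[ℂ] Lp X 2 (volume.restrict (Ioi (0 : ℝ)))) :
    Prop :=
  ∀ r : ℝ, 0 ≤ r → ∀ x, restrictL X (translateL X r (extendL X (V x))) = V (T r x)

theorem ae_norm_le_norm_Lp_top {α : Type*} [MeasurableSpace α] {μ : Measure α} (φ : Lp X ∞ μ) :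
    ∀ᵐ t ∂μ, ‖φ t‖ ≤ ‖φ‖ := by
  filter_upwards [enorm_ae_le_eLpNormEssSup φ μ] with t ht
  rw [Lp.norm_def, eLpNorm_exponent_top, ← toReal_enorm]
  refine ENNReal.toReal_mono ?_ ht
  rw [← eLpNorm_exponent_top]
  exact Lp.eLpNorm_ne_top φ

theorem inner_restrictL (v : Lp X 2 (volume.restrict (Ioi (0 : ℝ))))
    (u : Lp X 2 (volume : Measure ℝ)) : ⟪v, restrictL X u⟫_ℂ = ⟪extendL X v, u⟫_ℂ := by
  rw [L2.inner_def, L2.inner_def, ← integral_indicator measurableSet_Ioi]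
  refine integral_congr_ae ?_
  filter_upwards [coeFn_extendByZero v,
    (ae_restrict_iff' measurableSet_Ioi).1 (coeFn_restrictL u)] with t h1 h2
  rw [extendL_apply, h1]
  by_cases ht : t ∈ Ioi (0 : ℝ)
  · simp only [indicator_of_mem ht, h2 ht]
  · simp only [indicator_of_notMem ht, inner_zero_left]

variable [CompleteSpace X]

theorem IsLaplaceSymbol.inner_eq {φ : Lp ℂ ∞ (volume : Measure ℝ)} {h : ℝ → ℂ}
    (hφ : IsLaplaceSymbol φ h) (v : Lp X 2 (volume.restrict (Ioi (0 : ℝ))))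
    (u : Lp X 2 (volume : Measure ℝ)) : ⟪v, restrictL X (fourierMultiplierL X φ u)⟫_ℂ
      = ∫ r in Ioi (0 : ℝ), h r * ⟪v, restrictL X (translateL X r u)⟫_ℂ := by
  simp only [inner_restrictL]
  exact inner_fourierMultiplierL hφ.integrableOn hφ.ae_eq u _

/-- Tested against `v`, both sides are integrals over `r` of compressed left shifts, and these do
not see the truncation performed by the inner Toeplitz operator. -/
theorem IsLaplaceSymbol.toeplitzL_comp {φ ψ χ : Lp ℂ ∞ (volume : Measure ℝ)} {h : ℝ → ℂ}
    (hφ : IsLaplaceSymbol φ h) (hχ : ∀ᵐ ξ, χ ξ = φ ξ * ψ ξ)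
    (f : Lp X 2 (volume.restrict (Ioi (0 : ℝ)))) :
    toeplitzL X χ f = toeplitzL X φ (toeplitzL X ψ f) := by
  refine ext_inner_left ℂ fun v => ?_
  rw [toeplitzL_apply, toeplitzL_apply, fourierMultiplierL_comp hχ, hφ.inner_eq, hφ.inner_eq]
  refine setIntegral_congr_fun measurableSet_Ioi fun r hr => ?_
  rw [toeplitzL_apply, restrictL_translateL_extendL r (le_of_lt hr)]

/-- Multiplicativity of Toeplitz operators, for a left factor with analytic symbol. -/
theorem IsAnalyticSymbol.toeplitzL_comp {φ ψ χ : Lp ℂ ∞ (volume : Measure ℝ)}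
    (hφ : IsAnalyticSymbol φ) (hχ : ∀ᵐ ξ, χ ξ = φ ξ * ψ ξ)
    (f : Lp X 2 (volume.restrict (Ioi (0 : ℝ)))) :
    toeplitzL X χ f = toeplitzL X φ (toeplitzL X ψ f) := by
  obtain ⟨φ', h, K, h1, h2, h3⟩ := hφ
  -- Only the left factor is approximated; `ψ` is an arbitrary bounded symbol, for which no
  -- analyticity is needed.
  let χ' : ℕ → Lp ℂ ∞ (volume : Measure ℝ) := fun n => φ' n • ψ
  have hχ' : ∀ n, ∀ᵐ ξ, χ' n ξ = φ' n ξ * ψ ξ := fun n => Lp.coeFn_lpSMul (φ' n) ψ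
  have hψ : ∀ᵐ ξ, ‖ψ ξ‖ ≤ ‖ψ‖ := ae_norm_le_norm_Lp_top ψ
  have t1 : Tendsto (fun n => toeplitzL X (χ' n) f) atTop (𝓝 (toeplitzL X χ f)) := by
    refine tendsto_toeplitzL (K := K * ‖ψ‖) (fun n => ?_) ?_ f
    · filter_upwards [hχ' n, h2 n, hψ] with ξ e1 e2 e3
      rw [e1, norm_mul]
      exact mul_le_mul e2 e3 (norm_nonneg _) ((norm_nonneg _).trans e2)
    · filter_upwards [ae_all_iff.2 hχ', h3, hχ] with ξ e1 e2 e3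
      simp only [e1, e3]
      exact e2.mul_const _
  have t2 := tendsto_toeplitzL h2 h3 (toeplitzL X ψ f)
  refine tendsto_nhds_unique t1 (t2.congr fun n => ?_)
  exact ((h1 n).toeplitzL_comp (hχ' n) f).symm

theorem IsC0Semigroup.integrableOn_smul_orbit {T : ℝ → X →L[ℂ] X} (hT : IsC0Semigroup T)
    (hs : IsExponentiallyStable T) {h : ℝ → ℂ} (hh : IntegrableOn h (Ioi 0)) (x : X) :
    IntegrableOn (fun r => h r • T r x) (Ioi 0) := by
  obtain ⟨M, hM, hb⟩ := hs.exists_bound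
  have h1 : IntegrableOn (fun r => h r • T |r| x) (Ioi 0) := by
    refine Integrable.smul_bdd hh (M * ‖x‖) (hT.continuous_orbit hs x).aestronglyMeasurable
      (ae_of_all _ fun r => (T |r|).le_of_opNorm_le (hb _ (abs_nonneg r)) x)
  refine h1.congr_fun (fun r hr => ?_) measurableSet_Ioi
  simp only [abs_of_pos (mem_Ioi.1 hr)]

/-- The intertwining relation is integrated over `r` against `h`. The operator acting on `x` on the
right does not depend on `V`. -/
theorem IsLaplaceSymbol.toeplitzL_intertwining {T : ℝ → X →L[ℂ] X} (hT : IsC0Semigroup T)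
    (hs : IsExponentiallyStable T) {φ : Lp ℂ ∞ (volume : Measure ℝ)} {h : ℝ → ℂ}
    (hφ : IsLaplaceSymbol φ h) {V : X →L[ℂ] Lp X 2 (volume.restrict (Ioi (0 : ℝ)))}
    (hV : IsIntertwining T V) (x : X) :
    toeplitzL X φ (V x) = V (∫ r in Ioi (0 : ℝ), h r • T r x) := by
  refine ext_inner_left ℂ fun v => ?_
  have hi := hT.integrableOn_smul_orbit hs hφ.integrableOn x
  rw [toeplitzL_apply, hφ.inner_eq, ← V.integral_comp_comm hi]
  have h2 := (innerSL ℂ v).integral_comp_comm (V.integrable_comp hi)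
  simp only [innerSL_apply_apply] at h2
  rw [← h2]
  refine setIntegral_congr_fun measurableSet_Ioi fun r hr => ?_
  rw [hV r (le_of_lt hr), map_smul, inner_smul_right]

/-- For each approximant, the operator `∫ h(r) T(r) dr` occurs for both `V` and `Ψ`; applying `Λ` to
the relation for `Ψ` eliminates it. What is left depends on the symbol only through Toeplitz
operators, so it passes to the strong limit even where the weights `h n` do not converge. -/
theorem IsAnalyticSymbol.toeplitzL_intertwining {T : ℝ → X →L[ℂ] X} (hT : IsC0Semigroup T)
    (hs : IsExponentiallyStable T) {φ : Lp ℂ ∞ (volume : Measure ℝ)} (hφ : IsAnalyticSymbol φ)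
    {V Ψ : X →L[ℂ] Lp X 2 (volume.restrict (Ioi (0 : ℝ)))} (hV : IsIntertwining T V)
    (hΨ : IsIntertwining T Ψ) {Λ : Lp X 2 (volume.restrict (Ioi (0 : ℝ))) →L[ℂ] X}
    (hΛ : ∀ x, Λ (Ψ x) = x) (x : X) :
    toeplitzL X φ (V x) = V (Λ (toeplitzL X φ (Ψ x))) := by
  obtain ⟨φ', h, K, h1, h2, h3⟩ := hφ
  have t1 := tendsto_toeplitzL h2 h3 (V x)
  have t2 := ((V ∘L Λ).continuous.tendsto _).comp (tendsto_toeplitzL h2 h3 (Ψ x))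
  refine tendsto_nhds_unique t1 (t2.congr fun n => ?_)
  simp only [Function.comp_apply, ContinuousLinearMap.comp_apply]
  rw [(h1 n).toeplitzL_intertwining hT hs hΨ, (h1 n).toeplitzL_intertwining hT hs hV, hΛ]

end Intertwining

/-! ### Superpositions of the operators of a semigroup, and negative fractional powers -/

section Superposition

variable {X : Type*} [NormedAddCommGroup X] [InnerProductSpace ℂ X]

/-- The weights `h` for which `∫_0^∞ h(r) T(r) x dr` converges for all exponentially stable `T`. -/
def IsSubexponential (h : ℝ → ℂ) : Prop :=
  ∀ ω : ℝ, 0 < ω → IntegrableOn (fun r : ℝ => h r * (Real.exp (-ω * r) : ℂ)) (Ioi 0)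

theorem IsC0Semigroup.continuousOn_orbit {T : ℝ → X →L[ℂ] X} (hT : IsC0Semigroup T)
    (hs : IsExponentiallyStable T) (x : X) : ContinuousOn (fun r => T r x) (Ici 0) :=
  (hT.continuous_orbit hs x).continuousOn.congr fun r hr => by
    simp only [abs_of_nonneg (mem_Ici.1 hr)]

theorem IsSubexponential.integrableOn {T : ℝ → X →L[ℂ] X} (hT : IsC0Semigroup T)
    (hs : IsExponentiallyStable T) {h : ℝ → ℂ} (hh : IsSubexponential h) (x : X) :
    IntegrableOn (fun r => h r • T r x) (Ioi 0) := by
  obtain ⟨M, ω, hω, hb⟩ := hs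
  -- The decay of the semigroup is moved to the weight: `e^{ωr} T(r)x` stays bounded and `h(r)
  -- e^{-ωr}` is integrable.
  have hc : ContinuousOn (fun r : ℝ => (Real.exp (ω * r) : ℂ) • T r x) (Ioi 0) :=
    ContinuousOn.smul (by fun_prop)
      ((hT.continuousOn_orbit ⟨M, ω, hω, hb⟩ x).mono Ioi_subset_Ici_self)
  have h1 := Integrable.smul_bdd (hh ω hω) (M * ‖x‖)
    (hc.aestronglyMeasurable measurableSet_Ioi) ?_
  · refine h1.congr (ae_of_all _ fun r => ?_)
    simp only [Pi.smul_apply']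
    rw [smul_smul, mul_assoc, ← Complex.ofReal_mul, ← Real.exp_add]
    simp
  · filter_upwards [ae_restrict_mem measurableSet_Ioi] with r hr
    rw [norm_smul, Complex.norm_real, Real.norm_eq_abs, Real.abs_exp]
    calc Real.exp (ω * r) * ‖T r x‖ ≤ Real.exp (ω * r) * (M * Real.exp (-ω * r) * ‖x‖) := by
          gcongr
          exact (T r).le_of_opNorm_le (hb r (le_of_lt hr)) x
      _ = M * ‖x‖ * (Real.exp (ω * r) * Real.exp (-ω * r)) := by ring
      _ = M * ‖x‖ := by rw [← Real.exp_add]; simp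

variable [CompleteSpace X]

/-- The operator `x ↦ ∫_0^∞ h(r) T(r) x dr`. -/
theorem IsSubexponential.exists_superposition {T : ℝ → X →L[ℂ] X} (hT : IsC0Semigroup T)
    (hs : IsExponentiallyStable T) {h : ℝ → ℂ} (hh : IsSubexponential h) :
    ∃ S : X →L[ℂ] X, ∀ x, S x = ∫ r in Ioi (0 : ℝ), h r • T r x := by
  have hi := hh.integrableOn hT hs
  obtain ⟨M, ω, hω, hb⟩ := hs
  refine ⟨LinearMap.mkContinuous
    { toFun := fun x => ∫ r in Ioi (0 : ℝ), h r • T r x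
      map_add' := fun x y => ?_
      map_smul' := fun c x => ?_ }
      (∫ r in Ioi (0 : ℝ), ‖h r * (Real.exp (-ω * r) : ℂ)‖ * M) fun x => ?_, fun x => rfl⟩
  · rw [← integral_add (hi x) (hi y)]
    simp only [map_add, smul_add]
  · rw [RingHom.id_apply, ← integral_smul]
    simp only [map_smul, smul_comm c]
  · refine (norm_integral_le_of_norm_le
      (g := fun r => ‖h r * (Real.exp (-ω * r) : ℂ)‖ * M * ‖x‖) ?_ ?_).trans_eq ?_
    · exact ((hh ω hω).norm.mul_const _).mul_const _
    · filter_upwards [ae_restrict_mem measurableSet_Ioi] with r hr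
      rw [norm_smul, norm_mul, Complex.norm_real, Real.norm_eq_abs, Real.abs_exp]
      have := (T r).le_of_opNorm_le (hb r (le_of_lt hr)) x
      calc ‖h r‖ * ‖T r x‖ ≤ ‖h r‖ * (M * Real.exp (-ω * r) * ‖x‖) := by gcongr
        _ = _ := by ring
    · rw [integral_mul_const]

theorem IsC0Semigroup.superposition_comm {T : ℝ → X →L[ℂ] X} (hT : IsC0Semigroup T)
    (hs : IsExponentiallyStable T) {h : ℝ → ℂ} (hh : IsSubexponential h) {S : X →L[ℂ] X}
    (hS : ∀ x, S x = ∫ r in Ioi (0 : ℝ), h r • T r x) {t : ℝ} (ht : 0 ≤ t) (x : X) :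
    T t (S x) = S (T t x) := by
  rw [hS, hS, ← (T t).integral_comp_comm (hh.integrableOn hT hs x)]
  refine setIntegral_congr_fun measurableSet_Ioi fun r hr => ?_
  have h1 := hT.map_add t r ht (le_of_lt hr)
  have h2 := hT.map_add r t (le_of_lt hr) ht
  rw [add_comm, h1] at h2
  rw [map_smul]
  exact congrArg _ (DFunLike.congr_fun h2 x)

/-- The weight must be real because it passes unconjugated from one slot of the inner product to the
other. -/
theorem IsC0Semigroup.inner_superposition_adjoint {T : ℝ → X →L[ℂ] X} (hT : IsC0Semigroup T)
    (hs : IsExponentiallyStable T) {h : ℝ → ℂ} (hh : IsSubexponential h)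
    (hreal : ∀ r, starRingEnd ℂ (h r) = h r) {S S' : X →L[ℂ] X}
    (hS : ∀ x, S x = ∫ r in Ioi (0 : ℝ), h r • T r x)
    (hS' : ∀ x, S' x = ∫ r in Ioi (0 : ℝ), h r • adjointSemigroup T r x) (x y : X) :
    ⟪S' y, x⟫_ℂ = ⟪y, S x⟫_ℂ := by
  have h1 := (innerSL ℂ y).integral_comp_comm (hh.integrableOn hT hs x)
  have h2 := (innerSL ℂ x).integral_comp_comm (hh.integrableOn (hT.adjoint hs) hs.adjoint y)
  simp only [innerSL_apply_apply] at h1 h2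
  rw [hS, hS', ← h1, ← inner_conj_symm, ← h2, ← integral_conj]
  refine integral_congr_ae (ae_of_all _ fun r => ?_)
  simp only
  rw [inner_conj_symm, inner_smul_left, inner_smul_right, hreal, adjointSemigroup,
    ContinuousLinearMap.adjoint_inner_left]

/-- Superpositions compose by convolution of the weights. -/
theorem IsC0Semigroup.superposition_comp {T : ℝ → X →L[ℂ] X} (hT : IsC0Semigroup T)
    (hs : IsExponentiallyStable T) {p q k : ℝ → ℂ} (hp : IsSubexponential p)
    (hq : IsSubexponential q) (hk : ∀ u : ℝ, 0 < u → ∫ t in (0 : ℝ)..u, p t * q (u - t) = k u)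
    (x : X) :
    ∫ t in Ioi (0 : ℝ), p t • T t (∫ s in Ioi (0 : ℝ), q s • T s x)
      = ∫ u in Ioi (0 : ℝ), k u • T u x := by
  have hqi := hq.integrableOn hT hs x
  have hco := hT.continuous_orbit hs x
  obtain ⟨M, ω, hω, hb⟩ := hs
  -- Damping both weights by `e^{-ωr}` makes them integrable on the line, so their convolution
  -- integrand is integrable in the plane. The factor `e^{-ωu}` this produces is compensated in the
  -- bounded function `W`.
  set f : ℝ → ℂ := (Ioi (0 : ℝ)).indicator fun r => p r * (Real.exp (-ω * r) : ℂ) with hf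
  set g : ℝ → ℂ := (Ioi (0 : ℝ)).indicator fun r => q r * (Real.exp (-ω * r) : ℂ) with hg
  have hfi : Integrable f := (integrable_indicator_iff measurableSet_Ioi).2 (hp ω hω)
  have hgi : Integrable g := (integrable_indicator_iff measurableSet_Ioi).2 (hq ω hω)
  set W : ℝ → X := fun u => (Real.exp (ω * |u|) : ℂ) • T |u| x with hW
  have hWc : Continuous W := by
    refine Continuous.smul ?_ hco
    fun_prop
  have hWb : ∀ u, ‖W u‖ ≤ M * ‖x‖ := by
    intro u
    rw [hW, norm_smul, Complex.norm_real, Real.norm_eq_abs, Real.abs_exp]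
    calc Real.exp (ω * |u|) * ‖T |u| x‖
        ≤ Real.exp (ω * |u|) * (M * Real.exp (-ω * |u|) * ‖x‖) := by
          gcongr
          exact (T |u|).le_of_opNorm_le (hb _ (abs_nonneg u)) x
      _ = M * ‖x‖ * (Real.exp (ω * |u|) * Real.exp (-ω * |u|)) := by ring
      _ = M * ‖x‖ := by rw [← Real.exp_add]; simp
  have hint : Integrable (Function.uncurry fun u t : ℝ => (f t * g (u - t)) • W u)
      (volume.prod volume) :=
    Integrable.smul_bdd (hfi.convolution_integrand (ContinuousLinearMap.mul ℝ ℂ) hgi) (M * ‖x‖)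
      (hWc.comp continuous_fst).aestronglyMeasurable (ae_of_all _ fun p => hWb p.1)
  -- Integrating first over `t` produces the convolution `k`; integrating first over `u` and
  -- substituting `u = s + t` produces the iterated superposition.
  have hswap := integral_integral_swap hint
  have hleft : ∀ u : ℝ, ∫ t, (f t * g (u - t)) • W u
      = (Ioi (0 : ℝ)).indicator (fun u => k u • T u x) u := by
    intro u
    rw [integral_smul_const]
    have e1 : ∀ t, f t * g (u - t)
        = (Ioo 0 u).indicator (fun t => (p t * q (u - t)) * (Real.exp (-ω * u) : ℂ)) t := by
      intro t
      by_cases h1 : 0 < t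
      · by_cases h2 : t < u
        · rw [hf, hg, indicator_of_mem (mem_Ioi.2 h1), indicator_of_mem (mem_Ioi.2 (sub_pos.2 h2)),
            indicator_of_mem (show t ∈ Ioo 0 u from ⟨h1, h2⟩),
            show -ω * u = -ω * t + -ω * (u - t) by ring, Real.exp_add, Complex.ofReal_mul]
          ring
        · rw [hg, indicator_of_notMem (s := Ioi 0) (by simpa using h2), mul_zero,
            indicator_of_notMem (fun h => h2 h.2)]
      · rw [hf, indicator_of_notMem (s := Ioi 0) (by simpa using h1), zero_mul,
            indicator_of_notMem (fun h => h1 h.1)]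
    simp only [e1]
    rw [integral_indicator measurableSet_Ioo, integral_mul_const]
    by_cases hu : 0 < u
    · rw [indicator_of_mem (mem_Ioi.2 hu), ← integral_Ioc_eq_integral_Ioo,
        ← intervalIntegral.integral_of_le hu.le, hk u hu]
      simp only [hW]
      rw [abs_of_pos hu, smul_smul, mul_assoc, ← Complex.ofReal_mul, ← Real.exp_add]
      simp
    · rw [indicator_of_notMem (s := Ioi 0) (by simpa using hu), Ioo_eq_empty hu]
      simp
  have hright : ∀ t : ℝ, ∫ u, (f t * g (u - t)) • W u
      = (Ioi (0 : ℝ)).indicator (fun t => p t • T t (∫ s in Ioi (0 : ℝ), q s • T s x)) t := by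
    intro t
    rw [← integral_add_right_eq_self _ t]
    simp only [add_sub_cancel_right]
    by_cases ht : 0 < t
    · rw [indicator_of_mem (mem_Ioi.2 ht), ← (T t).integral_comp_comm hqi, ← integral_smul,
        ← integral_indicator measurableSet_Ioi]
      refine integral_congr_ae (ae_of_all _ fun s => ?_)
      simp only
      by_cases h0 : 0 < s
      · rw [hf, hg, indicator_of_mem (mem_Ioi.2 h0), indicator_of_mem (mem_Ioi.2 h0),
          indicator_of_mem (mem_Ioi.2 ht), hW]
        simp only
        rw [abs_of_pos (add_pos h0 ht), add_comm s t, hT.map_add t s ht.le h0.le, map_smul,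
          smul_smul, smul_smul]
        have : p t * (Real.exp (-ω * t) : ℂ) * (q s * (Real.exp (-ω * s) : ℂ))
            * (Real.exp (ω * (t + s)) : ℂ) = p t * q s := by
          have h3 : (Real.exp (-ω * t) : ℂ) * (Real.exp (-ω * s) : ℂ)
              * (Real.exp (ω * (t + s)) : ℂ) = 1 := by
            rw [← Complex.ofReal_mul, ← Complex.ofReal_mul, ← Real.exp_add, ← Real.exp_add]
            ring_nf
            simp
          linear_combination p t * q s * h3
        rw [this]
        rfl
      · rw [hg, indicator_of_notMem (s := Ioi 0) (by simpa using h0),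
          indicator_of_notMem (s := Ioi 0) (by simpa using h0), mul_zero, zero_smul]
    · rw [indicator_of_notMem (s := Ioi 0) (by simpa using ht), hf,
        indicator_of_notMem (s := Ioi 0) (by simpa using ht)]
      simp
  simp only [hleft, hright] at hswap
  rw [integral_indicator measurableSet_Ioi, integral_indicator measurableSet_Ioi] at hswap
  exact hswap.symm

/-- The weight of the negative fractional power of order `α`. -/
def gammaWeight (α t : ℝ) : ℂ := ((Real.Gamma α : ℝ) : ℂ)⁻¹ * ((t ^ (α - 1) : ℝ) : ℂ)

theorem isSubexponential_gammaWeight {α : ℝ} (hα : 0 < α) : IsSubexponential (gammaWeight α) := by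
  intro ω hω
  have h := (integrableOn_rpow_mul_exp_neg_mul_rpow (s := α - 1) (p := 1) (by linarith) one_pos hω)
  refine (h.ofReal (𝕜 := ℂ)|>.const_mul ((Real.Gamma α : ℝ) : ℂ)⁻¹).congr (ae_of_all _ fun t => ?_)
  simp [gammaWeight, mul_assoc]

theorem gammaWeight_one {t : ℝ} : gammaWeight 1 t = 1 := by
  simp [gammaWeight]

theorem conj_gammaWeight (α t : ℝ) : starRingEnd ℂ (gammaWeight α t) = gammaWeight α t := by
  rw [gammaWeight, map_mul, map_inv₀, Complex.conj_ofReal, Complex.conj_ofReal]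

/-- This is Euler's Beta integral `B(α,β) = Γ(α)Γ(β)/Γ(α+β)`, scaled to `[0,u]`. It encodes the law
`(-A)^{-α} (-A)^{-β} = (-A)^{-(α+β)}`. -/
theorem gammaWeight_convolution {α β : ℝ} (hα : 0 < α) (hβ : 0 < β) {u : ℝ} (hu : 0 < u) :
    ∫ t in (0 : ℝ)..u, gammaWeight α t * gammaWeight β (u - t) = gammaWeight (α + β) u := by
  have h1 := Complex.betaIntegral_scaled α β hu
  have h2 := Complex.Gamma_mul_Gamma_eq_betaIntegral (s := α) (t := β) (by simpa) (by simpa)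
  have e : ∀ t ∈ uIcc 0 u, gammaWeight α t * gammaWeight β (u - t)
      = (Complex.Gamma α)⁻¹ * (Complex.Gamma β)⁻¹ *
        ((t : ℂ) ^ ((α : ℂ) - 1) * ((u : ℂ) - t) ^ ((β : ℂ) - 1)) := by
    intro t ht
    rw [uIcc_of_le hu.le] at ht
    rw [gammaWeight, gammaWeight, Complex.ofReal_cpow ht.1,
      Complex.ofReal_cpow (sub_nonneg.2 ht.2), Complex.Gamma_ofReal, Complex.Gamma_ofReal]
    push_cast
    ring
  rw [intervalIntegral.integral_congr e, intervalIntegral.integral_const_mul, h1, gammaWeight,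
    Complex.ofReal_cpow hu.le, ← Complex.Gamma_ofReal]
  have g1 : Complex.Gamma α ≠ 0 := Complex.Gamma_ne_zero_of_re_pos (by simpa)
  have g2 : Complex.Gamma β ≠ 0 := Complex.Gamma_ne_zero_of_re_pos (by simpa)
  have g3 : Complex.Gamma (α + β : ℂ) ≠ 0 := Complex.Gamma_ne_zero_of_re_pos (by simp; linarith)
  push_cast
  field_simp
  linear_combination -(u : ℂ) ^ ((α : ℂ) + β - 1) * h2

end Superposition

/-! ### The generator and its inverse, orbits, and square-function embeddings -/

section Generator

variable {X : Type*} [NormedAddCommGroup X] [InnerProductSpace ℂ X] [CompleteSpace X]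

theorem IsC0Semigroup.integrableOn_orbit {T : ℝ → X →L[ℂ] X} (hT : IsC0Semigroup T)
    (hs : IsExponentiallyStable T) (x : X) : IntegrableOn (fun r => T r x) (Ioi 0) := by
  refine ((isSubexponential_gammaWeight one_pos).integrableOn hT hs x).congr
    (ae_of_all _ fun r => ?_)
  simp only [gammaWeight_one, one_smul]

/-- `∫_0^∞ T(r) w dr` is a preimage of `-w` under the generator. -/
theorem IsC0Semigroup.integral_mem_generatorGraph {T : ℝ → X →L[ℂ] X} (hT : IsC0Semigroup T)
    (hs : IsExponentiallyStable T) (w : X) :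
    (∫ r in Ioi (0 : ℝ), T r w, -w) ∈ generatorGraph T := by
  obtain ⟨S, hS⟩ := hT.exists_integrated hs
  have h2 := (hT.tendsto_integrated hs hS 0 w).neg
  have h3 : S 0 w = 0 := by simp [hS]
  simp only [abs_zero, hT.map_zero, zero_add, h3, sub_zero, one_apply_eq_self] at h2
  refine h2.congr' ?_
  filter_upwards [self_mem_nhdsWithin] with h hh
  have hh' : (0 : ℝ) ≤ h := le_of_lt hh
  have hi := hT.integrableOn_orbit hs w
  -- Applying `T h` moves the lower limit to `h`, so the difference quotient is minus the mean of
  -- the orbit over `(0,h)`.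
  have e1 : T h (∫ r in Ioi (0 : ℝ), T r w) = ∫ r in Ioi h, T r w := by
    rw [← (T h).integral_comp_comm hi, ← integral_indicator measurableSet_Ioi,
      ← integral_indicator measurableSet_Ioi,
      ← integral_add_right_eq_self ((Ioi h).indicator fun r => T r w) h]
    refine integral_congr_ae (ae_of_all _ fun r => ?_)
    simp only [indicator_apply, mem_Ioi, lt_add_iff_pos_left]
    split_ifs with h0
    · rw [add_comm, hT.map_add h r hh' h0.le]
      rfl
    · rfl
  have e2 : S h w = ∫ r in Ioc 0 h, T r w := by
    rw [hS, intervalIntegral.integral_of_le hh']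
    refine setIntegral_congr_fun measurableSet_Ioc fun r hr => ?_
    simp only [abs_of_pos hr.1]
  have e3 : ∫ r in Ioi (0 : ℝ), T r w = (∫ r in Ioc 0 h, T r w) + ∫ r in Ioi h, T r w := by
    rw [← setIntegral_union (Ioc_disjoint_Ioi le_rfl) measurableSet_Ioi
      (hi.mono_set Ioc_subset_Ioi_self) (hi.mono_set (Ioi_subset_Ioi hh')),
      Ioc_union_Ioi_eq_Ioi hh']
  rw [e1, e2, e3, ← smul_neg]
  congr 1
  abel

/-- Let `t → ∞` in `∫_0^t T(r) y dr = T(t) x - x`; exponential stability gives `T(t) x → 0`. -/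
theorem IsC0Semigroup.integral_of_mem_generatorGraph {T : ℝ → X →L[ℂ] X} (hT : IsC0Semigroup T)
    (hs : IsExponentiallyStable T) {x y : X} (hxy : (x, y) ∈ generatorGraph T) :
    ∫ r in Ioi (0 : ℝ), T r y = -x := by
  obtain ⟨S, hS⟩ := hT.exists_integrated hs
  have hi := hT.integrableOn_orbit hs y
  have t1 := intervalIntegral_tendsto_integral_Ioi 0 hi tendsto_id
  have t2 : Tendsto (fun t : ℝ => T t x - x) atTop (𝓝 (0 - x)) := by
    refine Tendsto.sub_const ?_ x
    obtain ⟨M, ω, hω, hb⟩ := hs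
    have t3 : Tendsto (fun t : ℝ => M * Real.exp (-ω * t) * ‖x‖) atTop (𝓝 (M * 0 * ‖x‖)) := by
      refine Tendsto.mul_const _ (Tendsto.const_mul _ ?_)
      refine Real.tendsto_exp_atBot.comp ?_
      exact tendsto_id.const_mul_atTop_of_neg (by linarith)
    rw [mul_zero, zero_mul] at t3
    refine squeeze_zero_norm' ?_ t3
    filter_upwards [eventually_ge_atTop 0] with t ht
    exact (T t).le_of_opNorm_le (hb t ht) x
  rw [zero_sub] at t2
  refine tendsto_nhds_unique t1 (t2.congr' ?_)
  filter_upwards [eventually_ge_atTop 0] with t ht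
  rw [← hT.integrated_generator hs hS ht hxy, hS]
  refine intervalIntegral.integral_congr fun r hr => ?_
  rw [uIcc_of_le ht] at hr
  simp only [abs_of_nonneg hr.1]

theorem IsC0Semigroup.map_mem_generatorGraph {T : ℝ → X →L[ℂ] X} (hT : IsC0Semigroup T)
    {x y : X} (hxy : (x, y) ∈ generatorGraph T) {t : ℝ} (ht : 0 ≤ t) :
    (T t x, T t y) ∈ generatorGraph T := by
  have h : Tendsto _ _ _ := ((T t).continuous.tendsto y).comp hxy
  refine h.congr' ?_
  filter_upwards [self_mem_nhdsWithin] with h hh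
  have h1 := hT.map_add t h ht (le_of_lt hh)
  have h2 := hT.map_add h t (le_of_lt hh) ht
  rw [add_comm, h1] at h2
  simp only [Function.comp_apply, map_smul, map_sub]
  congr 2
  exact DFunLike.congr_fun h2 x

theorem mem_domain_generator_iff {T : ℝ → X →L[ℂ] X} {x : X} :
    x ∈ (generator T).domain ↔ ∃ y, (x, y) ∈ generatorGraph T := by
  rw [LinearPMap.mem_domain_iff, generator_graph]

theorem IsC0Semigroup.map_mem_domain {T : ℝ → X →L[ℂ] X} (hT : IsC0Semigroup T)
    {x : X} (hx : x ∈ (generator T).domain) {t : ℝ} (ht : 0 ≤ t) :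
    T t x ∈ (generator T).domain := by
  obtain ⟨y, hy⟩ := mem_domain_generator_iff.1 hx
  exact mem_domain_generator_iff.2 ⟨_, hT.map_mem_generatorGraph hy ht⟩

/-- The pair `(0, -w)` would lie in the graph of the single-valued operator `A`. -/
theorem IsC0Semigroup.eq_zero_of_integral_eq_zero {T : ℝ → X →L[ℂ] X} (hT : IsC0Semigroup T)
    (hs : IsExponentiallyStable T) {w : X} (h : ∫ r in Ioi (0 : ℝ), T r w = 0) : w = 0 := by
  have h1 := hT.integral_mem_generatorGraph hs w
  rw [h, ← generator_graph] at h1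
  simpa using LinearPMap.graph_fst_eq_zero_snd _ h1 rfl

/-- The rescaled semigroup `e^{-at} T(t)`. -/
def rescaledSemigroup (a : ℂ) (T : ℝ → X →L[ℂ] X) : ℝ → X →L[ℂ] X :=
  fun t => Complex.exp (-a * t) • T t

theorem IsC0Semigroup.rescaled {T : ℝ → X →L[ℂ] X} (hT : IsC0Semigroup T) (a : ℂ) :
    IsC0Semigroup (rescaledSemigroup a T) where
  map_zero := by simp [rescaledSemigroup, hT.map_zero]
  map_add s t h1 h2 := by
    simp only [rescaledSemigroup]
    rw [hT.map_add s t h1 h2, smul_mul_smul_comm, ← Complex.exp_add]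
    push_cast
    ring_nf
  tendsto_zero x := by
    have h1 : Tendsto (fun t : ℝ => Complex.exp (-a * t)) (𝓝[>] 0) (𝓝 1) := by
      have : Continuous fun t : ℝ => Complex.exp (-a * t) := by fun_prop
      simpa using (this.tendsto 0).mono_left nhdsWithin_le_nhds
    simpa [rescaledSemigroup] using h1.smul (hT.tendsto_zero x)

theorem IsExponentiallyStable.rescaled {T : ℝ → X →L[ℂ] X} (hs : IsExponentiallyStable T) {a : ℂ}
    (ha : 0 ≤ a.re) : IsExponentiallyStable (rescaledSemigroup a T) := by
  obtain ⟨M, ω, hω, hb⟩ := hs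
  refine ⟨M, ω, hω, fun t ht => ?_⟩
  rw [rescaledSemigroup, norm_smul, Complex.norm_exp]
  refine (mul_le_of_le_one_left (norm_nonneg _) ?_).trans (hb t ht)
  rw [Real.exp_le_one_iff]
  simp
  positivity

/-- Product rule for `e^{-at} T(t)x` at `t = 0`. It reduces the resolvent of `A` at `a` to the
inverse of the generator of the rescaled semigroup. -/
theorem mem_generatorGraph_rescaled {T : ℝ → X →L[ℂ] X} (a : ℂ) {x y : X}
    (hxy : (x, y) ∈ generatorGraph T) : (x, y - a • x) ∈ generatorGraph (rescaledSemigroup a T) := by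
  have h1 : Tendsto (fun t : ℝ => Complex.exp (-a * t)) (𝓝[>] 0) (𝓝 1) := by
    have : Continuous fun t : ℝ => Complex.exp (-a * t) := by fun_prop
    simpa using (this.tendsto 0).mono_left nhdsWithin_le_nhds
  have h2 : Tendsto (fun t : ℝ => (t : ℂ)⁻¹ * (Complex.exp (-a * t) - 1)) (𝓝[>] 0) (𝓝 (-a)) := by
    have hd : HasDerivAt (fun t : ℝ => Complex.exp (-a * t)) (-a) 0 := by
      have h := ((Complex.ofRealCLM.hasDerivAt (x := 0)).const_mul (-a)).cexp
      simpa using h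
    refine (hd.tendsto_slope_zero_right).congr fun t => ?_
    rw [zero_add, ← Complex.ofReal_inv, Complex.real_smul]
    simp
  have h3 := (h1.smul (show Tendsto _ _ _ from hxy)).add (h2.smul_const x)
  rw [one_smul, neg_smul, ← sub_eq_add_neg] at h3
  refine h3.congr fun t => ?_
  simp only [rescaledSemigroup, _root_.smul_apply]
  module

theorem mem_generatorGraph_of_rescaled {T : ℝ → X →L[ℂ] X} (a : ℂ) {x y : X}
    (hxy : (x, y) ∈ generatorGraph (rescaledSemigroup a T)) : (x, y + a • x) ∈ generatorGraph T := by
  have h := mem_generatorGraph_rescaled (-a) hxy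
  have e : rescaledSemigroup (-a) (rescaledSemigroup a T) = T := by
    ext t x
    simp only [rescaledSemigroup, smul_smul, ← Complex.exp_add]
    simp
  rwa [e, neg_smul, sub_neg_eq_add] at h

theorem IsC0Semigroup.memLp_orbit {T : ℝ → X →L[ℂ] X} (hT : IsC0Semigroup T)
    (hs : IsExponentiallyStable T) :
    ∃ C : ℝ, 0 ≤ C ∧ ∀ x, MemLp (fun t => T t x) 2 (volume.restrict (Ioi (0 : ℝ))) ∧
      ∫ t in Ioi (0 : ℝ), ‖T t x‖ ^ 2 ≤ C * ‖x‖ ^ 2 := by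
  have hc := hT.continuousOn_orbit hs
  obtain ⟨M, ω, hω, hb⟩ := hs
  have hi : IntegrableOn (fun t : ℝ => Real.exp (-(2 * ω) * t)) (Ioi 0) :=
    integrableOn_exp_mul_Ioi (by linarith) 0
  have hle : ∀ x : X, ∀ t ∈ Ioi (0 : ℝ), ‖T t x‖ ^ 2
      ≤ M ^ 2 * ‖x‖ ^ 2 * Real.exp (-(2 * ω) * t) := by
    intro x t ht
    have h1 := (T t).le_of_opNorm_le (hb t (le_of_lt ht)) x
    calc ‖T t x‖ ^ 2 ≤ (M * Real.exp (-ω * t) * ‖x‖) ^ 2 := by gcongr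
      _ = M ^ 2 * ‖x‖ ^ 2 * (Real.exp (-ω * t) * Real.exp (-ω * t)) := by ring
      _ = _ := by rw [← Real.exp_add]; ring_nf
  refine ⟨M ^ 2 * ∫ t in Ioi (0 : ℝ), Real.exp (-(2 * ω) * t), ?_, fun x => ?_⟩
  · exact mul_nonneg (sq_nonneg _) (integral_nonneg fun _ => (Real.exp_pos _).le)
  have hm : AEStronglyMeasurable (fun t => T t x) (volume.restrict (Ioi (0 : ℝ))) :=
    ((hc x).mono Ioi_subset_Ici_self).aestronglyMeasurable measurableSet_Ioi
  have hint : IntegrableOn (fun t => ‖T t x‖ ^ 2) (Ioi 0) := by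
    refine (hi.const_mul (M ^ 2 * ‖x‖ ^ 2)).mono' (hm.norm.pow 2) ?_
    filter_upwards [ae_restrict_mem measurableSet_Ioi] with t ht
    rw [norm_pow, norm_norm]
    exact hle x t ht
  refine ⟨(memLp_two_iff_integrable_sq_norm hm).2 hint, ?_⟩
  calc ∫ t in Ioi (0 : ℝ), ‖T t x‖ ^ 2
      ≤ ∫ t in Ioi (0 : ℝ), M ^ 2 * ‖x‖ ^ 2 * Real.exp (-(2 * ω) * t) :=
        setIntegral_mono_on hint (hi.const_mul _) measurableSet_Ioi (hle x)
    _ = _ := by rw [integral_const_mul]; ring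

/-- The orbit map `x ↦ T(·)x` is bounded from `X` to `L²((0,∞);X)` and intertwines the semigroup
with the left shift. -/
theorem IsC0Semigroup.exists_orbit {T : ℝ → X →L[ℂ] X} (hT : IsC0Semigroup T)
    (hs : IsExponentiallyStable T) :
    ∃ V : X →L[ℂ] Lp X 2 (volume.restrict (Ioi (0 : ℝ))), (∀ x, V x = orbitLp T x) ∧
      (∀ x, V x =ᵐ[volume.restrict (Ioi (0 : ℝ))] fun t => T t x) ∧ IsIntertwining T V := by
  obtain ⟨C, hC, h⟩ := hT.memLp_orbit hs
  have e : ∀ x, orbitLp T x = (h x).1.toLp := fun x => dif_pos (h x).1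
  have e' : ∀ x, orbitLp T x =ᵐ[volume.restrict (Ioi (0 : ℝ))] fun t => T t x := fun x => by
    rw [e]; exact (h x).1.coeFn_toLp
  refine ⟨LinearMap.mkContinuous
    { toFun := orbitLp T
      map_add' := fun x y => ?_
      map_smul' := fun c x => ?_ } (Real.sqrt C) fun x => ?_, fun x => rfl, e', ?_⟩
  · refine Lp.ext ?_
    filter_upwards [e' (x + y), e' x, e' y, Lp.coeFn_add (orbitLp T x) (orbitLp T y)]
      with t h1 h2 h3 h4
    rw [h1, h4, Pi.add_apply, h2, h3, _root_.map_add]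
  · refine Lp.ext ?_
    filter_upwards [e' (c • x), e' x, Lp.coeFn_smul c (orbitLp T x)] with t h1 h2 h3
    rw [h1, RingHom.id_apply, h3, Pi.smul_apply, h2, map_smul]
  · refine abs_le_of_sq_le_sq' ?_ (by positivity) |>.2
    rw [mul_pow, Real.sq_sqrt hC]
    refine le_trans (le_of_eq ?_) (h x).2
    refine (Lp.norm_sq_eq_integral (orbitLp T x)).trans (integral_congr_ae ?_)
    filter_upwards [e' x] with t h1
    rw [h1]
  · intro r hr x
    change restrictL X (translateL X r (extendL X (orbitLp T x))) = orbitLp T (T r x)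
    refine Lp.ext ?_
    have h0 : ∀ᵐ t : ℝ, extendL X (orbitLp T x) t = (Ioi (0 : ℝ)).indicator (fun t => T t x) t := by
      filter_upwards [coeFn_extendByZero (orbitLp T x),
        (ae_restrict_iff' measurableSet_Ioi).1 (e' x)] with t h1 h2
      rw [extendL_apply, h1]
      by_cases ht : t ∈ Ioi (0 : ℝ)
      · simp only [indicator_of_mem ht, h2 ht]
      · simp only [indicator_of_notMem ht]
    have h1 := (measurePreserving_add_right volume r).quasiMeasurePreserving.ae h0
    filter_upwards [coeFn_restrictL (translateL X r (extendL X (orbitLp T x))),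
      ae_restrict_of_ae (coeFn_translateL r (extendL X (orbitLp T x))), ae_restrict_of_ae h1,
      e' (T r x), ae_restrict_mem measurableSet_Ioi] with t e1 e2 e3 e4 ht
    rw [e1, e2, e3, e4, indicator_of_mem (show t + r ∈ Ioi 0 from add_pos_of_pos_of_nonneg ht hr),
      hT.map_add t r (le_of_lt ht) hr]
    rfl

end Generator

/-! ### Square functions of `(-A)^{1/2}` and left invertibility -/

section SquareFunction

variable {X : Type*} [NormedAddCommGroup X] [InnerProductSpace ℂ X] [CompleteSpace X]

/-- Since `1/2 + 1/2 = 1`, the convolved weight is the constant `1`. Here `B = (-A)^{-1/2}` and `R =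
(-A)^{-1}`, notation kept in what follows. -/
theorem IsC0Semigroup.negPow_half_comp {T : ℝ → X →L[ℂ] X} (hT : IsC0Semigroup T)
    (hs : IsExponentiallyStable T) {B R : X →L[ℂ] X}
    (hB : ∀ x, B x = ∫ r in Ioi (0 : ℝ), gammaWeight (1 / 2) r • T r x)
    (hR : ∀ x, R x = ∫ r in Ioi (0 : ℝ), T r x) (x : X) : B (B x) = R x := by
  have hg : IsSubexponential (gammaWeight (1 / 2)) := isSubexponential_gammaWeight (by norm_num)
  have hh : (0 : ℝ) < 1 / 2 := by norm_num
  have h := hT.superposition_comp hs hg hg (k := gammaWeight (1 / 2 + 1 / 2))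
    (fun u hu => gammaWeight_convolution hh hh hu) x
  rw [hB, hB, h, hR]
  norm_num
  simp only [gammaWeight_one, one_smul]

theorem IsC0Semigroup.negPow_half_injective {T : ℝ → X →L[ℂ] X} (hT : IsC0Semigroup T)
    (hs : IsExponentiallyStable T) {B : X →L[ℂ] X}
    (hB : ∀ x, B x = ∫ r in Ioi (0 : ℝ), gammaWeight (1 / 2) r • T r x) {x : X} (hx : B x = 0) :
    x = 0 := by
  obtain ⟨R, hR⟩ := (isSubexponential_gammaWeight one_pos).exists_superposition hT hs
  simp only [gammaWeight_one, one_smul] at hR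
  refine hT.eq_zero_of_integral_eq_zero hs ?_
  rw [← hR, ← hT.negPow_half_comp hs hB hR, hx, _root_.map_zero]

/-- Translates membership in the graph of the unbounded operator `(-A)^{1/2}` into an equation for
the bounded operator `B`, the only form in which admissibility is used. -/
theorem IsC0Semigroup.mem_graph_negGeneratorPow_half {T : ℝ → X →L[ℂ] X} (hT : IsC0Semigroup T)
    (hs : IsExponentiallyStable T) {B : X →L[ℂ] X}
    (hB : ∀ x, B x = ∫ r in Ioi (0 : ℝ), gammaWeight (1 / 2) r • T r x) {x z : X}
    (h : (x, z) ∈ (negGeneratorPow T (1 / 2)).graph) : B z = x := by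
  have happ : ∀ z : (negGeneratorNegPow T (1 / 2)).domain, negGeneratorNegPow T (1 / 2) z = B z := by
    intro z
    rw [hB]
    simp only [gammaWeight, mul_smul, integral_smul]
    rfl
  -- `LinearPMap.inverse` has the transposed graph only when the kernel is trivial.
  have hker : LinearMap.ker (negGeneratorNegPow T (1 / 2)).toFun = ⊥ := by
    rw [LinearMap.ker_eq_bot']
    intro z hz
    exact Subtype.ext (hT.negPow_half_injective hs hB ((happ z).symm.trans hz))
  rw [negGeneratorPow, LinearPMap.inverse_graph hker] at h
  obtain ⟨⟨z', x'⟩, hp, he⟩ := h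
  obtain ⟨rfl, rfl⟩ : x' = x ∧ z' = z := by simpa using he
  obtain ⟨w, rfl, rfl⟩ := (LinearPMap.mem_graph_iff _).1 hp
  exact (happ w).symm

/-- If `(-A)^{1/2}` is admissible, then `x ↦ (-A)^{1/2} T(·)x` extends to a bounded operator from
`X` to `L²((0,∞);X)` which intertwines the semigroup with the left shift. -/
theorem IsC0Semigroup.exists_squareFunction {T : ℝ → X →L[ℂ] X} (hT : IsC0Semigroup T)
    (hs : IsExponentiallyStable T) (hadm : IsAdmissible T (negGeneratorPow T (1 / 2)))
    {B R : X →L[ℂ] X} (hB : ∀ x, B x = ∫ r in Ioi (0 : ℝ), gammaWeight (1 / 2) r • T r x)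
    (hR : ∀ x, R x = ∫ r in Ioi (0 : ℝ), T r x)
    {V : X →L[ℂ] Lp X 2 (volume.restrict (Ioi (0 : ℝ)))}
    (hV : ∀ x, V x =ᵐ[volume.restrict (Ioi (0 : ℝ))] fun t => T t x) (hVT : IsIntertwining T V) :
    ∃ Ψ : X →L[ℂ] Lp X 2 (volume.restrict (Ioi (0 : ℝ))), (∀ w, Ψ (R w) = V (B w)) ∧
      IsIntertwining T Ψ ∧ DenseRange R := by
  have hg : IsSubexponential (gammaWeight (1 / 2)) := isSubexponential_gammaWeight (by norm_num)
  have hBB := hT.negPow_half_comp hs hB hR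
  obtain ⟨-, m, hm⟩ := hadm
  have hRmem : ∀ w, R w ∈ (generator T).domain := fun w => by
    rw [hR]
    exact mem_domain_generator_iff.2 ⟨_, hT.integral_mem_generatorGraph hs w⟩
  have hdense : DenseRange R := by
    refine (hT.dense_generator_domain hs).mono fun x hx => ?_
    obtain ⟨y, hy⟩ := mem_domain_generator_iff.1 hx
    refine ⟨-y, ?_⟩
    rw [map_neg, hR, hT.integral_of_mem_generatorGraph hs hy, neg_neg]
  -- The admissibility constant `m` is not known to be nonnegative, hence `max m 0`.
  have hbound : ∀ w, ‖V (B w)‖ ≤ Real.sqrt (max m 0) * ‖R w‖ := by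
    intro w
    obtain ⟨f, hf, -, hfm⟩ := hm (R w) (hRmem w)
    -- As `R = B²`, formally `(-A)^{1/2} T(t) R w = T(t) B w`; injectivity of `B` makes this
    -- rigorous.
    have hft : ∀ t, 0 ≤ t → f t = T t (B w) := by
      intro t ht
      have h1 := hT.mem_graph_negGeneratorPow_half hs hB (hf t ht)
      rw [← sub_eq_zero]
      refine hT.negPow_half_injective hs hB ?_
      rw [map_sub, h1, ← hT.superposition_comm hs hg hB ht, hBB, sub_self]
    refine abs_le_of_sq_le_sq' ?_ (by positivity) |>.2
    rw [mul_pow, Real.sq_sqrt (le_max_right _ _), Lp.norm_sq_eq_integral]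
    calc ∫ t in Ioi (0 : ℝ), ‖V (B w) t‖ ^ 2 = ∫ t in Ioi (0 : ℝ), ‖f t‖ ^ 2 := by
          refine integral_congr_ae ?_
          filter_upwards [hV (B w), ae_restrict_mem measurableSet_Ioi] with t h1 h2
          rw [h1, hft t (le_of_lt h2)]
      _ ≤ m * ‖R w‖ ^ 2 := hfm
      _ ≤ max m 0 * ‖R w‖ ^ 2 := by gcongr; exact le_max_left _ _
  -- On the dense range of `R` the map is `R w ↦ V (B w)`; `hbound` makes it well defined and
  -- bounded, so it extends to `X`.
  set Ψ := LinearMap.extendOfNorm ((V ∘L B).toLinearMap) (R : X →ₗ[ℂ] X) with hΨ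
  have hΨR : ∀ w, Ψ (R w) = V (B w) := fun w => LinearMap.extendOfNorm_eq
    (f := ((V ∘L B).toLinearMap)) (e := (R : X →ₗ[ℂ] X)) hdense ⟨_, hbound⟩ w
  refine ⟨Ψ, hΨR, fun r hr x => ?_, hdense⟩
  have hR1 : ∀ x, R x = ∫ r in Ioi (0 : ℝ), gammaWeight 1 r • T r x := by
    simpa only [gammaWeight_one, one_smul] using hR
  refine hdense.induction_on (p := fun x => restrictL X (translateL X r (extendL X (Ψ x)))
    = Ψ (T r x)) x (isClosed_eq ?_ ?_) fun w => ?_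
  · exact (restrictL X).continuous.comp ((translateL X r).continuous.comp
      ((extendL X).continuous.comp Ψ.continuous))
  · exact Ψ.continuous.comp (T r).continuous
  · rw [hΨR, hVT r hr, hT.superposition_comm hs (isSubexponential_gammaWeight one_pos) hR1 hr,
      hΨR, hT.superposition_comm hs hg hB hr]

/-- If `(-A)^{1/2}` and `(-A^*)^{1/2}` are admissible, then the bounded extension of
`x ↦ (-A)^{1/2} T(·)x` is left invertible. -/
theorem IsC0Semigroup.exists_leftInvertible_intertwining {T : ℝ → X →L[ℂ] X}
    (hT : IsC0Semigroup T) (hs : IsExponentiallyStable T)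
    (hadm : IsAdmissible T (negGeneratorPow T (1 / 2)))
    (hadm' : IsAdmissible (adjointSemigroup T) (negGeneratorPow (adjointSemigroup T) (1 / 2))) :
    ∃ (Ψ : X →L[ℂ] Lp X 2 (volume.restrict (Ioi (0 : ℝ))))
      (Λ : Lp X 2 (volume.restrict (Ioi (0 : ℝ))) →L[ℂ] X),
      IsIntertwining T Ψ ∧ ∀ x, Λ (Ψ x) = x := by
  have hT' := hT.adjoint hs
  have hs' := hs.adjoint
  have hg : IsSubexponential (gammaWeight (1 / 2)) := isSubexponential_gammaWeight (by norm_num)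
  have hg1 : IsSubexponential (gammaWeight 1) := isSubexponential_gammaWeight one_pos
  obtain ⟨B, hB⟩ := hg.exists_superposition hT hs
  obtain ⟨B', hB'⟩ := hg.exists_superposition hT' hs'
  obtain ⟨R, hR1⟩ := hg1.exists_superposition hT hs
  obtain ⟨R', hR1'⟩ := hg1.exists_superposition hT' hs'
  have hR : ∀ x, R x = ∫ r in Ioi (0 : ℝ), T r x := by
    simpa only [gammaWeight_one, one_smul] using hR1
  have hR' : ∀ x, R' x = ∫ r in Ioi (0 : ℝ), adjointSemigroup T r x := by
    simpa only [gammaWeight_one, one_smul] using hR1'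
  obtain ⟨V, -, hV, hVT⟩ := hT.exists_orbit hs
  obtain ⟨V', -, hV', hVT'⟩ := hT'.exists_orbit hs'
  obtain ⟨Ψ, hΨR, hΨ, hd⟩ := hT.exists_squareFunction hs hadm hB hR hV hVT
  obtain ⟨Ψ', hΨR', hΨ', hd'⟩ := hT'.exists_squareFunction hs' hadm' hB' hR' hV' hVT'
  -- The integrand is `⟪T(t)^* B' v, T(t) B w⟫ = ⟪v, T(2t) B² w⟫`. The substitution `s = 2t` gives
  -- the factor `1/2`, and the remaining integral is `⟪v, R (R w)⟫ = ⟪R' v, R w⟫`.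
  have key : ∀ w v, 2 * ⟪Ψ' (R' v), Ψ (R w)⟫_ℂ = ⟪R' v, R w⟫_ℂ := by
    intro w v
    have e1 : ⟪Ψ' (R' v), Ψ (R w)⟫_ℂ = ∫ t in Ioi (0 : ℝ), ⟪v, T (2 * t) (R w)⟫_ℂ := by
      rw [hΨR, hΨR', L2.inner_def]
      refine integral_congr_ae ?_
      filter_upwards [hV (B w), hV' (B' v), ae_restrict_mem measurableSet_Ioi] with t h1 h2 ht
      have ht' : (0 : ℝ) ≤ t := le_of_lt ht
      rw [h1, h2, adjointSemigroup, ContinuousLinearMap.adjoint_inner_left,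
        hT.inner_superposition_adjoint hs hg (conj_gammaWeight _) hB hB',
        ← hT.superposition_comm hs hg hB ht', ← hT.superposition_comm hs hg hB ht',
        hT.negPow_half_comp hs hB hR, two_mul, hT.map_add t t ht' ht']
      rfl
    have e2 := integral_comp_mul_left_Ioi (fun s => ⟪v, T s (R w)⟫_ℂ) 0 (two_pos (α := ℝ))
    have e3 := (innerSL ℂ v).integral_comp_comm (hT.integrableOn_orbit hs (R w))
    simp only [innerSL_apply_apply] at e3
    rw [e1, e2, mul_zero, e3, ← hR,
      hT.inner_superposition_adjoint hs hg1 (conj_gammaWeight _) hR1 hR1', Complex.real_smul]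
    push_cast
    rw [mul_inv_cancel_left₀ two_ne_zero]
  have key2 : ∀ w y, 2 * ⟪Ψ' y, Ψ (R w)⟫_ℂ = ⟪y, R w⟫_ℂ := fun w y =>
    hd'.induction_on (p := fun y => 2 * ⟪Ψ' y, Ψ (R w)⟫_ℂ = ⟪y, R w⟫_ℂ) y
      (isClosed_eq (by fun_prop) (by fun_prop)) (key w)
  have key3 : ∀ x y, 2 * ⟪Ψ' y, Ψ x⟫_ℂ = ⟪y, x⟫_ℂ := fun x y =>
    hd.induction_on (p := fun x => 2 * ⟪Ψ' y, Ψ x⟫_ℂ = ⟪y, x⟫_ℂ) x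
      (isClosed_eq (by fun_prop) (by fun_prop)) (fun w => key2 w y)
  refine ⟨Ψ, (2 : ℂ) • ContinuousLinearMap.adjoint Ψ', hΨ, fun x => ext_inner_left ℂ fun y => ?_⟩
  rw [_root_.smul_apply, inner_smul_right, ContinuousLinearMap.adjoint_inner_right, key3]

end SquareFunction

/-! ### Boundary values of bounded analytic functions on the left half-plane -/

section BoundaryValues

open Metric

theorem isOpen_leftHalfPlane : IsOpen leftHalfPlane :=
  isOpen_lt Complex.continuous_re continuous_const

theorem convex_leftHalfPlane : Convex ℝ leftHalfPlane := convex_halfSpace_re_lt 0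

theorem ball_neg_subset_leftHalfPlane (r : ℝ) : ball (-(r : ℂ)) r ⊆ leftHalfPlane := by
  intro z hz
  rw [mem_ball, dist_eq_norm, sub_neg_eq_add] at hz
  have h1 := (Complex.re_le_norm (z + r)).trans_lt hz
  simp only [Complex.add_re, Complex.ofReal_re] at h1
  change z.re < 0
  linarith

theorem exists_mem_ball_neg {z : ℂ} (hz : z ∈ leftHalfPlane) :
    ∃ n : ℕ, 1 ≤ n ∧ z ∈ ball (-((n : ℝ) : ℂ)) n := by
  have hz' : z.re < 0 := hz
  -- `|z + n| < n` amounts to `|z|² < -2 n Re z`, which holds for large `n` because `Re z < 0`.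
  obtain ⟨n, hn⟩ := exists_nat_gt (max 1 (‖z‖ ^ 2 / (-2 * z.re)))
  have h1 : (1 : ℝ) < n := (le_max_left _ _).trans_lt hn
  have h2 := (le_max_right _ _).trans_lt hn
  rw [div_lt_iff₀ (by linarith)] at h2
  refine ⟨n, by exact_mod_cast h1.le, ?_⟩
  rw [mem_ball, dist_eq_norm, sub_neg_eq_add]
  refine lt_of_pow_lt_pow_left₀ 2 (by linarith) ?_
  rw [← Complex.normSq_eq_norm_sq] at h2 ⊢
  rw [Complex.normSq_apply] at h2 ⊢
  simp only [Complex.add_re, Complex.add_im, Complex.ofReal_re, Complex.ofReal_im, add_zero]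
  nlinarith

/-- Holomorphic functions on the left half-plane have primitives. -/
theorem exists_primitive_leftHalfPlane {g : ℂ → ℂ} (hg : DifferentiableOn ℂ g leftHalfPlane) :
    ∃ G : ℂ → ℂ, ∀ z ∈ leftHalfPlane, HasDerivAt G (g z) z := by
  -- The disks `|z + n| < n` increase to the half-plane. Normalizing the primitives to vanish at
  -- `-1`, a point of every disk with `n ≥ 1`, makes them agree on overlaps.
  have h1 : ∀ n : ℕ, ∃ G : ℂ → ℂ, G (-1) = 0 ∧
      ∀ z ∈ ball (-((n : ℝ) : ℂ)) n, HasDerivAt G (g z) z := by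
    intro n
    obtain ⟨G, hG0, hG⟩ := ((hg.mono (ball_neg_subset_leftHalfPlane n)).isExactOn_ball).with_val_at
      (-1) 0
    exact ⟨G, hG0, hG⟩
  choose G hG0 hG using h1
  have hmono : ∀ m n : ℕ, m ≤ n → ball (-((m : ℝ) : ℂ)) m ⊆ ball (-((n : ℝ) : ℂ)) n := by
    intro m n hmn
    refine ball_subset_ball' ?_
    have hmn' : (m : ℝ) ≤ n := by exact_mod_cast hmn
    rw [dist_eq_norm, show -((m : ℝ) : ℂ) - -((n : ℝ) : ℂ) = ((n - m : ℝ) : ℂ) by push_cast; ring,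
      Complex.norm_real, Real.norm_eq_abs, abs_of_nonneg (sub_nonneg.2 hmn')]
    linarith
  have heq : ∀ m n : ℕ, 1 ≤ m → m ≤ n → ∀ z ∈ ball (-((m : ℝ) : ℂ)) m, G m z = G n z := by
    intro m n hm hmn z hz
    have h1m : (-1 : ℂ) ∈ ball (-((m : ℝ) : ℂ)) m := by
      have hm' : (1 : ℝ) ≤ m := by exact_mod_cast hm
      rw [mem_ball, dist_eq_norm, show (-1 : ℂ) - -((m : ℝ) : ℂ) = ((m - 1 : ℝ) : ℂ) by
        push_cast; ring, Complex.norm_real, Real.norm_eq_abs, abs_of_nonneg (by linarith)]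
      linarith
    refine isOpen_ball.eqOn_of_deriv_eq (convex_ball _ _).isPreconnected
      (fun w hw => (hG m w hw).differentiableAt.differentiableWithinAt)
      (fun w hw => (hG n w (hmono m n hmn hw)).differentiableAt.differentiableWithinAt)
      (fun w hw => ?_) h1m ((hG0 m).trans (hG0 n).symm) hz
    rw [(hG m w hw).deriv, (hG n w (hmono m n hmn hw)).deriv]
  have heq' : ∀ m n : ℕ, 1 ≤ m → 1 ≤ n → ∀ z ∈ ball (-((m : ℝ) : ℂ)) m,
      z ∈ ball (-((n : ℝ) : ℂ)) n → G m z = G n z := by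
    intro m n hm hn z h1 h2
    rcases le_total m n with h | h
    · exact heq m n hm h z h1
    · exact (heq n m hn h z h2).symm
  classical
  choose N hN1 hN using fun z : leftHalfPlane => exists_mem_ball_neg z.2
  refine ⟨fun z => if hz : z ∈ leftHalfPlane then G (N ⟨z, hz⟩) z else 0, fun z hz => ?_⟩
  refine (hG (N ⟨z, hz⟩) z (hN ⟨z, hz⟩)).congr_of_eventuallyEq ?_
  filter_upwards [isOpen_ball.mem_nhds (hN ⟨z, hz⟩), isOpen_leftHalfPlane.mem_nhds hz] with w h1 h2
  rw [dif_pos h2]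
  exact heq' _ _ (hN1 _) (hN1 _) w (hN ⟨w, h2⟩) h1

/-- The Cauchy formula for the derivative, for functions continuous on the closed disk. -/
theorem DiffContOnCl.deriv_eq_circleIntegral {c w : ℂ} {R : ℝ} {f : ℂ → ℂ}
    (hf : DiffContOnCl ℂ f (ball c R)) (hw : w ∈ ball c R) :
    deriv f w = (2 * Real.pi * Complex.I : ℂ)⁻¹ • ∮ z in C(c, R), ((z - w) ^ 2)⁻¹ • f z := by
  have hR := pos_of_mem_ball hw
  have hdw : DifferentiableAt ℂ f w := hf.differentiableAt isOpen_ball hw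
  -- Cauchy's integral formula is applied to the difference quotient of `f`, whose value at `w` is
  -- the derivative. The constant `f w` drops out because `(z - w)⁻²` has zero integral.
  have hf' : DiffContOnCl ℂ (dslope f w) (ball c R) := by
    refine ⟨(Complex.differentiableOn_dslope (isOpen_ball.mem_nhds hw)).2 hf.differentiableOn, ?_⟩
    exact (continuousOn_dslope (mem_of_superset (isOpen_ball.mem_nhds hw) subset_closure)).2
      ⟨hf.continuousOn, hdw⟩
  have h0 := hf'.two_pi_i_inv_smul_circleIntegral_sub_inv_smul hw
  rw [← dslope_same, ← h0]
  congr 1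
  have h1 : ContinuousOn (fun z : ℂ => ((z - w) ^ 2)⁻¹) (sphere c R) := by
    refine ((continuous_id'.sub continuous_const).pow 2).continuousOn.inv₀ fun u hu h => ?_
    exact sphere_disjoint_ball.ne_of_mem hu hw (sub_eq_zero.mp (sq_eq_zero_iff.mp h))
  have h2 : CircleIntegrable (fun z : ℂ => ((z - w) ^ 2)⁻¹ • f z) c R := by
    refine ContinuousOn.circleIntegrable hR.le (h1.smul (hf.continuousOn.mono ?_))
    rw [closure_ball c hR.ne']
    exact sphere_subset_closedBall
  have h3 : CircleIntegrable (fun z : ℂ => ((z - w) ^ 2)⁻¹ • f w) c R :=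
    ContinuousOn.circleIntegrable hR.le (h1.smul continuousOn_const)
  have h4 : (∮ z : ℂ in C(c, R), ((z - w) ^ 2)⁻¹) = 0 := by
    simpa using! circleIntegral.integral_sub_zpow_of_ne (by decide : (-2 : ℤ) ≠ -1) c w R
  trans ∮ z in C(c, R), ((z - w) ^ 2)⁻¹ • (f z - f w)
  · refine circleIntegral.integral_congr hR.le fun z hz => ?_
    have hzw : z ≠ w := sphere_disjoint_ball.ne_of_mem hz hw
    simp only [dslope_of_ne _ hzw, slope, vsub_eq_sub, smul_eq_mul, sq, mul_inv, mul_assoc]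
  · simp only [smul_sub]
    rw [circleIntegral.integral_sub h2 h3, circleIntegral.integral_smul_const, h4, zero_smul,
      sub_zero]

/-- On the circle tangent to the imaginary axis at `0`, `|z + 1| = 1` means `|z|² = -2 Re z`. Points
of it near `0` are thus only quadratically far from the axis. -/
theorem norm_sq_add_ofReal_of_mem_sphere {z : ℂ} (hz : z ∈ sphere (-1 : ℂ) 1) (ε : ℝ) :
    ‖z + ε‖ ^ 2 = ‖z‖ ^ 2 * (1 - ε) + ε ^ 2 ∧ z.re = -‖z‖ ^ 2 / 2 := by
  rw [mem_sphere, dist_eq_norm, sub_neg_eq_add] at hz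
  have h : ‖z + 1‖ ^ 2 = 1 := by rw [hz, one_pow]
  rw [← Complex.normSq_eq_norm_sq, Complex.normSq_apply] at h ⊢
  rw [← Complex.normSq_eq_norm_sq, Complex.normSq_apply]
  simp only [Complex.add_re, Complex.add_im, Complex.ofReal_re, Complex.ofReal_im, add_zero,
    Complex.one_re, Complex.one_im] at h ⊢
  constructor
  · linear_combination ε * h
  · linear_combination (1 / 2 : ℝ) * h

/-- A direct Cauchy estimate at `-ε` would integrate `η|z|/|z + ε|²` and lose a factor `log(1/ε)`.
Multiplying `H` by `k(z) = z/(z - ε)²` avoids this: `k'(-ε) = 0` and `k(-ε) = -1/(4ε)`, so `H'(-ε) =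
-4ε (kH)'(-ε)`. On the circle `|z - ε| ≥ |z|`, so the integrand for `(kH)'` is controlled by the
Poisson kernel at `-ε`, whose circle average is `1`. -/
theorem norm_deriv_le_of_sphere_bound {H : ℂ → ℂ} (hH : DiffContOnCl ℂ H (ball (-1) 1)) {η K : ℝ}
    (hη : 0 ≤ η) (hK : 0 ≤ K)
    (hb : ∀ z ∈ sphere (-1 : ℂ) 1, ‖H z‖ ≤ η * ‖z‖ + K * ‖z‖ ^ 3) {ε : ℝ} (hε : 0 < ε)
    (hε2 : ε ≤ 1 / 2) : ‖deriv H (-(ε : ℂ))‖ ≤ 4 * η + 8 * K * ε := by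
  have hw : -(ε : ℂ) ∈ ball (-1 : ℂ) 1 := by
    rw [mem_ball, dist_eq_norm, show -(ε : ℂ) - -1 = ((1 - ε : ℝ) : ℂ) by push_cast; ring,
      Complex.norm_real, Real.norm_eq_abs, abs_of_nonneg (by linarith)]
    linarith
  have hne : ∀ z : ℂ, z.re ≤ 0 → z - ε ≠ 0 := by
    intro z hz h
    have := congrArg Complex.re h
    simp at this
    linarith
  have hcl : closedBall (-1 : ℂ) 1 ⊆ {z | z.re ≤ 0} := by
    intro z hz
    rw [mem_closedBall, dist_eq_norm, sub_neg_eq_add] at hz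
    have := (Complex.re_le_norm (z + 1)).trans hz
    simp only [Complex.add_re, Complex.one_re] at this
    change z.re ≤ 0
    linarith
  set k : ℂ → ℂ := fun z => z / (z - ε) ^ 2 with hk
  have hkd : ∀ z : ℂ, z.re ≤ 0 → DifferentiableAt ℂ k z := fun z hz =>
    differentiableAt_id.div ((differentiableAt_id.sub_const _).pow 2) (pow_ne_zero 2 (hne z hz))
  have hkc : DiffContOnCl ℂ k (ball (-1) 1) := by
    refine DifferentiableOn.diffContOnCl fun z hz => (hkd z ?_).differentiableWithinAt
    exact hcl (closure_ball_subset_closedBall hz)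
  have hF : DiffContOnCl ℂ (fun z => k z • H z) (ball (-1) 1) := hkc.smul hH
  have hεc : (ε : ℂ) ≠ 0 := by exact_mod_cast hε.ne'
  have hk0 : HasDerivAt k 0 (-(ε : ℂ)) := by
    have h2 : (-(ε : ℂ) - ε) ≠ 0 := hne _ (by simp [hε.le])
    have h := (hasDerivAt_id (-(ε : ℂ))).div (((hasDerivAt_id (-(ε : ℂ))).sub_const (ε : ℂ)).pow 2)
      (pow_ne_zero 2 h2)
    refine h.congr_deriv ?_
    simp only [id, Pi.pow_apply]
    rw [div_eq_zero_iff]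
    left
    push_cast
    ring
  have hHd : HasDerivAt H (deriv H (-(ε : ℂ))) (-(ε : ℂ)) :=
    (hH.differentiableAt isOpen_ball hw).hasDerivAt
  have hFd : deriv H (-(ε : ℂ)) = -(4 * ε) * deriv (fun z => k z • H z) (-(ε : ℂ)) := by
    rw [(hk0.fun_smul hHd).deriv, hk]
    simp only [smul_eq_mul, zero_mul, add_zero]
    have h2 : (-(ε : ℂ) - ε) ≠ 0 := hne _ (by simp [hε.le])
    have h3 : (-(ε : ℂ) - ε) ^ 2 = 4 * ε ^ 2 := by ring
    rw [h3]
    field_simp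
  set P : ℂ → ℝ := poissonKernel (-1) (-(ε : ℂ)) with hP
  have hPeq : ∀ z ∈ sphere (-1 : ℂ) 1, P z = (ε * (2 - ε)) / ‖z + ε‖ ^ 2 := by
    intro z hz
    rw [mem_sphere, dist_eq_norm] at hz
    rw [hP, poissonKernel_def, hz, show -(ε : ℂ) - -1 = ((1 - ε : ℝ) : ℂ) by push_cast; ring,
      Complex.norm_real, Real.norm_eq_abs, sq_abs]
    congr 1
    · ring
    · push_cast; ring_nf
  have hbd : ∀ z ∈ sphere (-1 : ℂ) 1,
      ‖((z - -(ε : ℂ)) ^ 2)⁻¹ • (k z • H z)‖ ≤ η / ε * P z + 2 * K := by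
    intro z hz
    obtain ⟨e1, -⟩ := norm_sq_add_ofReal_of_mem_sphere hz ε
    obtain ⟨e2, -⟩ := norm_sq_add_ofReal_of_mem_sphere hz (-ε)
    have e3 : z + ((-ε : ℝ) : ℂ) = z - ε := by push_cast; ring
    rw [e3] at e2
    have hs : 0 ≤ ‖z‖ ^ 2 := sq_nonneg _
    have p1 : 0 < ‖z + ε‖ ^ 2 := by rw [e1]; nlinarith [sq_pos_of_pos hε]
    have p2 : 0 < ‖z - ε‖ ^ 2 := by rw [e2]; nlinarith [sq_pos_of_pos hε]
    rw [hPeq z hz, sub_neg_eq_add, norm_smul, norm_smul, norm_inv, norm_pow, hk]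
    simp only [norm_div, norm_pow]
    have hle : ‖z‖ ^ 2 / ‖z - ε‖ ^ 2 ≤ 1 := by
      rw [div_le_one p2, e2]; nlinarith
    -- This is where `ε ≤ 1/2` enters: `|z + ε|² ≥ (1 - ε)|z|²`.
    have hle2 : ‖z‖ ^ 2 / ‖z + ε‖ ^ 2 ≤ 2 := by
      rw [div_le_iff₀ p1, e1]; nlinarith
    calc (‖z + ε‖ ^ 2)⁻¹ * (‖z‖ / ‖z - ε‖ ^ 2 * ‖H z‖)
        ≤ (‖z + ε‖ ^ 2)⁻¹ * (‖z‖ / ‖z - ε‖ ^ 2 * (η * ‖z‖ + K * ‖z‖ ^ 3)) := by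
          gcongr
          exact hb z hz
      _ = (‖z‖ ^ 2 / ‖z - ε‖ ^ 2) * (η / ‖z + ε‖ ^ 2 + K * (‖z‖ ^ 2 / ‖z + ε‖ ^ 2)) := by
          field_simp
      _ ≤ 1 * (η / ‖z + ε‖ ^ 2 + K * 2) := by gcongr
      _ ≤ η / ε * (ε * (2 - ε) / ‖z + ε‖ ^ 2) + 2 * K := by
          have : η / ε * (ε * (2 - ε) / ‖z + ε‖ ^ 2) = (2 - ε) * (η / ‖z + ε‖ ^ 2) := by
            field_simp
          rw [this]
          have h0 : 0 ≤ η / ‖z + ε‖ ^ 2 := by positivity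
          nlinarith
  have hPc : ContinuousOn P (sphere (-1 : ℂ) 1) := by
    refine ContinuousOn.congr (f := fun z : ℂ => (ε * (2 - ε)) / ‖z + ε‖ ^ 2) ?_ hPeq
    refine ContinuousOn.div continuousOn_const (by fun_prop) fun z hz => ?_
    obtain ⟨e1, -⟩ := norm_sq_add_ofReal_of_mem_sphere hz ε
    rw [e1]
    have hs : 0 ≤ ‖z‖ ^ 2 := sq_nonneg _
    nlinarith [sq_pos_of_pos hε]
  have hmem : ∀ θ : ℝ, circleMap (-1) 1 θ ∈ sphere (-1 : ℂ) 1 := fun θ =>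
    circleMap_mem_sphere _ zero_le_one θ
  have hPθ : Continuous fun θ : ℝ => P (circleMap (-1) 1 θ) :=
    hPc.comp_continuous (continuous_circleMap _ _) hmem
  have hPint : ∫ θ in (0 : ℝ)..2 * Real.pi, P (circleMap (-1) 1 θ) = 2 * Real.pi := by
    have h := (diffContOnCl_const (c := (1 : ℂ)) (s := ball (-1 : ℂ)
      1)).circleAverage_poissonKernel_smul hw
    rw [Real.circleAverage_def] at h
    simp only [Pi.smul_apply', Complex.real_smul, mul_one, intervalIntegral.integral_ofReal] at h
    rw [← Complex.ofReal_mul] at h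
    have h' := Complex.ofReal_injective (h.trans Complex.ofReal_one.symm)
    have hpi : (2 * Real.pi) ≠ 0 := by positivity
    rw [inv_mul_eq_div, div_eq_iff hpi, one_mul] at h'
    exact h'
  have hfin : ‖deriv (fun z => k z • H z) (-(ε : ℂ))‖ ≤ η / ε + 2 * K := by
    rw [hF.deriv_eq_circleIntegral hw, norm_smul, circleIntegral]
    have h1 := intervalIntegral.norm_integral_le_of_norm_le (μ := volume) (a := 0)
      (b := 2 * Real.pi) (f := fun θ => deriv (circleMap (-1) 1) θ •
        ((circleMap (-1) 1 θ - -(ε : ℂ)) ^ 2)⁻¹ • (k (circleMap (-1) 1 θ) • H (circleMap (-1) 1 θ)))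
      (g := fun θ => η / ε * P (circleMap (-1) 1 θ) + 2 * K) Real.two_pi_pos.le
      (ae_of_all _ fun θ _ => by
        rw [norm_smul, deriv_circleMap, norm_mul, Complex.norm_I, norm_circleMap_zero, abs_one,
          one_mul, one_mul]
        exact hbd _ (hmem θ))
      (((hPθ.const_mul _).add continuous_const).intervalIntegrable _ _)
    rw [intervalIntegral.integral_add ((hPθ.const_mul _).intervalIntegrable _ _)
      (Continuous.intervalIntegrable (by fun_prop) _ _), intervalIntegral.integral_const_mul, hPint,
      intervalIntegral.integral_const, smul_eq_mul, sub_zero] at h1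
    have h2 : ‖(2 * Real.pi * Complex.I : ℂ)⁻¹‖ = (2 * Real.pi)⁻¹ := by
      rw [norm_inv, norm_mul, Complex.norm_I, mul_one, ← Complex.ofReal_ofNat,
        ← Complex.ofReal_mul, Complex.norm_real, Real.norm_eq_abs, abs_of_pos Real.two_pi_pos]
    rw [h2, inv_mul_le_iff₀ Real.two_pi_pos]
    refine h1.trans_eq ?_
    ring
  rw [hFd, norm_mul, norm_neg, norm_mul, Complex.norm_real, Real.norm_eq_abs, abs_of_pos hε]
  calc _ ≤ ‖(4 : ℂ)‖ * ε * (η / ε + 2 * K) := by gcongr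
    _ = 4 * η + 8 * K * ε := by
      rw [Complex.norm_ofNat]; field_simp; ring

/-- On the tangent circle a point `z` near `0` is at distance `|z|²/2` from the axis. The Lipschitz
bound therefore transfers `H = o(|y|)` from the axis to the circle with error `O(|z|²)`, and the
sphere estimate turns this into decay of the derivative. -/
theorem tendsto_deriv_of_isLittleO_imaginaryAxis {H : ℂ → ℂ} {L : NNReal} (hL : LipschitzWith L H)
    (h0 : H 0 = 0) (hd : DifferentiableOn ℂ H leftHalfPlane)
    (ho : (fun y : ℝ => H (y * Complex.I)) =o[𝓝 0] fun y : ℝ => y) :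
    Tendsto (fun r : ℝ => deriv H r) (𝓝[<] 0) (𝓝 0) := by
  have hH : DiffContOnCl ℂ H (ball (-1) 1) := by
    refine ⟨hd.mono ?_, hL.continuous.continuousOn⟩
    simpa using ball_neg_subset_leftHalfPlane 1
  have hnorm : ∀ z, ‖H z‖ ≤ L * ‖z‖ := fun z => by
    simpa [dist_eq_norm, h0] using hL.dist_le_mul z 0
  have hstep : ∀ η : ℝ, 0 < η → ∃ K : ℝ, 0 ≤ K ∧
      ∀ z ∈ sphere (-1 : ℂ) 1, ‖H z‖ ≤ η * ‖z‖ + K * ‖z‖ ^ 3 := by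
    intro η hη
    have h1 := ho.def (half_pos hη)
    obtain ⟨ρ₀, hρ₀, hb⟩ := Metric.eventually_nhds_iff.1 h1
    have hL1 : (0 : ℝ) < L + 1 := by positivity
    -- For `|z| < ρ` the Lipschitz error `L |z|²/2` is at most `η|z|/2`. For `|z| ≥ ρ` the bound
    -- `L|z|` is absorbed into `(L/ρ²)|z|³`.
    set ρ := min ρ₀ (η / (L + 1)) with hρ
    have hρpos : 0 < ρ := lt_min hρ₀ (by positivity)
    refine ⟨L / ρ ^ 2, by positivity, fun z hz => ?_⟩
    rcases lt_or_ge ‖z‖ ρ with hlt | hge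
    · obtain ⟨-, hre⟩ := norm_sq_add_ofReal_of_mem_sphere hz 0
      have e1 : ‖H (z.im * Complex.I)‖ ≤ η / 2 * ‖z‖ := by
        have hy : dist z.im 0 < ρ₀ := by
          rw [dist_zero_right, Real.norm_eq_abs]
          exact ((Complex.abs_im_le_norm z).trans_lt hlt).trans_le (min_le_left _ _)
        refine (hb hy).trans ?_
        rw [Real.norm_eq_abs]
        gcongr
        exact Complex.abs_im_le_norm z
      have e2 : ‖H z - H (z.im * Complex.I)‖ ≤ L * (‖z‖ ^ 2 / 2) := by
        have h2 := hL.dist_le_mul z (z.im * Complex.I)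
        rw [dist_eq_norm, dist_eq_norm] at h2
        refine h2.trans_eq ?_
        congr 1
        have h3 : z - z.im * Complex.I = (z.re : ℂ) := by
          rw [sub_eq_iff_eq_add]; exact (Complex.re_add_im z).symm
        rw [h3, Complex.norm_real, hre, Real.norm_eq_abs, abs_div, abs_neg, abs_of_nonneg
          (sq_nonneg _), abs_two]
      have e3 : L * (‖z‖ ^ 2 / 2) ≤ η / 2 * ‖z‖ := by
        have h4 : ‖z‖ * (L + 1) ≤ η := by
          rw [← le_div_iff₀ hL1]
          exact hlt.le.trans (min_le_right _ _)
        have h5 := norm_nonneg z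
        nlinarith
      have e4 : 0 ≤ L / ρ ^ 2 * ‖z‖ ^ 3 := by positivity
      calc ‖H z‖ ≤ ‖H z - H (z.im * Complex.I)‖ + ‖H (z.im * Complex.I)‖ := by
            simpa using norm_add_le (H z - H (z.im * Complex.I)) (H (z.im * Complex.I))
        _ ≤ _ := by linarith
    · have e1 : L * ‖z‖ ≤ L / ρ ^ 2 * ‖z‖ ^ 3 := by
        rw [div_mul_eq_mul_div, le_div_iff₀ (by positivity)]
        have : ρ ^ 2 ≤ ‖z‖ ^ 2 := by gcongr
        calc L * ‖z‖ * ρ ^ 2 ≤ L * ‖z‖ * ‖z‖ ^ 2 := by gcongr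
          _ = _ := by ring
      have e2 : 0 ≤ η * ‖z‖ := by positivity
      linarith [hnorm z]
  rw [Metric.tendsto_nhdsWithin_nhds]
  intro δ hδ
  -- With `η = δ/8` and `ε = -r < δ/(16(K + 1))`, both terms of `4η + 8Kε` are at most `δ/2`, the
  -- second strictly less.
  obtain ⟨K, hK, hb⟩ := hstep (δ / 8) (by positivity)
  refine ⟨min (1 / 2) (δ / (16 * (K + 1))), by positivity, fun {r} hr hr' => ?_⟩
  rw [dist_zero_right, Real.norm_eq_abs, abs_of_neg hr, lt_min_iff] at hr'
  have h := norm_deriv_le_of_sphere_bound hH (by positivity) hK hb (ε := -r) (by simpa using hr)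
    hr'.1.le
  rw [Complex.ofReal_neg, neg_neg] at h
  rw [dist_zero_right]
  refine h.trans_lt ?_
  have h2 := hr'.2
  rw [lt_div_iff₀ (by positivity)] at h2
  have hr0 : 0 < -r := by simpa using hr
  nlinarith

/-- **Fatou's theorem**: bounded analytic functions on the left half-plane have horizontal limits
almost everywhere on the imaginary axis. -/
theorem ae_exists_tendsto_boundary {g : ℂ → ℂ} (hg : g ∈ HInfMinus) :
    ∀ᵐ ξ : ℝ, Tendsto (fun r : ℝ => g (r + (2 * Real.pi * ξ : ℝ) * Complex.I)) (𝓝[<] 0)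
      (𝓝 (boundaryValue g (2 * Real.pi * ξ))) := by
  obtain ⟨hgd, K, hgK⟩ := hg
  obtain ⟨G, hG⟩ := exists_primitive_leftHalfPlane hgd
  have hLip : LipschitzOnWith K.toNNReal G leftHalfPlane :=
    convex_leftHalfPlane.lipschitzOnWith_of_nnnorm_hasDerivWithin_le
      (fun z hz => (hG z hz).hasDerivWithinAt) fun z hz => by
        rw [← NNReal.coe_le_coe, coe_nnnorm]
        exact (hgK z hz).trans (Real.le_coe_toNNReal K)
  -- Boundedness of `g` makes its primitive Lipschitz, so it extends to the axis, where it is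
  -- differentiable almost everywhere by the one-dimensional Rademacher theorem. Those are the
  -- points at which the limit will be shown to exist.
  obtain ⟨F, hF, hFG⟩ := hLip.extend_finite_dimension
  set L := lipschitzExtensionConstant ℂ * K.toNNReal
  have hFd : ∀ z ∈ leftHalfPlane, HasDerivAt F (g z) z := fun z hz =>
    (hG z hz).congr_of_eventuallyEq
      (eventually_of_mem (isOpen_leftHalfPlane.mem_nhds hz) fun w hw => (hFG hw).symm)
  have hline : LipschitzWith (L * (2 * Real.pi).toNNReal)
      fun ξ : ℝ => F ((2 * Real.pi * ξ : ℝ) * Complex.I) := by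
    refine hF.comp (LipschitzWith.of_dist_le_mul fun a b => ?_)
    rw [dist_eq_norm, ← sub_mul, norm_mul, Complex.norm_I, mul_one, ← Complex.ofReal_sub,
      Complex.norm_real, ← mul_sub, norm_mul, dist_eq_norm, Real.norm_eq_abs (2 * Real.pi),
      abs_of_pos Real.two_pi_pos, Real.coe_toNNReal _ Real.two_pi_pos.le]
  filter_upwards [hline.ae_differentiableAt_real] with ξ hξ
  suffices h : ∃ c, Tendsto (fun r : ℝ => g (r + (2 * Real.pi * ξ : ℝ) * Complex.I)) (𝓝[<] 0)
      (𝓝 c) from tendsto_nhds_limUnder h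
  set ω : ℝ := 2 * Real.pi * ξ with hω
  obtain ⟨d, hd⟩ : ∃ d, HasDerivAt (fun y : ℝ => F ((ω + y : ℝ) * Complex.I)) d 0 := by
    have h1 : HasDerivAt (fun y : ℝ => ξ + (2 * Real.pi)⁻¹ * y) (2 * Real.pi)⁻¹ 0 := by
      simpa using ((hasDerivAt_id (0 : ℝ)).const_mul (2 * Real.pi)⁻¹).const_add ξ
    have h2 := HasDerivAt.scomp_of_eq (0 : ℝ) hξ.hasDerivAt h1 (by simp)
    refine ⟨_, h2.congr_of_eventuallyEq (Eventually.of_forall fun y => ?_)⟩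
    simp only [Function.comp_apply, hω]
    congr 3
    field_simp
  -- If the derivative of `F` along the axis is `d = ic`, then `c` is the expected limit of `g`.
  -- Subtracting the affine part gives `H` with `H' = g(iω + ·) - c` in the half-plane and `H(iy) =
  -- o(y)`.
  set c : ℂ := -Complex.I * d with hc
  set H : ℂ → ℂ := fun z => F (ω * Complex.I + z) - F (ω * Complex.I) - c * z with hH
  have hHL : LipschitzWith (L + ‖c‖₊) H := by
    have h1 : LipschitzWith L fun z => F (ω * Complex.I + z) - F (ω * Complex.I) := by
      refine LipschitzWith.of_dist_le_mul fun a b => ?_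
      rw [dist_sub_right]
      simpa using hF.dist_le_mul (ω * Complex.I + a) (ω * Complex.I + b)
    have h2 : LipschitzWith ‖c‖₊ fun z : ℂ => c * z := LipschitzWith.of_dist_le_mul fun a b => by
      rw [dist_eq_norm, ← mul_sub, norm_mul, dist_eq_norm, coe_nnnorm]
    exact h1.sub h2
  have hmem : ∀ z ∈ leftHalfPlane, ω * Complex.I + z ∈ leftHalfPlane := fun z hz => by
    have hz' : z.re < 0 := hz
    change (ω * Complex.I + z).re < 0
    simpa using hz'
  have hHd : ∀ z ∈ leftHalfPlane, HasDerivAt H (g (ω * Complex.I + z) - c) z := fun z hz => by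
    have h1 := ((hFd _ (hmem z hz)).comp_const_add _ z).sub_const (F (ω * Complex.I))
    have h2 := h1.sub ((hasDerivAt_id z).const_mul c)
    simpa using! h2
  have ho : (fun y : ℝ => H (y * Complex.I)) =o[𝓝 0] fun y : ℝ => y := by
    have h1 := hd.isLittleO
    simp only [sub_zero, add_zero] at h1
    refine h1.congr_left fun y => ?_
    simp only [hH, hc, Complex.real_smul]
    push_cast
    rw [add_mul]
    linear_combination -(y : ℂ) * d * Complex.I_mul_I
  have hlim := tendsto_deriv_of_isLittleO_imaginaryAxis hHL (by simp [hH])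
    (fun z hz => (hHd z hz).differentiableAt.differentiableWithinAt) ho
  refine ⟨c, ?_⟩
  have h3 := hlim.add_const c
  rw [zero_add] at h3
  refine h3.congr' ?_
  filter_upwards [self_mem_nhdsWithin] with r hr
  have hr' : (r : ℂ) ∈ leftHalfPlane := by
    change (r : ℂ).re < 0
    simpa using hr
  rw [(hHd _ hr').deriv, sub_add_cancel, add_comm]

end BoundaryValues

/-! ### Laplace representation of decaying analytic functions -/

section LaplaceRepresentation

theorem integrable_of_norm_le_div_one_add_sq {f : ℝ → ℂ} {C : ℝ} (hf : Continuous f)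
    (hC : ∀ y, ‖f y‖ ≤ C / (1 + y ^ 2)) : Integrable f :=
  (integrable_inv_one_add_sq.const_mul C).mono' hf.aestronglyMeasurable
    (ae_of_all _ fun y => by simpa only [div_eq_mul_inv] using hC y)

/-- The integrals of a decaying analytic function along two vertical lines agree. -/
theorem integral_verticalLine_eq {K : ℂ → ℂ} {a b C : ℝ} (hab : a ≤ b)
    (hd : ∀ z : ℂ, z.re ∈ Icc a b → DifferentiableAt ℂ K z)
    (hC : ∀ z : ℂ, z.re ∈ Icc a b → ‖K z‖ ≤ C / (1 + z.im ^ 2)) :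
    ∫ y : ℝ, K (a + y * Complex.I) = ∫ y : ℝ, K (b + y * Complex.I) := by
  have hint : ∀ c ∈ Icc a b, Integrable fun y : ℝ => K (c + y * Complex.I) := by
    intro c hc
    refine integrable_of_norm_le_div_one_add_sq (C := C) ?_ fun y => ?_
    · refine continuous_iff_continuousAt.2 fun y => ?_
      exact (hd (c + y * Complex.I) (by simpa using hc)).continuousAt.comp
        (f := fun y : ℝ => (c : ℂ) + y * Complex.I) (by fun_prop)
    · simpa using hC (c + y * Complex.I) (by simpa using hc)
  -- Cauchy's theorem on the rectangle of height `2n`; its horizontal sides vanish in the limit by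
  -- the quadratic decay.
  have hrect : ∀ n : ℕ, (∫ y in (-n : ℝ)..n, K (b + y * Complex.I))
      - ∫ y in (-n : ℝ)..n, K (a + y * Complex.I) = Complex.I * (
        (∫ x in a..b, K (x + (-n : ℝ) * Complex.I)) - ∫ x in a..b, K (x + (n : ℝ) * Complex.I)) := by
    intro n
    have h := Complex.integral_boundary_rect_eq_zero_of_differentiableOn K
      (a + (-n : ℝ) * Complex.I) (b + (n : ℝ) * Complex.I) (fun z hz => by
        refine (hd z ?_).differentiableWithinAt
        have := hz.1
        simpa [uIcc_of_le hab] using this)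
    simp at h
    simp only [Complex.ofReal_neg, Complex.ofReal_natCast, neg_mul]
    linear_combination -Complex.I * h + ((∫ y in (-n : ℝ)..n, K (b + y * Complex.I))
      - ∫ y in (-n : ℝ)..n, K (a + y * Complex.I)) * Complex.I_mul_I
  have hhor : ∀ s : ℕ → ℝ, (∀ n, s n ^ 2 = (n : ℝ) ^ 2) →
      Tendsto (fun n : ℕ => ∫ x in a..b, K (x + s n * Complex.I)) atTop (𝓝 0) := by
    intro s hsn
    have hlim : Tendsto (fun n : ℕ => C / (1 + (n : ℝ) ^ 2) * |b - a|) atTop (𝓝 0) := by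
      rw [← zero_mul |b - a|]
      refine Tendsto.mul_const _ (Tendsto.div_atTop tendsto_const_nhds ?_)
      exact tendsto_atTop_add_const_left _ _
        ((tendsto_pow_atTop two_ne_zero).comp tendsto_natCast_atTop_atTop)
    refine squeeze_zero_norm (fun n => ?_) hlim
    refine intervalIntegral.norm_integral_le_of_norm_le_const fun x hx => ?_
    rw [uIoc_of_le hab] at hx
    have := hC (x + s n * Complex.I) (by simpa using ⟨hx.1.le, hx.2⟩)
    simpa [hsn n] using this
  have t1 := intervalIntegral_tendsto_integral (hint b (right_mem_Icc.2 hab))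
    (tendsto_neg_atTop_atBot.comp tendsto_natCast_atTop_atTop) tendsto_natCast_atTop_atTop
  have t2 := intervalIntegral_tendsto_integral (hint a (left_mem_Icc.2 hab))
    (tendsto_neg_atTop_atBot.comp tendsto_natCast_atTop_atTop) tendsto_natCast_atTop_atTop
  have t3 := ((hhor (fun n => -n) fun n => by ring).sub (hhor (fun n => n) fun n => rfl)).const_mul
    Complex.I
  rw [sub_zero, mul_zero] at t3
  have t4 := tendsto_nhds_unique (t1.sub t2) (t3.congr fun n => (hrect n).symm)
  exact (sub_eq_zero.1 t4).symm

/-- A function that is analytic on a half-plane `Re z < δ`, `δ > 0`, and decays quadratically there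
is on the imaginary axis of the form `∫_0^∞ h(r) e^{rz} dr` with an integrable `h`. -/
theorem exists_laplace_representation {K : ℂ → ℂ} {δ C : ℝ} (hδ : 0 < δ)
    (hd : ∀ z : ℂ, z.re < δ → DifferentiableAt ℂ K z)
    (hC : ∀ z : ℂ, z.re < δ → ‖K z‖ ≤ C / (1 + z.im ^ 2)) :
    ∃ h : ℝ → ℂ, IntegrableOn h (Ioi 0) ∧ ∀ ξ : ℝ, K ((2 * Real.pi * ξ : ℝ) * Complex.I)
      = ∫ r in Ioi (0 : ℝ), Complex.exp ((2 * Real.pi * (r * ξ) : ℝ) * Complex.I) * h r := by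
  have hC0 : 0 ≤ C := by
    have := (norm_nonneg _).trans (hC 0 (by simpa using hδ))
    simpa using this
  set κ : ℝ → ℂ := fun ξ => K ((2 * Real.pi * ξ : ℝ) * Complex.I) with hκ
  have hK0 : Continuous fun y : ℝ => K (y * Complex.I) := by
    refine continuous_iff_continuousAt.2 fun y => ?_
    exact (hd (y * Complex.I) (by simpa using hδ)).continuousAt.comp
        (f := fun y : ℝ => (y : ℂ) * Complex.I) (by fun_prop)
  have hK0i : Integrable fun y : ℝ => K (y * Complex.I) :=
    integrable_of_norm_le_div_one_add_sq hK0 fun y => by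
      simpa using hC (y * Complex.I) (by simpa using hδ)
  have hκc : Continuous κ := hK0.comp (by fun_prop : Continuous fun ξ : ℝ => 2 * Real.pi * ξ)
  have hκi : Integrable κ := hK0i.comp_mul_left' Real.two_pi_pos.ne'
  set h : ℝ → ℂ := 𝓕 κ with hh
  have hform : ∀ r : ℝ, h r = ((2 * Real.pi)⁻¹ : ℝ) •
      ∫ y : ℝ, Complex.exp (-r * (y * Complex.I)) * K (y * Complex.I) := by
    intro r
    have := Measure.integral_comp_mul_left
      (fun y : ℝ => Complex.exp (-r * (y * Complex.I)) * K (y * Complex.I)) (2 * Real.pi)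
    rw [abs_of_pos (inv_pos.2 Real.two_pi_pos)] at this
    rw [← this, hh, Real.fourier_eq']
    refine integral_congr_ae (ae_of_all _ fun ξ => ?_)
    simp only [hκ, smul_eq_mul]
    congr 2
    simp
    ring
  -- Moving the contour to `Re z = c` gives `e^{-rc}`. Letting `c → -∞` kills `h` on the negative
  -- half-line, and `c = δ/2` gives exponential decay on the positive one.
  have hbound : ∀ c : ℝ, c < δ → ∀ r : ℝ, ‖h r‖ ≤ C * Real.exp (-r * c) := by
    intro c hc r
    have hshift : ∫ y : ℝ, Complex.exp (-r * (y * Complex.I)) * K (y * Complex.I)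
        = ∫ y : ℝ, Complex.exp (-r * (c + y * Complex.I)) * K (c + y * Complex.I) := by
      have hd' : ∀ z : ℂ, z.re < δ → DifferentiableAt ℂ (fun z => Complex.exp (-r * z) * K z) z :=
        fun z hz => DifferentiableAt.mul (by fun_prop) (hd z hz)
      have hC' : ∀ z : ℂ, |z.re| ≤ |c| → z.re < δ →
          ‖Complex.exp (-r * z) * K z‖ ≤ (Real.exp (|r| * |c|) * C) / (1 + z.im ^ 2) := by
        intro z hz hz'
        rw [norm_mul, mul_div_assoc, Complex.norm_exp]
        refine mul_le_mul (Real.exp_le_exp.2 ?_) (hC z hz') (norm_nonneg _) (Real.exp_pos _).le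
        have : (-(r : ℂ) * z).re = -(r * z.re) := by simp
        rw [this]
        refine (neg_le_abs _).trans ?_
        rw [abs_mul]
        gcongr
      rcases le_total 0 c with h0 | h0
      · have := integral_verticalLine_eq h0 (fun z hz => hd' z (hz.2.trans_lt hc))
          (fun z hz => hC' z (abs_le_abs_of_nonneg hz.1 hz.2) (hz.2.trans_lt hc))
        simpa using this
      · have := integral_verticalLine_eq h0 (fun z hz => hd' z (hz.2.trans_lt hδ))
          (fun z hz => hC' z (abs_le_abs_of_nonpos hz.2 hz.1) (hz.2.trans_lt hδ))
        simpa using this.symm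
    rw [hform, hshift, norm_smul, Real.norm_eq_abs, abs_of_pos (inv_pos.2 Real.two_pi_pos)]
    have hle : ‖∫ y : ℝ, Complex.exp (-r * (c + y * Complex.I)) * K (c + y * Complex.I)‖
        ≤ ∫ y : ℝ, Real.exp (-r * c) * C * (1 + y ^ 2)⁻¹ := by
      refine norm_integral_le_of_norm_le (integrable_inv_one_add_sq.const_mul _)
        (ae_of_all _ fun y => ?_)
      rw [norm_mul, Complex.norm_exp, mul_assoc, ← div_eq_mul_inv]
      have e1 : (-(r : ℂ) * (c + y * Complex.I)).re = -r * c := by simp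
      rw [e1]
      gcongr
      simpa using hC (c + y * Complex.I) (by simpa using hc)
    rw [integral_const_mul, integral_univ_inv_one_add_sq] at hle
    calc (2 * Real.pi)⁻¹ * ‖∫ y : ℝ, Complex.exp (-r * (c + y * Complex.I)) * K (c + y * Complex.I)‖
        ≤ (2 * Real.pi)⁻¹ * (Real.exp (-r * c) * C * Real.pi) := by gcongr
      _ = C * Real.exp (-r * c) / 2 := by field_simp
      _ ≤ _ := half_le_self (by positivity)
  have hneg : ∀ r : ℝ, r < 0 → h r = 0 := by
    intro r hr
    rw [← norm_le_zero_iff]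
    have t : Tendsto (fun c : ℝ => C * Real.exp (-r * c)) atBot (𝓝 (C * 0)) := by
      refine Tendsto.const_mul _ (Real.tendsto_exp_atBot.comp ?_)
      exact tendsto_id.const_mul_atBot (by linarith)
    rw [mul_zero] at t
    refine ge_of_tendsto t ?_
    filter_upwards [eventually_lt_atBot δ] with c hc
    exact hbound c hc r
  have hhc : Continuous h := VectorFourier.fourierIntegral_continuous Real.continuous_fourierChar
    (by fun_prop) hκi
  have hi0 : IntegrableOn h (Ioi 0) := by
    refine ((integrableOn_exp_mul_Ioi (a := -(δ / 2)) (by linarith) 0).const_mul C).mono'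
      hhc.aestronglyMeasurable (ae_of_all _ fun r => ?_)
    refine (hbound (δ / 2) (by linarith) r).trans_eq ?_
    ring_nf
  -- The one-sided support makes `h` integrable on the line, so Fourier inversion recovers the
  -- symbol as an integral over `(0,∞)`.
  have hsupp : h =ᵐ[volume] (Ioi (0 : ℝ)).indicator h := by
    filter_upwards [Measure.ae_ne volume (0 : ℝ)] with r hr
    by_cases h0 : 0 < r
    · rw [indicator_of_mem (mem_Ioi.2 h0)]
    · rw [indicator_of_notMem (by simpa using h0), hneg r (lt_of_le_of_ne (not_lt.1 h0) hr)]
  have hi : Integrable h := ((integrable_indicator_iff measurableSet_Ioi).2 hi0).congr hsupp.symm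
  refine ⟨h, hi0, fun ξ => ?_⟩
  have hinv := hκi.fourierInv_fourier_eq hi (hκc.continuousAt (x := ξ))
  change κ ξ = _
  rw [← hinv, Real.fourierInv_eq', ← integral_indicator measurableSet_Ioi]
  refine integral_congr_ae ?_
  filter_upwards [hsupp] with r hr
  rw [← hh, hr, smul_eq_mul]
  by_cases h0 : 0 < r
  · rw [indicator_of_mem (mem_Ioi.2 h0), indicator_of_mem (mem_Ioi.2 h0)]
    simp [mul_comm]
  · rw [indicator_of_notMem (by simpa using h0), indicator_of_notMem (by simpa using h0), mul_zero]

end LaplaceRepresentation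

/-! ### The boundary function as an analytic symbol -/

section BoundaryLp

theorem bddAbove_hInfNorm {g : ℂ → ℂ} (hg : g ∈ HInfMinus) :
    BddAbove (range fun s : leftHalfPlane => ‖g s‖) := by
  obtain ⟨-, K, hK⟩ := hg
  exact ⟨K, by rintro _ ⟨s, rfl⟩; exact hK s s.2⟩

theorem norm_le_hInfNorm {g : ℂ → ℂ} (hg : g ∈ HInfMinus) {s : ℂ} (hs : s ∈ leftHalfPlane) :
    ‖g s‖ ≤ hInfNorm g :=
  le_ciSup (bddAbove_hInfNorm hg) (⟨s, hs⟩ : leftHalfPlane)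

theorem ofReal_add_mul_I_mem_leftHalfPlane {r : ℝ} (hr : r < 0) (ω : ℝ) :
    (r + ω * Complex.I : ℂ) ∈ leftHalfPlane := by
  change (r + ω * Complex.I : ℂ).re < 0
  simpa using hr

theorem tendsto_neg_one_div_nhdsLT :
    Tendsto (fun n : ℕ => -(1 / ((n : ℝ) + 1))) atTop (𝓝[<] (0 : ℝ)) := by
  refine tendsto_nhdsWithin_iff.2 ⟨?_, Eventually.of_forall fun n => ?_⟩
  · simpa using (tendsto_one_div_add_atTop_nhds_zero_nat (𝕜 := ℝ)).neg
  · change -(1 / ((n : ℝ) + 1)) < 0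
    have : (0 : ℝ) < 1 / (n + 1) := by positivity
    linarith

theorem continuous_verticalLine {g : ℂ → ℂ} (hg : g ∈ HInfMinus) {r : ℝ} (hr : r < 0) :
    Continuous fun ξ : ℝ => g (r + (2 * Real.pi * ξ : ℝ) * Complex.I) := by
  refine continuous_iff_continuousAt.2 fun ξ => ?_
  exact ((hg.1.differentiableAt (isOpen_leftHalfPlane.mem_nhds
    (ofReal_add_mul_I_mem_leftHalfPlane hr (2 * Real.pi * ξ)))).continuousAt).comp
    (f := fun ξ : ℝ => (r + (2 * Real.pi * ξ : ℝ) * Complex.I : ℂ)) (by fun_prop)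

theorem ae_norm_boundaryValue_le {g : ℂ → ℂ} (hg : g ∈ HInfMinus) :
    ∀ᵐ ξ : ℝ, ‖boundaryValue g (2 * Real.pi * ξ)‖ ≤ hInfNorm g := by
  filter_upwards [ae_exists_tendsto_boundary hg] with ξ hξ
  refine le_of_tendsto hξ.norm ?_
  filter_upwards [self_mem_nhdsWithin] with r hr
  exact norm_le_hInfNorm hg (ofReal_add_mul_I_mem_leftHalfPlane hr _)

theorem memLp_boundaryValue {g : ℂ → ℂ} (hg : g ∈ HInfMinus) :
    MemLp (fun ξ : ℝ => boundaryValue g (2 * Real.pi * ξ)) ∞ volume := by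
  refine memLp_top_of_bound ?_ _ (ae_norm_boundaryValue_le hg)
  refine aestronglyMeasurable_of_tendsto_ae atTop (fun n : ℕ => (continuous_verticalLine hg
    (r := -(1 / ((n : ℝ) + 1))) (neg_lt_zero.2 (by positivity))).aestronglyMeasurable) ?_
  filter_upwards [ae_exists_tendsto_boundary hg] with ξ hξ
  exact hξ.comp tendsto_neg_one_div_nhdsLT

theorem coeFn_boundaryLp {g : ℂ → ℂ} (hg : g ∈ HInfMinus) :
    boundaryLp g =ᵐ[volume] fun ξ : ℝ => boundaryValue g (2 * Real.pi * ξ) := by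
  rw [boundaryLp, dif_pos (memLp_boundaryValue hg)]
  exact MemLp.coeFn_toLp _

theorem ae_tendsto_boundaryLp {g : ℂ → ℂ} (hg : g ∈ HInfMinus) :
    ∀ᵐ ξ : ℝ, Tendsto (fun r : ℝ => g (r + (2 * Real.pi * ξ : ℝ) * Complex.I)) (𝓝[<] 0)
      (𝓝 (boundaryLp g ξ)) := by
  filter_upwards [coeFn_boundaryLp hg, ae_exists_tendsto_boundary hg] with ξ h1 h2
  rwa [h1]

theorem norm_boundaryLp_le {g : ℂ → ℂ} (hg : g ∈ HInfMinus) : ‖boundaryLp g‖ ≤ hInfNorm g := by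
  have h0 : 0 ≤ hInfNorm g := Real.iSup_nonneg fun _ => norm_nonneg _
  rw [Lp.norm_def, eLpNorm_exponent_top]
  refine ENNReal.toReal_le_of_le_ofReal h0 (eLpNormEssSup_le_of_ae_bound ?_)
  filter_upwards [coeFn_boundaryLp hg, ae_norm_boundaryValue_le hg] with ξ h1 h2
  rwa [h1]

theorem ae_boundaryLp_mul {f g : ℂ → ℂ} (hf : f ∈ HInfMinus) (hg : g ∈ HInfMinus) :
    ∀ᵐ ξ : ℝ, boundaryLp (f * g) ξ = boundaryLp f ξ * boundaryLp g ξ := by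
  filter_upwards [ae_tendsto_boundaryLp (mul_mem hf hg), ae_tendsto_boundaryLp hf,
    ae_tendsto_boundaryLp hg] with ξ h1 h2 h3
  exact tendsto_nhds_unique h1 (h2.mul h3)

theorem boundaryLp_add {f g : ℂ → ℂ} (hf : f ∈ HInfMinus) (hg : g ∈ HInfMinus) :
    boundaryLp (f + g) = boundaryLp f + boundaryLp g := by
  refine Lp.ext ?_
  filter_upwards [ae_tendsto_boundaryLp (add_mem hf hg), ae_tendsto_boundaryLp hf,
    ae_tendsto_boundaryLp hg, Lp.coeFn_add (boundaryLp f) (boundaryLp g)] with ξ h1 h2 h3 h4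
  rw [h4]
  exact tendsto_nhds_unique h1 (h2.add h3)

theorem ae_boundaryLp_algebraMap (c : ℂ) :
    ∀ᵐ ξ : ℝ, boundaryLp (algebraMap ℂ (ℂ → ℂ) c) ξ = c := by
  filter_upwards [ae_tendsto_boundaryLp (HInfMinus.algebraMap_mem c)] with ξ h1
  exact tendsto_nhds_unique h1 tendsto_const_nhds

/-- The boundary function of a bounded analytic function is an analytic symbol. -/
theorem isAnalyticSymbol_boundaryLp {g : ℂ → ℂ} (hg : g ∈ HInfMinus) :
    IsAnalyticSymbol (boundaryLp g) := by
  set N := hInfNorm g with hN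
  have hN0 : 0 ≤ N := Real.iSup_nonneg fun _ => norm_nonneg _
  set δ : ℕ → ℝ := fun n => 1 / ((n : ℝ) + 1) with hδdef
  have hδ : ∀ n, 0 < δ n := fun n => by simp only [hδdef]; positivity
  have hδ1 : ∀ n, δ n ≤ 1 := fun n => by
    simp only [hδdef]
    rw [div_le_one (by positivity)]
    linarith [Nat.cast_nonneg (α := ℝ) n]
  set M : ℕ → ℝ := fun n => n + 2 with hMdef
  have hM : ∀ n, 2 ≤ M n := fun n => by
    simp only [hMdef]; linarith [Nat.cast_nonneg (α := ℝ) n]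
  -- The shift by `δ n` gives analyticity beyond the axis. The squared factor gives quadratic decay,
  -- has modulus at most `1` on the axis and tends to `1` there. As `δ n ≤ 1` and `M n ≥ 2`, its
  -- pole stays at distance at least `1` from `Re z < δ n`.
  set K : ℕ → ℂ → ℂ := fun n z => g (z - δ n) * (M n / (M n - z)) ^ 2 with hK
  have hmem : ∀ n (z : ℂ), z.re < δ n → z - δ n ∈ leftHalfPlane := fun n z hz => by
    change (z - δ n).re < 0
    simpa using hz
  have hre : ∀ n (z : ℂ), z.re < δ n → 1 ≤ (M n - z).re := fun n z hz => by
    simp only [Complex.sub_re, Complex.ofReal_re]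
    linarith [hδ1 n, hM n]
  have hne : ∀ n (z : ℂ), z.re < δ n → (M n - z : ℂ) ≠ 0 := fun n z hz h => by
    have := hre n z hz
    rw [h, Complex.zero_re] at this
    linarith
  have hKd : ∀ n (z : ℂ), z.re < δ n → DifferentiableAt ℂ (K n) z := by
    intro n z hz
    have h1 : DifferentiableAt ℂ g (z - δ n) :=
      hg.1.differentiableAt (isOpen_leftHalfPlane.mem_nhds (hmem n z hz))
    have h2 : DifferentiableAt ℂ (fun z : ℂ => g (z - δ n)) z :=
      h1.comp z (differentiableAt_id.sub_const _)
    refine h2.mul ((DifferentiableAt.div (by fun_prop) (by fun_prop) (hne n z hz)).pow 2)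
  have hKb : ∀ n (z : ℂ), z.re < δ n → ‖K n z‖ ≤ (N * M n ^ 2) / (1 + z.im ^ 2) := by
    intro n z hz
    have h1 := norm_le_hInfNorm hg (hmem n z hz)
    have h2 : 1 + z.im ^ 2 ≤ ‖(M n - z : ℂ)‖ ^ 2 := by
      rw [← Complex.normSq_eq_norm_sq, Complex.normSq_apply]
      have h3 := hre n z hz
      have h4 : (M n - z : ℂ).im = -z.im := by simp
      rw [h4]
      nlinarith
    have h5 : 0 < M n := by linarith [hM n]
    rw [hK, norm_mul, norm_pow, norm_div, Complex.norm_real, Real.norm_eq_abs, abs_of_pos h5,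
      div_pow, mul_div_assoc]
    gcongr
  have hκ1 : ∀ n (ξ : ℝ), ‖K n ((2 * Real.pi * ξ : ℝ) * Complex.I)‖ ≤ N := by
    intro n ξ
    have h0 : ((2 * Real.pi * ξ : ℝ) * Complex.I : ℂ).re < δ n := by simpa using hδ n
    have h1 := norm_le_hInfNorm hg (hmem n _ h0)
    have h5 : 0 < M n := by linarith [hM n]
    have h6 : ‖(M n / (M n - (2 * Real.pi * ξ : ℝ) * Complex.I) : ℂ)‖ ≤ 1 := by
      rw [norm_div, Complex.norm_real, Real.norm_eq_abs, abs_of_pos h5]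
      refine div_le_one_of_le₀ ?_ (norm_nonneg _)
      refine le_trans (le_of_eq ?_) (Complex.re_le_norm _)
      simp
    rw [hK, norm_mul, norm_pow]
    exact (mul_le_of_le_one_right (norm_nonneg _) (pow_le_one₀ (norm_nonneg _) h6)).trans h1
  have hκc : ∀ n, Continuous fun ξ : ℝ => K n ((2 * Real.pi * ξ : ℝ) * Complex.I) := by
    intro n
    refine continuous_iff_continuousAt.2 fun ξ => ?_
    exact (hKd n ((2 * Real.pi * ξ : ℝ) * Complex.I) (by simpa using hδ n)).continuousAt.comp
      (f := fun ξ : ℝ => ((2 * Real.pi * ξ : ℝ) * Complex.I : ℂ)) (by fun_prop)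
  have hκm : ∀ n, MemLp (fun ξ : ℝ => K n ((2 * Real.pi * ξ : ℝ) * Complex.I)) ∞ volume :=
    fun n => memLp_top_of_bound (hκc n).aestronglyMeasurable N (ae_of_all _ (hκ1 n))
  choose h hhi hh using fun n => exists_laplace_representation (hδ n) (hKd n) (hKb n)
  refine ⟨fun n => (hκm n).toLp, h, N, fun n => ⟨hhi n, ?_⟩, fun n => ?_, ?_⟩
  · filter_upwards [(hκm n).coeFn_toLp] with ξ e
    rw [e, hh]
  · filter_upwards [(hκm n).coeFn_toLp] with ξ e
    rw [e]
    exact hκ1 n ξ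
  · filter_upwards [ae_all_iff.2 fun n => (hκm n).coeFn_toLp, ae_tendsto_boundaryLp hg] with ξ e1 e2
    simp only [e1]
    have t1 := e2.comp tendsto_neg_one_div_nhdsLT
    have t2 : Tendsto (fun n : ℕ => ((M n : ℂ) / (M n - (2 * Real.pi * ξ : ℝ) * Complex.I)) ^ 2)
        atTop (𝓝 (1 ^ 2)) := by
      refine Tendsto.pow ?_ 2
      set w : ℂ := (2 * Real.pi * ξ : ℝ) * Complex.I with hw
      have hMt : Tendsto M atTop atTop :=
        tendsto_atTop_add_const_right _ _ tendsto_natCast_atTop_atTop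
      have t3 : Tendsto (fun n => w * ((M n)⁻¹ : ℝ)) atTop (𝓝 (w * (0 : ℝ))) :=
        ((Complex.continuous_ofReal.tendsto _).comp (tendsto_inv_atTop_zero.comp hMt)).const_mul w
      have t4 := (tendsto_const_nhds (x := (1 : ℂ))).sub t3
      rw [Complex.ofReal_zero, mul_zero, sub_zero] at t4
      have t5 := t4.inv₀ one_ne_zero
      rw [inv_one] at t5
      refine t5.congr fun n => ?_
      have h5 : (M n : ℂ) ≠ 0 := by
        have := hM n
        exact_mod_cast (by linarith : M n ≠ 0)
      have h6 : (M n - w : ℂ) ≠ 0 := hne n w (by simpa [hw] using hδ n)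
      have h7 : (1 - w * ((M n)⁻¹ : ℝ) : ℂ) = (M n - w) / M n := by
        push_cast
        field_simp
      rw [h7, inv_div]
    have t6 := t1.mul t2
    rw [one_pow, mul_one] at t6
    refine t6.congr fun n => ?_
    simp only [hK, Function.comp_apply, hδdef]
    congr 2
    push_cast
    ring

/-- For `Re s = 0 < Re a`, `∫_0^∞ e^{(s-a)r} dr = -1/(s - a)`. -/
theorem isLaplaceSymbol_boundaryLp_resolvent {a : ℂ} (ha : 0 < a.re) {g : ℂ → ℂ}
    (hg : g ∈ HInfMinus) (hga : ∀ s ∈ leftHalfPlane, g s = (s - a)⁻¹) :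
    IsLaplaceSymbol (boundaryLp g) fun r : ℝ => -Complex.exp (-a * r) := by
  have hexp : ∀ ω : ℝ, IntegrableOn (fun r : ℝ => Complex.exp ((ω * Complex.I - a) * r)) (Ioi 0) :=
    fun ω => integrableOn_exp_mul_complex_Ioi (by simpa using ha) 0
  refine ⟨by simpa using (hexp 0).neg, ?_⟩
  filter_upwards [ae_tendsto_boundaryLp hg] with ξ h1
  have hne : ((2 * Real.pi * ξ : ℝ) * Complex.I - a : ℂ) ≠ 0 := fun h => by
    have := congrArg Complex.re h
    simp at this
    linarith
  have h2 : Tendsto (fun r : ℝ => (r + (2 * Real.pi * ξ : ℝ) * Complex.I - a : ℂ)⁻¹) (𝓝[<] 0)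
      (𝓝 (((2 * Real.pi * ξ : ℝ) * Complex.I - a : ℂ)⁻¹)) := by
    refine Tendsto.inv₀ ?_ hne
    have hc : Continuous fun r : ℝ => (r + (2 * Real.pi * ξ : ℝ) * Complex.I - a : ℂ) := by fun_prop
    simpa using (hc.tendsto 0).mono_left nhdsWithin_le_nhds
  have h3 : boundaryLp g ξ = ((2 * Real.pi * ξ : ℝ) * Complex.I - a : ℂ)⁻¹ := by
    refine tendsto_nhds_unique h1 (h2.congr' ?_)
    filter_upwards [self_mem_nhdsWithin] with r hr
    rw [hga _ (ofReal_add_mul_I_mem_leftHalfPlane hr _)]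
  have h4 := integral_exp_mul_complex_Ioi (a := (2 * Real.pi * ξ : ℝ) * Complex.I - a)
    (by simpa using ha) 0
  rw [Complex.ofReal_zero, mul_zero, Complex.exp_zero] at h4
  rw [h3, ← one_div, ← neg_neg (1 / _), ← neg_div, ← h4, ← integral_neg]
  refine integral_congr_ae (ae_of_all _ fun r => ?_)
  simp only
  rw [mul_neg, ← Complex.exp_add]
  congr 2
  push_cast
  ring

end BoundaryLp

/-! ### The functional calculus -/

section FunctionalCalculus

variable {X : Type*} [NormedAddCommGroup X] [InnerProductSpace ℂ X] [CompleteSpace X]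

theorem mem_graph_toPMap_iff {S : X →ₗ[ℂ] X} {D : Submodule ℂ X} {x y : X} :
    (x, y) ∈ (S.toPMap D).graph ↔ x ∈ D ∧ S x = y := by
  rw [LinearPMap.mem_graph_iff]
  constructor
  · rintro ⟨⟨x, hx⟩, rfl, rfl⟩
    exact ⟨hx, rfl⟩
  · rintro ⟨hx, rfl⟩
    exact ⟨⟨x, hx⟩, rfl, rfl⟩

/-- Every interval `(0,ε)` has positive measure. The defining identity of `g(A)` holds only for
almost every `t`, so uniqueness is tested along such times tending to `0`. -/
theorem frequently_nhdsGT_of_ae_restrict_Ioi {p : ℝ → Prop}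
    (hp : ∀ᵐ t ∂(volume.restrict (Ioi (0 : ℝ))), p t) : ∃ᶠ t in 𝓝[>] (0 : ℝ), p t := by
  rw [(nhdsGT_basis (0 : ℝ)).frequently_iff]
  intro ε hε
  have h1 : ∀ᵐ t ∂(volume.restrict (Ioo 0 ε)), p t :=
    ae_restrict_of_ae_restrict_of_subset Ioo_subset_Ioi_self hp
  have : (ae (volume.restrict (Ioo 0 ε))).NeBot := by
    rw [ae_restrict_neBot]
    simpa using hε
  obtain ⟨t, ht1, ht2⟩ := (h1.and (ae_restrict_mem measurableSet_Ioo)).exists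
  exact ⟨t, ht2, ht1⟩

/-- The operator `g(A)` is unique. -/
theorem IsFunctionOfGenerator.unique {T : ℝ → X →L[ℂ] X} (hT : IsC0Semigroup T) {g : ℂ → ℂ}
    {G₁ G₂ : X →ₗ.[ℂ] X} (h₁ : IsFunctionOfGenerator T g G₁) (h₂ : IsFunctionOfGenerator T g G₂) :
    G₁ = G₂ := by
  refine LinearPMap.ext (h₁.domain_eq.trans h₂.domain_eq.symm) fun x hx₁ hx₂ => ?_
  have hx : x ∈ (generator T).domain := h₁.domain_eq ▸ hx₁
  obtain ⟨y, hy⟩ := mem_domain_generator_iff.1 hx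
  obtain ⟨c₁, hc₁⟩ := h₁.bounded_graphNorm
  obtain ⟨c₂, hc₂⟩ := h₂.bounded_graphNorm
  have hg₁ : (x, G₁ ⟨x, hx₁⟩) ∈ G₁.graph := G₁.mem_graph ⟨x, hx₁⟩
  have hg₂ : (x, G₂ ⟨x, hx₂⟩) ∈ G₂.graph := G₂.mem_graph ⟨x, hx₂⟩
  -- `T(t)x → x` in the graph norm as `t ↓ 0`, and both operators take the same value `z` at `T(t)x`
  -- for almost every `t`. Boundedness for the graph norm then forces equality at `x`.
  set φ : ℝ → ℝ := fun t => c₁ * (‖x - T t x‖ + ‖y - T t y‖) + c₂ * (‖x - T t x‖ + ‖y - T t y‖)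
    with hφ
  have hlim : Tendsto φ (𝓝[>] 0) (𝓝 0) := by
    have t1 : ∀ z : X, Tendsto (fun t => ‖z - T t z‖) (𝓝[>] 0) (𝓝 0) := fun z => by
      simpa using ((tendsto_const_nhds (x := z)).sub (hT.tendsto_zero z)).norm
    simpa using (((t1 x).add (t1 y)).const_mul c₁).add (((t1 x).add (t1 y)).const_mul c₂)
  have hbound : ∃ᶠ t in 𝓝[>] (0 : ℝ), ‖G₁ ⟨x, hx₁⟩ - G₂ ⟨x, hx₂⟩‖ ≤ φ t := by
    have hae : ∀ᵐ t ∂(volume.restrict (Ioi (0 : ℝ))), ∃ z, (T t x, z) ∈ G₁.graph ∧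
        (T t x, z) ∈ G₂.graph := by
      filter_upwards [h₁.output_eq x hx, h₂.output_eq x hx] with t e1 e2
      exact ⟨_, e1, e2⟩
    refine ((frequently_nhdsGT_of_ae_restrict_Ioi hae).and_eventually
      self_mem_nhdsWithin).mono ?_
    rintro t ⟨⟨z, hz₁, hz₂⟩, ht⟩
    have hgen : (x - T t x, y - T t y) ∈ (generator T).graph := by
      rw [generator_graph]
      exact sub_mem hy (hT.map_mem_generatorGraph hy (le_of_lt ht))
    have b1 := hc₁ _ _ _ hgen (sub_mem hg₁ hz₁)
    have b2 := hc₂ _ _ _ hgen (sub_mem hg₂ hz₂)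
    calc ‖G₁ ⟨x, hx₁⟩ - G₂ ⟨x, hx₂⟩‖ = ‖(G₁ ⟨x, hx₁⟩ - z) - (G₂ ⟨x, hx₂⟩ - z)‖ := by
          rw [sub_sub_sub_cancel_right]
      _ ≤ _ := (norm_sub_le _ _).trans (add_le_add b1 b2)
  have h0 := ge_of_tendsto_of_frequently hlim hbound
  exact sub_eq_zero.1 (norm_le_zero_iff.1 h0)

/-- A bounded operator that commutes with the semigroup and reproduces the Toeplitz operator on
orbits is `g(A)`. -/
theorem isFunctionOfGenerator_toPMap {T : ℝ → X →L[ℂ] X} (hT : IsC0Semigroup T)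
    (hs : IsExponentiallyStable T) {g : ℂ → ℂ} {S : X →L[ℂ] X}
    (hcomm : ∀ t, 0 ≤ t → ∀ x, S (T t x) = T t (S x))
    (hS : ∀ x, toeplitz g (orbitLp T x) = orbitLp T (S x)) :
    IsFunctionOfGenerator T g ((S : X →ₗ[ℂ] X).toPMap (generator T).domain) where
  domain_eq := rfl
  bounded_graphNorm := by
    refine ⟨‖S‖, fun x y z _ hz => ?_⟩
    obtain ⟨-, rfl⟩ := mem_graph_toPMap_iff.1 hz
    refine (S.le_opNorm x).trans ?_
    gcongr
    exact le_add_of_nonneg_right (norm_nonneg y)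
  admissible := by
    obtain ⟨C, hC, h⟩ := hT.memLp_orbit hs
    refine ⟨le_rfl, C * ‖S‖ ^ 2, fun x hx => ⟨fun t => T t (S x), fun t ht => ?_, (h _).1, ?_⟩⟩
    · exact mem_graph_toPMap_iff.2 ⟨hT.map_mem_domain hx ht, hcomm t ht x⟩
    · refine (h (S x)).2.trans ?_
      rw [mul_assoc, ← mul_pow]
      gcongr
      exact S.le_opNorm x
  output_eq x hx := by
    obtain ⟨V, hV1, hV2, -⟩ := hT.exists_orbit hs
    rw [hS, ← hV1]
    filter_upwards [hV2 (S x), ae_restrict_mem measurableSet_Ioi] with t h1 ht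
    rw [h1]
    exact mem_graph_toPMap_iff.2 ⟨hT.map_mem_domain hx (le_of_lt ht), hcomm t (le_of_lt ht) x⟩

/-- The functional calculus `g ↦ Λ M_g Ψ` for a left invertible operator `Ψ` that intertwines the
semigroup with the left shift. -/
def toeplitzCalculus {T : ℝ → X →L[ℂ] X} (hT : IsC0Semigroup T) (hs : IsExponentiallyStable T)
    {Ψ : X →L[ℂ] Lp X 2 (volume.restrict (Ioi (0 : ℝ)))}
    {Λ : Lp X 2 (volume.restrict (Ioi (0 : ℝ))) →L[ℂ] X} (hΨ : IsIntertwining T Ψ)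
    (hΛ : ∀ x, Λ (Ψ x) = x) : HInfMinus →ₐ[ℂ] (X →L[ℂ] X) where
  toFun g := Λ ∘L toeplitzL X (boundaryLp g) ∘L Ψ
  map_one' := by
    ext x
    have h := toeplitzL_eq_id (X := X) (ae_boundaryLp_algebraMap 1)
    rw [_root_.map_one] at h
    change Λ (toeplitzL X (boundaryLp 1) (Ψ x)) = x
    rw [h]
    exact hΛ x
  map_mul' f g := by
    ext x
    change Λ (toeplitzL X (boundaryLp (f * g : ℂ → ℂ)) (Ψ x))
      = Λ (toeplitzL X (boundaryLp f) (Ψ (Λ (toeplitzL X (boundaryLp g) (Ψ x)))))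
    -- Since `M_g Ψ x` lies in the range of `Ψ`, the projection `Ψ Λ` between the two factors acts
    -- as the identity.
    rw [(isAnalyticSymbol_boundaryLp f.2).toeplitzL_comp (ae_boundaryLp_mul f.2 g.2),
      (isAnalyticSymbol_boundaryLp g.2).toeplitzL_intertwining hT hs hΨ hΨ hΛ]
    simp only [hΛ]
  map_zero' := by
    -- The boundary function of `0` vanishes because it equals its own double.
    have h := boundaryLp_add (zero_mem HInfMinus) (zero_mem HInfMinus)
    rw [add_zero, left_eq_add] at h
    ext x
    change Λ (toeplitzL X (boundaryLp 0) (Ψ x)) = 0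
    have h2 := toeplitzL_smul (X := X) 0 (0 : Lp ℂ ∞ (volume : Measure ℝ))
    rw [zero_smul, zero_smul] at h2
    rw [h, h2]
    exact _root_.map_zero Λ
  map_add' f g := by
    ext x
    change Λ (toeplitzL X (boundaryLp (f + g : ℂ → ℂ)) (Ψ x))
      = Λ (toeplitzL X (boundaryLp f) (Ψ x)) + Λ (toeplitzL X (boundaryLp g) (Ψ x))
    rw [boundaryLp_add f.2 g.2, toeplitzL_add]
    exact _root_.map_add Λ _ _
  commutes' c := by
    ext x
    have h1 : boundaryLp (algebraMap ℂ (ℂ → ℂ) c) = c • boundaryLp (algebraMap ℂ (ℂ → ℂ) 1) := by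
      refine Lp.ext ?_
      filter_upwards [ae_boundaryLp_algebraMap c, ae_boundaryLp_algebraMap 1,
        Lp.coeFn_smul c (boundaryLp (algebraMap ℂ (ℂ → ℂ) 1))] with ξ e1 e2 e3
      rw [e1, e3, Pi.smul_apply, e2, smul_eq_mul, mul_one]
    change Λ (toeplitzL X (boundaryLp (algebraMap ℂ (ℂ → ℂ) c)) (Ψ x)) = c • x
    rw [h1, toeplitzL_smul, toeplitzL_eq_id (ae_boundaryLp_algebraMap 1), _root_.smul_apply,
      map_smul]
    exact congrArg _ (hΛ x)

/-! ### Properties of the calculus `g ↦ Λ M_g Ψ` -/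

section Calculus

variable {T : ℝ → X →L[ℂ] X} (hT : IsC0Semigroup T) (hs : IsExponentiallyStable T)
  {Ψ : X →L[ℂ] Lp X 2 (volume.restrict (Ioi (0 : ℝ)))}
  {Λ : Lp X 2 (volume.restrict (Ioi (0 : ℝ))) →L[ℂ] X} (hΨ : IsIntertwining T Ψ)
  (hΛ : ∀ x, Λ (Ψ x) = x)

theorem toeplitzL_boundaryLp_intertwining
    {V : X →L[ℂ] Lp X 2 (volume.restrict (Ioi (0 : ℝ)))} (hV : IsIntertwining T V) (g : HInfMinus)
    (x : X) : toeplitzL X (boundaryLp g) (V x) = V (toeplitzCalculus hT hs hΨ hΛ g x) :=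
  (isAnalyticSymbol_boundaryLp g.2).toeplitzL_intertwining hT hs hV hΨ hΛ x

/-- `Ψ T(t)` intertwines as well, since the operators of the semigroup commute. Comparing the
intertwining identity for `Ψ T(t)` at `x` with that for `Ψ` at `T(t)x`, and applying `Λ`, gives the
claim. -/
theorem toeplitzCalculus_comm (g : HInfMinus) {t : ℝ} (ht : 0 ≤ t) (x : X) :
    toeplitzCalculus hT hs hΨ hΛ g (T t x) = T t (toeplitzCalculus hT hs hΨ hΛ g x) := by
  have hV : IsIntertwining T (Ψ ∘L T t) := fun r hr x => by
    have h1 := hT.map_add t r ht hr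
    have h2 := hT.map_add r t hr ht
    rw [add_comm, h1] at h2
    rw [ContinuousLinearMap.comp_apply, hΨ r hr]
    exact congrArg Ψ (DFunLike.congr_fun h2 x).symm
  have h1 := toeplitzL_boundaryLp_intertwining hT hs hΨ hΛ hΨ g (T t x)
  have h2 := toeplitzL_boundaryLp_intertwining hT hs hΨ hΛ hV g x
  have h3 := congrArg Λ (h1.symm.trans h2)
  simpa only [ContinuousLinearMap.comp_apply, hΛ] using h3

/-- The orbit map is itself intertwining, although it need not be left invertible; the intertwining
identity for it is the defining relation of `g(A)`. -/
theorem isFunctionOfGenerator_toeplitzCalculus (g : HInfMinus) : IsFunctionOfGenerator T g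
    ((toeplitzCalculus hT hs hΨ hΛ g : X →ₗ[ℂ] X).toPMap (generator T).domain) := by
  obtain ⟨V, hV1, -, hVT⟩ := hT.exists_orbit hs
  refine isFunctionOfGenerator_toPMap hT hs
    (fun t ht x => toeplitzCalculus_comm hT hs hΨ hΛ g ht x) fun x => ?_
  rw [toeplitz_eq_toeplitzL, ← hV1, ← hV1]
  exact toeplitzL_boundaryLp_intertwining hT hs hΨ hΛ hVT g x

theorem norm_toeplitzCalculus_le (g : HInfMinus) :
    ‖toeplitzCalculus hT hs hΨ hΛ g‖ ≤ ‖Λ‖ * ‖Ψ‖ * hInfNorm g := by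
  change ‖Λ ∘L toeplitzL X (boundaryLp g) ∘L Ψ‖ ≤ _
  have h1 : ‖toeplitzL X (boundaryLp g)‖ ≤ hInfNorm g :=
    (norm_toeplitzL_le _).trans (norm_boundaryLp_le g.2)
  calc ‖Λ ∘L toeplitzL X (boundaryLp g) ∘L Ψ‖
      ≤ ‖Λ‖ * (‖toeplitzL X (boundaryLp g)‖ * ‖Ψ‖) :=
        (ContinuousLinearMap.opNorm_comp_le _ _).trans
          (mul_le_mul_of_nonneg_left (ContinuousLinearMap.opNorm_comp_le _ _) (norm_nonneg _))
    _ ≤ ‖Λ‖ * (hInfNorm g * ‖Ψ‖) := by gcongr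
    _ = _ := by ring

/-- The symbol has weight `-e^{-ar}`, so the calculus gives minus the Laplace transform of the
semigroup at `a`, which is `(A - a)⁻¹`. -/
theorem toeplitzCalculus_resolvent {a : ℂ} (ha : 0 < a.re) (g : HInfMinus)
    (hga : ∀ s ∈ leftHalfPlane, (g : ℂ → ℂ) s = (s - a)⁻¹) (x : X) :
    toeplitzCalculus hT hs hΨ hΛ g x = -∫ r in Ioi (0 : ℝ), rescaledSemigroup a T r x := by
  change Λ (toeplitzL X (boundaryLp g) (Ψ x)) = _
  rw [(isLaplaceSymbol_boundaryLp_resolvent ha g.2 hga).toeplitzL_intertwining hT hs hΨ, hΛ,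
    ← integral_neg]
  simp only [rescaledSemigroup, neg_smul]
  rfl

end Calculus

end FunctionalCalculus

/-! ### The theorem -/

theorem theoremT3p4 {X : Type*} [NormedAddCommGroup X] [InnerProductSpace ℂ X] [CompleteSpace X]
    [TopologicalSpace.SeparableSpace X] (T : ℝ → X →L[ℂ] X)
    (hT : IsC0Semigroup T) (hstable : IsExponentiallyStable T)
    (hadm : IsAdmissible T (negGeneratorPow T (1 / 2)))
    (hadm_adjoint :
      IsAdmissible (adjointSemigroup T) (negGeneratorPow (adjointSemigroup T) (1 / 2))) :
    (∀ g ∈ HInfMinus, ∃! G : X →ₗ.[ℂ] X, IsFunctionOfGenerator T g G) ∧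
    (∀ g ∈ HInfMinus, ∀ G : X →ₗ.[ℂ] X, IsFunctionOfGenerator T g G →
      ∃ K : ℝ, ∀ x : G.domain, ‖G x‖ ≤ K * ‖(x : X)‖) ∧
    HasBoundedHInfCalculus T := by
  obtain ⟨Ψ, Λ, hΨ, hΛ⟩ := hT.exists_leftInvertible_intertwining hstable hadm hadm_adjoint
  have hΦ := isFunctionOfGenerator_toeplitzCalculus hT hstable hΨ hΛ
  refine ⟨fun g hg => ⟨_, hΦ ⟨g, hg⟩, fun G hG => hG.unique hT (hΦ ⟨g, hg⟩)⟩,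
    fun g hg G hG => ?_, toeplitzCalculus hT hstable hΨ hΛ, hΦ,
    ⟨‖Λ‖ * ‖Ψ‖, norm_toeplitzCalculus_le hT hstable hΨ hΛ⟩, fun a g ha hga => ⟨fun x => ?_, ?_⟩⟩
  -- By uniqueness `G` is the restriction of a bounded operator.
  · obtain rfl := hG.unique hT (hΦ ⟨g, hg⟩)
    exact ⟨_, fun x => (toeplitzCalculus hT hstable hΨ hΛ ⟨g, hg⟩).le_opNorm x⟩
  · rw [toeplitzCalculus_resolvent hT hstable hΨ hΛ ha g hga, generator_graph]
    -- With `w = ∫_0^∞ e^{-ar} T(r)x dr`, the generator `A - a` of the rescaled semigroup sends `w`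
    -- to `-x`; undoing the shift and changing signs gives the pair for `Φ g x = -w`.
    have h := mem_generatorGraph_of_rescaled a
      ((hT.rescaled a).integral_mem_generatorGraph (hstable.rescaled ha.le) x)
    have h' := neg_mem h
    rwa [Prod.neg_mk, neg_add, neg_neg, ← smul_neg] at h'
  · intro x
    have hx := (generator T).mem_graph x
    rw [generator_graph] at hx
    rw [toeplitzCalculus_resolvent hT hstable hΨ hΛ ha g hga,
      (hT.rescaled a).integral_of_mem_generatorGraph (hstable.rescaled ha.le)
        (mem_generatorGraph_rescaled a hx), neg_neg]

end
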